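/- Let $n\ge 3$, $B\ge 0$ and $T_0>0$, and let $D^n_{r}\subset\mathbb R^n$ be the closed disc of radius $r$ centred at $0$. Write $t=|x|$ and let $d\xi^2$ be the standard metric of the unit sphere $S^{n-1}$, pulled back to $\mathbb R^n\setminus\{0\}$ along $x\mapsto x/|x|$. Let $W$ be the space of all smooth Riemannian metrics $h$ on $D^n_{T_0}$ (smooth up to the boundary) which on $D^n_{T_0}\setminus\{0\}$ have the form $h=g(t)^2dt^2+f(t)^2d\xi^2$ with positive functions $g,f$ on $(0,T_0]$, and whose scalar curvature is greater than $B$ everywhere on $D^n_{T_0}$. The space $W$ carries the $C^\infty$ topology (uniform convergence on $D^n_{T_0}$ of the metric and of all its derivatives). Fix a torpedo metric $g_0=dt^2+f_0(t)^2d\xi^2$ of some radius $\varepsilon_0>0$ and size $T_0$ that belongs to $W$. Here $f_0$ is a smooth concave function on $[0,T_0]$ with $f_0(t)=\varepsilon_0\sin(t/\varepsilon_0)$ for $t$ near $0$ and $f_0(t)=\varepsilon_0$ for $t$ near $T_0$. Let $W^{\mathrm{loc}}\subset W$ be the subspace of locally torpedo metrics, that is, of those $h\in W$ for which there is a number $c$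 with $0<c\le T_0$ such that $$h=\Big(\frac{T_0}{c}\Big)^2dt^2+f_0\Big(\frac{T_0}{c}\,t\Big)^2d\xi^2\qquad\text{on } D^n_c\setminus\{0\}.$$ Then there exist a number $\delta$ with $0<\delta<T_0$ and a continuous map $\Psi\colon W\times[0,1]\to W$ such that (i) $\Psi(h,0)=h$ for all $h\in W$; (ii) $\Psi(h,1)\in W^{\mathrm{loc}}$ for all $h\in W$; (iii) $\Psi(h,s)=h$ on the annulus $\{x : T_0-\delta\le|x|\le T_0\}$ for all $h\in W$ and all $s\in[0,1]$. -/

import Mathlib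

open Set
open scoped ContDiff

noncomputable section

/-- Euclidean space `ℝⁿ`. -/
abbrev Euc (n : ℕ) : Type := EuclideanSpace ℝ (Fin n)

/-- The closed disc of radius `T` centred at the origin of `ℝⁿ`. -/
abbrev disc (n : ℕ) (T : ℝ) : Set (Euc n) := Metric.closedBall (0 : Euc n) T

/-- A smooth Riemannian metric on the closed disc of radius `T`, smooth up to the boundary. It is
given by its bilinear form at each point, in the global chart of `ℝⁿ`. The value outside the disc
carries no information and is normalised to `0`, so that two metrics are equal if and only if they
agree on the disc. -/
@[ext]
structure DiscMetric (n : ℕ) (T : ℝ) where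
  toFun : Euc n → LinearMap.BilinForm ℝ (Euc n)
  symm : ∀ x ∈ disc n T, ∀ v w, toFun x v w = toFun x w v
  posDef : ∀ x ∈ disc n T, ∀ v, v ≠ 0 → 0 < toFun x v v
  smooth : ∀ v w, ContDiffOn ℝ ∞ (fun x => toFun x v w) (disc n T)
  zero_off : ∀ x, x ∉ disc n T → toFun x = 0

namespace DiscMetric

variable {n : ℕ} {T : ℝ}

/-- The `k`-th derivative of the coefficient function `x ↦ h_x(v, w)` of a metric, as a function on
the disc, with values in the space of functions with the topology of uniform convergence. -/
def jet (k : ℕ) (v w : Euc n) (h : DiscMetric n T) :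
    UniformFun (disc n T) (Euc n [×k]→L[ℝ] ℝ) :=
  UniformFun.ofFun fun x => iteratedFDerivWithin ℝ k (fun y => h.toFun y v w) (disc n T) x

/-- The `C^∞` topology on the space of metrics: uniform convergence on the disc of the coefficients
of the metric and of all their derivatives (with respect to the flat reference metric). -/
instance : TopologicalSpace (DiscMetric n T) :=
  ⨅ (k : ℕ) (v : Euc n) (w : Euc n), TopologicalSpace.induced (jet k v w) inferInstance

/-- The standard basis vector `e_i`. -/
def basisVec (i : Fin n) : Euc n := EuclideanSpace.single i 1

/-- The partial derivative `∂_k u` of a function on the disc (one-sided at the boundary). -/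
def partialDeriv (T : ℝ) (k : Fin n) (u : Euc n → ℝ) (x : Euc n) : ℝ :=
  fderivWithin ℝ u (disc n T) x (basisVec k)

/-- The matrix `(h_{ij}(x))` of the metric. -/
def gram (h : DiscMetric n T) (x : Euc n) : Matrix (Fin n) (Fin n) ℝ :=
  Matrix.of fun i j => h.toFun x (basisVec i) (basisVec j)

/-- The Christoffel symbol
`Γ^k_{ij} = ½ ∑_l h^{kl} (∂_i h_{jl} + ∂_j h_{il} - ∂_l h_{ij})` of the Levi-Civita connection. -/
def christoffel (h : DiscMetric n T) (k i j : Fin n) (x : Euc n) : ℝ :=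
  (1 / 2) * ∑ l, (h.gram x)⁻¹ k l *
    (partialDeriv T i (fun y => h.gram y j l) x + partialDeriv T j (fun y => h.gram y i l) x
      - partialDeriv T l (fun y => h.gram y i j) x)

/-- The Ricci curvature
`R_{ij} = ∑_k (∂_k Γ^k_{ij} - ∂_j Γ^k_{ik}) + ∑_{k,l} (Γ^k_{kl} Γ^l_{ij} - Γ^k_{jl} Γ^l_{ik})`. -/
def ricci (h : DiscMetric n T) (i j : Fin n) (x : Euc n) : ℝ :=
  ∑ k, (partialDeriv T k (h.christoffel k i j) x - partialDeriv T j (h.christoffel k i k) x)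
    + ∑ k, ∑ l, (h.christoffel k k l x * h.christoffel l i j x
      - h.christoffel k j l x * h.christoffel l i k x)

/-- The scalar curvature `κ = ∑_{i,j} h^{ij} R_{ij}`. -/
def scalarCurvature (h : DiscMetric n T) (x : Euc n) : ℝ :=
  ∑ i, ∑ j, (h.gram x)⁻¹ i j * h.ricci i j x

end DiscMetric

variable {n : ℕ}

/-- The radial one-form `dt`, where `t = |x|`, at a point `x ≠ 0`. -/
def radialForm (x v : Euc n) : ℝ := inner ℝ x v / ‖x‖

/-- The form `dξ²` at a point `x ≠ 0`: the pullback of the metric of the unit sphere along the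
radial projection `x ↦ x / |x|`, whose differential is `v ↦ (v - dt(v) x / |x|) / |x|`. -/
def sphereForm (x v w : Euc n) : ℝ :=
  (inner ℝ v w - radialForm x v * radialForm x w) / ‖x‖ ^ 2

/-- The form `a² dt² + b² dξ²` at a point `x ≠ 0`. -/
def warpedForm (a b : ℝ) (x v w : Euc n) : ℝ :=
  a ^ 2 * (radialForm x v * radialForm x w) + b ^ 2 * sphereForm x v w

/-- The metric is `g(t)² dt² + f(t)² dξ²` on the disc of radius `r` minus the origin. -/
def HasWarpingOn {T : ℝ} (h : DiscMetric n T) (r : ℝ) (g f : ℝ → ℝ) : Prop :=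
  ∀ x : Euc n, x ≠ 0 → ‖x‖ ≤ r → ∀ v w, h.toFun x v w = warpedForm (g ‖x‖) (f ‖x‖) x v w

/-- The space `W` of warped metrics `g(t)² dt² + f(t)² dξ²` on the disc of radius `T` whose scalar
curvature is greater than `B` everywhere. It carries the `C^∞` topology. -/
def warpedMetrics (n : ℕ) (T B : ℝ) : Set (DiscMetric n T) :=
  {h | (∃ g f : ℝ → ℝ, (∀ t ∈ Ioc 0 T, 0 < g t ∧ 0 < f t) ∧ HasWarpingOn h T g f) ∧
    ∀ x ∈ disc n T, B < h.scalarCurvature x}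

/-- `f` is the warping function of a torpedo metric of radius `ε` and size `T`: the distance to the
axis, as a function of the arc length from the pole, along a curve which starts as an arc of a
circle of radius `ε` centred on the axis, bends to the parallel of the axis at distance `ε`, and
ends in a segment of that parallel. -/
structure IsTorpedoFunction (ε T : ℝ) (f : ℝ → ℝ) : Prop where
  radius_pos : 0 < ε
  smooth : ContDiffOn ℝ ∞ f (Icc 0 T)
  concave : ConcaveOn ℝ (Icc 0 T) f
  cap : ∃ a ∈ Ioo 0 T, ∀ t ∈ Icc 0 a, f t = ε * Real.sin (t / ε)
  neck : ∃ b ∈ Ioo 0 T, ∀ t ∈ Icc b T, f t = ε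

/-- The space `W^loc` of locally torpedo metrics: those metrics in `W` that, for some
`0 < c ≤ T`, are the warped metric `(T / c, f₀ ((T / c) t))` on the disc of radius `c`. -/
def locallyTorpedoMetrics (n : ℕ) (T B : ℝ) (f₀ : ℝ → ℝ) : Set (DiscMetric n T) :=
  {h | h ∈ warpedMetrics n T B ∧
    ∃ c ∈ Ioc 0 T, HasWarpingOn h c (fun _ => T / c) (fun t => f₀ (T / c * t))}

end

/-! Put `dv = (g / f) dt`. Then `g² dt² + f² dξ²` is `f² (dv² + dξ²)`, a metric conformal to a
cylinder, and `v → -∞` at the origin. Write `U = f ^ α` with `α = (n - 2) / 2`. The scalar curvature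
`κ` satisfies `c κ U ^ q = α² U - U''`, where `c = α / (2 (n - 1))`, `q = 1 + 2 / α` and the primes
are derivatives in `v` (`scalarCurvature_conformal`). The right side is linear in `U`, and `c b U ^
q` is convex in `U` for `b ≥ 0`. So, for a fixed coordinate `v`, the positive functions with `c b U
^ q < α² U - U''` form a convex set, and two of them can be joined by a segment.

The metric to be joined to `h` comes from adding conformal factors. Near the origin `U` is
comparable with `exp (α v)`. The torpedo, continued along its cylindrical end and then narrowed
slowly, has a factor `y (w)` that satisfies the inequality everywhere and tends to `0` as `w → ∞`
(`exists_torpedoProfile`). It is placed far down the cylinder by `G = P (v - a) U + Q (v) y (v -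
a)`: the cutoff `P` removes `h` inside the torpedo, and `Q` removes `y` before `v = 0`. For very
negative `a`, `U` and `U'` are negligible where `P` varies, and `y`, `y'`, `y''` are negligible
where `Q` varies. In between, the linear terms add up. The nonlinear term is harmless when one
summand dominates, and also when the two are comparable, because then both are small (`glue_ineq`).
The segment from `U` to `G` therefore stays in `W`.

At its end a core disc carries the factor `y (v - a)`, but with the coordinate `v` inherited from
`h`, so it is a piece of the torpedo up to a radial diffeomorphism. The second half of the homotopy
moves this coordinate linearly to the coordinate of the torpedo itself, rescaled to the core. The
coordinate stays increasing in `t`, and the curvature equation only sees `y`, so the bound persists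
(`lt_scalarCurvature_of_core`).

The coordinate is normalised to vanish at `|x| = T₀ / 2` and all changes take place where `v < 0`,
whence `δ = T₀ / 2`. How negative `a` must be depends only on a bound for the geometry of `h` on the
disc of radius `T₀ / 2`. This bound can be taken continuous in `h`, and then so can `a`
(`exists_continuous_isAdmissible`). For continuity in the `C^∞` topology, and for smoothness at the
origin, everything is expressed by functions that are smooth on the ball, such as `g²`, `f² / t²`,
`v - log t` and `exp (2 v)`. They are obtained from `h` by operations that preserve
`IsSmoothFamily`. -/

open scoped Topology

/-! ### Families of functions with jointly continuous derivatives -/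

noncomputable section

/-- A family `F p` of functions on the open set `U`, depending on a parameter `p` in a topological
space, is a `C^k` family if the derivatives of `F p` of order at most `k` exist on `U` and are
jointly continuous in the parameter and the point. -/
def IsCkFamily {P : Type*} [TopologicalSpace P] {E : Type} [NormedAddCommGroup E] [NormedSpace ℝ E]
    (U : Set E) : ℕ → ∀ {G : Type} [NormedAddCommGroup G] [NormedSpace ℝ G], (P → E → G) → Prop
  | 0, _, _, _, F => ContinuousOn (fun q : P × E => F q.1 q.2) (univ ×ˢ U)
  | k + 1, G, _, _, F => ContinuousOn (fun q : P × E => F q.1 q.2) (univ ×ˢ U) ∧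
      ∃ dF : P → E → E →L[ℝ] G, (∀ p, ∀ x ∈ U, HasFDerivAt (F p) (dF p x) x) ∧ IsCkFamily U k dF

/-- A smooth family: all derivatives are jointly continuous in the parameter and the point. -/
def IsSmoothFamily {P : Type*} [TopologicalSpace P] {E : Type} [NormedAddCommGroup E]
    [NormedSpace ℝ E] (U : Set E) {G : Type} [NormedAddCommGroup G] [NormedSpace ℝ G]
    (F : P → E → G) : Prop :=
  ∀ k, IsCkFamily U k F

section FamilyCalculus

variable {P Q : Type*} [TopologicalSpace P] [TopologicalSpace Q]
  {E E₁ G G₁ G₂ G₃ : Type} [NormedAddCommGroup E] [NormedSpace ℝ E]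
  [NormedAddCommGroup E₁] [NormedSpace ℝ E₁]
  [NormedAddCommGroup G] [NormedSpace ℝ G] [NormedAddCommGroup G₁] [NormedSpace ℝ G₁]
  [NormedAddCommGroup G₂] [NormedSpace ℝ G₂] [NormedAddCommGroup G₃] [NormedSpace ℝ G₃]
  {U : Set E} {k : ℕ}

namespace IsCkFamily

theorem continuousOn {F : P → E → G} (h : IsCkFamily U k F) :
    ContinuousOn (fun q : P × E => F q.1 q.2) (univ ×ˢ U) := by
  cases k with
  | zero => exact h
  | succ k => exact h.1

theorem of_succ {F : P → E → G} (h : IsCkFamily U (k + 1) F) : IsCkFamily U k F := by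
  induction k generalizing G with
  | zero => exact h.1
  | succ k ih =>
    obtain ⟨h0, F', hF', h1⟩ := h
    exact ⟨h0, F', hF', ih h1⟩

theorem congr (hU : IsOpen U) {F F₁ : P → E → G} (h : IsCkFamily U k F)
    (he : ∀ p, ∀ x ∈ U, F₁ p x = F p x) : IsCkFamily U k F₁ := by
  have h0 : ContinuousOn (fun q : P × E => F₁ q.1 q.2) (univ ×ˢ U) :=
    h.continuousOn.congr fun q hq => he q.1 q.2 hq.2
  cases k with
  | zero => exact h0
  | succ k =>
    obtain ⟨_, F', hF', h1⟩ := h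
    refine ⟨h0, F', fun p x hx => ?_, h1⟩
    refine (hF' p x hx).congr_of_eventuallyEq ?_
    filter_upwards [hU.mem_nhds hx] with y hy using he p y hy

theorem const {c : P → G} (hc : Continuous c) :
    IsCkFamily U k (fun p (_ : E) => c p) := by
  induction k generalizing G with
  | zero => exact (hc.comp continuous_fst).continuousOn
  | succ k ih =>
    exact ⟨(hc.comp continuous_fst).continuousOn, fun _ _ => 0,
      fun p x _ => hasFDerivAt_const _ _, ih continuous_const⟩

theorem clm (L : E →L[ℝ] G) : IsCkFamily U k (fun (_ : P) x => L x) := by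
  have h0 : ContinuousOn (fun q : P × E => L q.2) (univ ×ˢ U) :=
    (L.continuous.comp continuous_snd).continuousOn
  cases k with
  | zero => exact h0
  | succ k => exact ⟨h0, fun _ _ => L, fun _ _ _ => L.hasFDerivAt, const continuous_const⟩

theorem comp_param {π : Q → P} (hπ : Continuous π) {F : P → E → G} (h : IsCkFamily U k F) :
    IsCkFamily U k (fun q => F (π q)) := by
  have key : ∀ {G : Type} [NormedAddCommGroup G] [NormedSpace ℝ G] {F : P → E → G},
      ContinuousOn (fun q : P × E => F q.1 q.2) (univ ×ˢ U) →
      ContinuousOn (fun q : Q × E => F (π q.1) q.2) (univ ×ˢ U) := by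
    intro G _ _ F hF
    exact hF.comp (t := univ ×ˢ U) (f := fun q : Q × E => (π q.1, q.2)) (by fun_prop)
      fun q hq => ⟨mem_univ _, hq.2⟩
  induction k generalizing G with
  | zero => exact key h
  | succ k ih =>
    obtain ⟨h0, F', hF', h1⟩ := h
    exact ⟨key h0, fun q => F' (π q), fun q x hx => hF' (π q) x hx, ih h1⟩

theorem add {F₁ F₂ : P → E → G} (h₁ : IsCkFamily U k F₁) (h₂ : IsCkFamily U k F₂) :
    IsCkFamily U k (fun p x => F₁ p x + F₂ p x) := by
  induction k generalizing G with
  | zero => exact ContinuousOn.add h₁ h₂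
  | succ k ih =>
    obtain ⟨a0, F₁', a1, a2⟩ := h₁
    obtain ⟨b0, F₂', b1, b2⟩ := h₂
    exact ⟨a0.add b0, fun p x => F₁' p x + F₂' p x, fun p x hx => (a1 p x hx).add (b1 p x hx),
      ih a2 b2⟩

/-- By the Leibniz rule the derivative is again a sum of bilinear expressions, with `B` replaced by
`precompR` and `precompL`. The induction must therefore range over all bilinear maps and target
spaces. -/
theorem bilin (B : G₁ →L[ℝ] G₂ →L[ℝ] G₃) {F₁ : P → E → G₁} {F₂ : P → E → G₂}
    (h₁ : IsCkFamily U k F₁) (h₂ : IsCkFamily U k F₂) :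
    IsCkFamily U k (fun p x => B (F₁ p x) (F₂ p x)) := by
  have key : ∀ {G₁ G₂ G₃ : Type} [NormedAddCommGroup G₁] [NormedSpace ℝ G₁]
      [NormedAddCommGroup G₂] [NormedSpace ℝ G₂] [NormedAddCommGroup G₃] [NormedSpace ℝ G₃]
      (B : G₁ →L[ℝ] G₂ →L[ℝ] G₃) {F₁ : P → E → G₁} {F₂ : P → E → G₂} {k : ℕ},
      IsCkFamily U k F₁ → IsCkFamily U k F₂ →
      ContinuousOn (fun q : P × E => B (F₁ q.1 q.2) (F₂ q.1 q.2)) (univ ×ˢ U) := by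
    intro _ _ _ _ _ _ _ _ _ B F₁ F₂ k h₁ h₂
    exact (B.continuous.comp_continuousOn h₁.continuousOn).clm_apply h₂.continuousOn
  induction k generalizing G₁ G₂ G₃ with
  | zero => exact key B h₁ h₂
  | succ k ih =>
    have h₁' := h₁.of_succ
    have h₂' := h₂.of_succ
    have h0 := key B h₁ h₂
    obtain ⟨a0, F₁', a1, a2⟩ := h₁
    obtain ⟨b0, F₂', b1, b2⟩ := h₂
    refine ⟨h0, fun p x => B.precompR E (F₁ p x) (F₂' p x) + B.precompL E (F₁' p x) (F₂ p x),
      fun p x hx => B.hasFDerivAt_of_bilinear (a1 p x hx) (b1 p x hx), ?_⟩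
    exact (ih (B.precompR E) h₁' b2).add (ih (B.precompL E) a2 h₂')

theorem comp {V : Set E₁} {H : P → E₁ → G} {F : P → E → E₁}
    (hH : IsCkFamily V k H) (hF : IsCkFamily U k F) (hm : ∀ p, ∀ x ∈ U, F p x ∈ V) :
    IsCkFamily U k (fun p x => H p (F p x)) := by
  have key : ∀ {G : Type} [NormedAddCommGroup G] [NormedSpace ℝ G] {H : P → E₁ → G} {k : ℕ},
      IsCkFamily V k H → 
      ContinuousOn (fun q : P × E => H q.1 (F q.1 q.2)) (univ ×ˢ U) := by
    intro _ _ _ H k hH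
    exact hH.continuousOn.comp (t := univ ×ˢ V) (f := fun q : P × E => (q.1, F q.1 q.2))
      (continuousOn_fst.prodMk hF.continuousOn) fun q hq => ⟨mem_univ _, hm q.1 q.2 hq.2⟩
  induction k generalizing G with
  | zero => exact key hH
  | succ k ih =>
    have h0 := key hH
    have hF0 := hF.of_succ
    obtain ⟨a0, H', a1, a2⟩ := hH
    obtain ⟨b0, F', b1, b2⟩ := hF
    refine ⟨h0, fun p x => (ContinuousLinearMap.compL ℝ E E₁ G) (H' p (F p x)) (F' p x),
      fun p x hx => (a1 p _ (hm p x hx)).comp x (b1 p x hx), ?_⟩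
    exact bilin _ (ih a2 hF0) b2

theorem of_contDiffOn (hU : IsOpen U) {f : E → G} (hf : ContDiffOn ℝ ∞ f U) :
    IsCkFamily U k (fun _ : P => f) := by
  have key : ContinuousOn (fun q : P × E => f q.2) (univ ×ˢ U) :=
    hf.continuousOn.comp continuousOn_snd fun q hq => hq.2
  induction k generalizing G with
  | zero => exact key
  | succ k ih =>
    have h := (contDiffOn_infty_iff_fderiv_of_isOpen hU).1 hf
    refine ⟨key, fun _ => fderiv ℝ f, fun _ x hx =>
      ((h.1 x hx).differentiableAt (hU.mem_nhds hx)).hasFDerivAt, ih h.2 ?_⟩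
    exact h.2.continuousOn.comp continuousOn_snd fun q hq => hq.2

theorem contDiffOn {F : P → E → G} (hU : IsOpen U) (h : IsCkFamily U k F) (p : P) :
    ContDiffOn ℝ k (F p) U := by
  induction k generalizing G with
  | zero =>
    refine contDiffOn_zero.2 ?_
    exact (continuousOn h).comp (f := fun x => (p, x)) (by fun_prop) fun x hx => ⟨mem_univ _, hx⟩
  | succ k ih =>
    obtain ⟨h0, F', hF', h1⟩ := h
    push_cast
    rw [contDiffOn_succ_iff_fderiv_of_isOpen hU]
    refine ⟨fun x hx => (hF' p x hx).differentiableAt.differentiableWithinAt, by simp, ?_⟩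
    exact (ih h1).congr fun x hx => (hF' p x hx).fderiv

theorem fderiv {F : P → E → G} (hU : IsOpen U) (h : IsCkFamily U (k + 1) F) :
    IsCkFamily U k (fun p => fderiv ℝ (F p)) := by
  obtain ⟨h0, F', hF', h1⟩ := h
  exact h1.congr hU fun p x hx => (hF' p x hx).fderiv

/-- Together with `of_iteratedFDeriv` this translates between nested Fréchet derivatives, which suit
the chain and product rules, and iterated derivatives, in which the `C^∞` topology is defined. -/
theorem continuousOn_iteratedFDeriv (hU : IsOpen U) {F : P → E → G} (h : IsCkFamily U k F) :
    ContinuousOn (fun q : P × E => iteratedFDeriv ℝ k (F q.1) q.2) (univ ×ˢ U) := by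
  induction k generalizing G with
  | zero =>
    simp only [iteratedFDeriv_zero_eq_comp]
    exact (LinearIsometryEquiv.continuous _).comp_continuousOn h
  | succ k ih =>
    have := ih (h.fderiv hU)
    have h2 := (continuousMultilinearCurryRightEquiv' ℝ k E G).symm.continuous.comp_continuousOn this
    refine h2.congr fun q _ => ?_
    rw [iteratedFDeriv_succ_eq_comp_right]; rfl

theorem of_iteratedFDeriv (hU : IsOpen U) {F : P → E → G} (hs : ∀ p, ContDiffOn ℝ ∞ (F p) U)
    (h : ∀ j, ContinuousOn (fun q : P × E => iteratedFDeriv ℝ j (F q.1) q.2) (univ ×ˢ U)) :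
    IsCkFamily U k F := by
  have key : ContinuousOn (fun q : P × E => F q.1 q.2) (univ ×ˢ U) := by
    have := (continuousMultilinearCurryFin0 ℝ E G).continuous.comp_continuousOn (h 0)
    refine this.congr fun q _ => ?_
    simp [iteratedFDeriv_zero_apply]
  induction k generalizing G with
  | zero => exact key
  | succ k ih =>
    have hs' := fun p => (contDiffOn_infty_iff_fderiv_of_isOpen hU).1 (hs p)
    have hj : ∀ j, ContinuousOn
        (fun q : P × E => iteratedFDeriv ℝ j (_root_.fderiv ℝ (F q.1)) q.2) (univ ×ˢ U) := by
      intro j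
      have := (continuousMultilinearCurryRightEquiv' ℝ j E G).continuous.comp_continuousOn (h (j+1))
      refine this.congr fun q _ => ?_
      simp only [Function.comp_apply]
      rw [iteratedFDeriv_succ_eq_comp_right]
      simp
    refine ⟨key, fun p => _root_.fderiv ℝ (F p), fun p x hx =>
      (((hs' p).1 x hx).differentiableAt (hU.mem_nhds hx)).hasFDerivAt,
      ih (fun p => (hs' p).2) hj ?_⟩
    have := (continuousMultilinearCurryFin0 ℝ E (E →L[ℝ] G)).continuous.comp_continuousOn (hj 0)
    refine this.congr fun q _ => ?_
    simp [iteratedFDeriv_zero_apply]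

end IsCkFamily

namespace IsSmoothFamily

variable {F F₁ F₂ : P → E → G}

theorem continuousOn (h : IsSmoothFamily U F) :
    ContinuousOn (fun q : P × E => F q.1 q.2) (univ ×ˢ U) := h 0

theorem congr (hU : IsOpen U) (h : IsSmoothFamily U F)
    (he : ∀ p, ∀ x ∈ U, F₁ p x = F p x) : IsSmoothFamily U F₁ := fun k => (h k).congr hU he

theorem const {c : P → G} (hc : Continuous c) : IsSmoothFamily U (fun p (_ : E) => c p) :=
  fun _ => .const hc

theorem clm (L : E →L[ℝ] G) : IsSmoothFamily U (fun (_ : P) x => L x) := fun _ => .clm L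

theorem id : IsSmoothFamily U (fun (_ : P) (x : E) => x) := fun _ => .clm (.id ℝ E)

theorem comp_param {π : Q → P} (hπ : Continuous π) (h : IsSmoothFamily U F) :
    IsSmoothFamily U (fun q => F (π q)) := fun k => (h k).comp_param hπ

theorem add (h₁ : IsSmoothFamily U F₁) (h₂ : IsSmoothFamily U F₂) :
    IsSmoothFamily U (fun p x => F₁ p x + F₂ p x) := fun k => (h₁ k).add (h₂ k)

theorem bilin (B : G₁ →L[ℝ] G₂ →L[ℝ] G₃) {F₁ : P → E → G₁} {F₂ : P → E → G₂}
    (h₁ : IsSmoothFamily U F₁) (h₂ : IsSmoothFamily U F₂) :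
    IsSmoothFamily U (fun p x => B (F₁ p x) (F₂ p x)) := fun k => (h₁ k).bilin B (h₂ k)

theorem comp {V : Set E₁} {H : P → E₁ → G} {F : P → E → E₁} (hH : IsSmoothFamily V H)
    (hF : IsSmoothFamily U F) (hm : ∀ p, ∀ x ∈ U, F p x ∈ V) :
    IsSmoothFamily U (fun p x => H p (F p x)) := fun k => (hH k).comp (hF k) hm

theorem of_contDiffOn (hU : IsOpen U) {f : E → G} (hf : ContDiffOn ℝ ∞ f U) :
    IsSmoothFamily U (fun _ : P => f) := fun _ => .of_contDiffOn hU hf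

theorem contDiffOn (hU : IsOpen U) (h : IsSmoothFamily U F) (p : P) :
    ContDiffOn ℝ ∞ (F p) U :=
  contDiffOn_infty.2 fun k => (h k).contDiffOn hU p

theorem fderiv (hU : IsOpen U) (h : IsSmoothFamily U F) :
    IsSmoothFamily U (fun p => fderiv ℝ (F p)) := fun k => (h (k + 1)).fderiv hU

theorem clm_apply {L : P → E → G₁ →L[ℝ] G₂} {F : P → E → G₁} (hL : IsSmoothFamily U L)
    (hF : IsSmoothFamily U F) : IsSmoothFamily U (fun p x => L p x (F p x)) :=
  bilin (ContinuousLinearMap.id ℝ _) hL hF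

theorem clm_comp (L : G₁ →L[ℝ] G₂) {F : P → E → G₁} (hF : IsSmoothFamily U F) :
    IsSmoothFamily U (fun p x => L (F p x)) := clm_apply (const continuous_const) hF

theorem neg (h : IsSmoothFamily U F) : IsSmoothFamily U (fun p x => - F p x) := by
  simpa using clm_comp (-ContinuousLinearMap.id ℝ G) h

theorem sub (h₁ : IsSmoothFamily U F₁) (h₂ : IsSmoothFamily U F₂) :
    IsSmoothFamily U (fun p x => F₁ p x - F₂ p x) := by
  simpa only [sub_eq_add_neg] using h₁.add h₂.neg

theorem smul {f : P → E → ℝ} (hf : IsSmoothFamily U f) (hF : IsSmoothFamily U F) :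
    IsSmoothFamily U (fun p x => f p x • F p x) :=
  bilin (ContinuousLinearMap.lsmul ℝ ℝ) hf hF

theorem mul {f g : P → E → ℝ} (hf : IsSmoothFamily U f) (hg : IsSmoothFamily U g) :
    IsSmoothFamily U (fun p x => f p x * g p x) := hf.smul hg

theorem pow {f : P → E → ℝ} (hf : IsSmoothFamily U f) (m : ℕ) :
    IsSmoothFamily U (fun p x => f p x ^ m) := by
  induction m with
  | zero => simpa using const (P := P) (U := U) (continuous_const (y := (1 : ℝ)))
  | succ m ih => simpa only [pow_succ] using ih.mul hf

theorem sum {ι : Type*} (s : Finset ι) {f : ι → P → E → G}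
    (hf : ∀ i ∈ s, IsSmoothFamily U (f i)) :
    IsSmoothFamily U (fun p x => ∑ i ∈ s, f i p x) := by
  classical
  induction s using Finset.induction_on with
  | empty => simpa using const (P := P) (U := U) (continuous_const (y := (0 : G)))
  | insert i s hi ih =>
    simp only [Finset.sum_insert hi]
    exact (hf i (by simp)).add (ih fun j hj => hf j (by simp [hj]))

theorem prod {ι : Type*} (s : Finset ι) {f : ι → P → E → ℝ}
    (hf : ∀ i ∈ s, IsSmoothFamily U (f i)) :
    IsSmoothFamily U (fun p x => ∏ i ∈ s, f i p x) := by
  classical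
  induction s using Finset.induction_on with
  | empty => simpa using const (P := P) (U := U) (continuous_const (y := (1 : ℝ)))
  | insert i s hi ih =>
    simp only [Finset.prod_insert hi]
    exact (hf i (by simp)).mul (ih fun j hj => hf j (by simp [hj]))

theorem comp_contDiffOn {O : Set G} (hO : IsOpen O) {H : G → G₁} (hH : ContDiffOn ℝ ∞ H O)
    (hF : IsSmoothFamily U F) (hm : ∀ p, ∀ x ∈ U, F p x ∈ O) :
    IsSmoothFamily U (fun p x => H (F p x)) :=
  comp (of_contDiffOn hO hH) hF hm

theorem comp_contDiff {H : G → G₁} (hH : ContDiff ℝ ∞ H) (hF : IsSmoothFamily U F) :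
    IsSmoothFamily U (fun p x => H (F p x)) :=
  comp_contDiffOn isOpen_univ hH.contDiffOn hF fun _ _ _ => mem_univ _

theorem inv {f : P → E → ℝ} (hf : IsSmoothFamily U f) (h0 : ∀ p, ∀ x ∈ U, f p x ≠ 0) :
    IsSmoothFamily U (fun p x => (f p x)⁻¹) :=
  comp_contDiffOn (isOpen_compl_singleton (x := (0 : ℝ)))
    (contDiffOn_inv ℝ) hf h0

theorem div {f g : P → E → ℝ} (hf : IsSmoothFamily U f) (hg : IsSmoothFamily U g)
    (h0 : ∀ p, ∀ x ∈ U, g p x ≠ 0) : IsSmoothFamily U (fun p x => f p x / g p x) := by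
  simpa only [div_eq_mul_inv] using hf.mul (hg.inv h0)

theorem exp {f : P → E → ℝ} (hf : IsSmoothFamily U f) :
    IsSmoothFamily U (fun p x => Real.exp (f p x)) := comp_contDiff Real.contDiff_exp hf

theorem rpow_const {f : P → E → ℝ} (hf : IsSmoothFamily U f) (r : ℝ)
    (h0 : ∀ p, ∀ x ∈ U, 0 < f p x) : IsSmoothFamily U (fun p x => f p x ^ r) :=
  comp_contDiffOn (isOpen_Ioi (a := (0 : ℝ)))
    (fun y (hy : 0 < y) => (Real.contDiffAt_rpow_const_of_ne hy.ne').contDiffWithinAt) hf h0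

end IsSmoothFamily

/-! ### Integrals of families over a compact space -/

section Integral

set_option linter.unusedSectionVars false

variable {X : Type*} [TopologicalSpace X] [CompactSpace X]

/-- Currying turns a jointly continuous map with a compact variable `σ` into a continuous map to the
continuous functions of `σ` with the supremum metric. As `U` is open, neighbourhoods in `P × U` are
neighbourhoods in `P × E`. -/
theorem eventually_forall_dist_lt_of_continuousOn {M : Type*} [PseudoMetricSpace M] (hU : IsOpen U)
    {F : P × X → E → M} (hF : ContinuousOn (fun q : (P × X) × E => F q.1 q.2) (univ ×ˢ U))
    (p₀ : P) {x₀ : E} (hx₀ : x₀ ∈ U) {ε : ℝ} (hε : 0 < ε) :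
    ∀ᶠ q : P × E in 𝓝 (p₀, x₀), ∀ σ, dist (F (q.1, σ) q.2) (F (p₀, σ) x₀) < ε := by
  have hc : Continuous (fun z : (P × U) × X => F (z.1.1, z.2) z.1.2) := by
    rw [continuous_iff_continuousAt]
    intro z
    have h1 := hF.continuousAt (x := ((z.1.1, z.2), (z.1.2 : E)))
      ((isOpen_univ.prod hU).mem_nhds ⟨mem_univ _, z.1.2.2⟩)
    exact ContinuousAt.comp (f := fun z : (P × U) × X => ((z.1.1, z.2), (z.1.2 : E))) h1
      (by fun_prop)
  let f := ContinuousMap.curry ⟨_, hc⟩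
  have h2 := (Metric.continuous_iff'.1 f.continuous (p₀, ⟨x₀, hx₀⟩) ε hε)
  have h3 : 𝓝 (p₀, x₀) = Filter.map (fun z : P × U => (z.1, (z.2 : E))) (𝓝 (p₀, ⟨x₀, hx₀⟩)) := by
    have : Topology.IsOpenEmbedding (fun z : P × U => (z.1, (z.2 : E))) :=
      Topology.IsOpenEmbedding.id.prodMap hU.isOpenEmbedding_subtypeVal
    exact (this.map_nhds_eq (p₀, ⟨x₀, hx₀⟩)).symm
  rw [h3, Filter.eventually_map]
  filter_upwards [h2] with z hz σ
  exact lt_of_le_of_lt (ContinuousMap.dist_apply_le_dist (f := f z) (g := f (p₀, ⟨x₀, hx₀⟩)) σ) hz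

variable [MeasurableSpace X] [BorelSpace X] (μ : MeasureTheory.Measure X)
  [MeasureTheory.IsFiniteMeasure μ]

open MeasureTheory

theorem continuousOn_integral_of_family (hU : IsOpen U) {F : P × X → E → G}
    (hF : ContinuousOn (fun q : (P × X) × E => F q.1 q.2) (univ ×ˢ U)) :
    ContinuousOn (fun q : P × E => ∫ σ, F (q.1, σ) q.2 ∂μ) (univ ×ˢ U) := by
  have hslice : ∀ p, ∀ x ∈ U, Continuous fun σ => F (p, σ) x := fun p x hx =>
    hF.comp_continuous (f := fun σ => ((p, σ), x)) (by fun_prop) fun σ => ⟨mem_univ _, hx⟩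
  have hint : ∀ p, ∀ x ∈ U, Integrable (fun σ => F (p, σ) x) μ := fun p x hx =>
    (hslice p x hx).integrable_of_hasCompactSupport (HasCompactSupport.of_compactSpace _)
  rintro ⟨p₀, x₀⟩ ⟨-, hx₀⟩
  refine ContinuousAt.continuousWithinAt ?_
  rw [Metric.continuousAt_iff']
  intro ε hε
  set m : ℝ := μ.real univ
  have hm : 0 ≤ m := measureReal_nonneg
  have hU' : ∀ᶠ q : P × E in 𝓝 (p₀, x₀), q.2 ∈ U :=
    continuous_snd.continuousAt.eventually (hU.mem_nhds hx₀)
  -- The `+ 1` in the denominator covers a measure of total mass zero.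
  filter_upwards [eventually_forall_dist_lt_of_continuousOn hU hF p₀ hx₀
    (show 0 < ε / (m + 1) by positivity), hU'] with q hq hqU
  rw [dist_eq_norm, ← integral_sub (hint _ _ hqU) (hint _ _ hx₀)]
  calc _ ≤ ε / (m + 1) * m := norm_integral_le_of_norm_le_const (Filter.Eventually.of_forall
        fun σ => by rw [← dist_eq_norm]; exact (hq σ).le)
    _ < ε := by rw [div_mul_eq_mul_div, div_lt_iff₀ (by positivity)]; nlinarith

variable [SecondCountableTopology X]

theorem IsCkFamily.integral (hU : IsOpen U) {F : P × X → E → G} (hF : IsCkFamily U k F) :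
    IsCkFamily U k (fun p x => ∫ σ, F (p, σ) x ∂μ) := by
  induction k generalizing G with
  | zero => exact continuousOn_integral_of_family μ hU hF
  | succ k ih =>
    obtain ⟨h0, F', hF', h1⟩ := hF
    refine ⟨continuousOn_integral_of_family μ hU h0, fun p x => ∫ σ, F' (p, σ) x ∂μ, ?_, ih h1⟩
    intro p x hx
    have hcont : ∀ {G : Type} [NormedAddCommGroup G] [NormedSpace ℝ G] {F : P × X → E → G},
        ContinuousOn (fun q : (P × X) × E => F q.1 q.2) (univ ×ˢ U) → ∀ x ∈ U,
        Continuous fun σ => F (p, σ) x := fun hF x hx =>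
      hF.comp_continuous (f := fun σ => ((p, σ), x)) (by fun_prop) fun σ => ⟨mem_univ _, hx⟩
    have hc' := hcont h1.continuousOn x hx
    -- By compactness the derivative at `x` is bounded by `b` for all `σ`, and near `x` it changes
    -- by less than `1` uniformly in `σ`. So the constant `b + 1` dominates it.
    obtain ⟨b, hb⟩ := (isCompact_range hc'.norm).bddAbove
    have h2 := eventually_forall_dist_lt_of_continuousOn hU h1.continuousOn p hx one_pos
    have h3 : ∀ᶠ y in 𝓝 x, ∀ σ, dist (F' (p, σ) y) (F' (p, σ) x) < 1 :=
      (Continuous.prodMk_right p).continuousAt.eventually h2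
    refine hasFDerivAt_integral_of_dominated_of_fderiv_le (F := fun y σ => F (p, σ) y)
      (F' := fun y σ => F' (p, σ) y) (bound := fun _ => b + 1)
      (Filter.inter_mem h3 (hU.mem_nhds hx)) ?_ ?_ ?_ ?_ (integrable_const _) ?_
    · filter_upwards [hU.mem_nhds hx] with y hy
      exact (hcont h0 y hy).aestronglyMeasurable
    · exact (hcont h0 x hx).integrable_of_hasCompactSupport (HasCompactSupport.of_compactSpace _)
    · exact hc'.aestronglyMeasurable
    · refine Filter.Eventually.of_forall fun σ y hy => ?_
      have h4 := hy.1 σ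
      rw [dist_eq_norm] at h4
      have h5 : ‖F' (p, σ) x‖ ≤ b := hb (mem_range_self σ)
      calc ‖F' (p, σ) y‖ = ‖F' (p, σ) x + (F' (p, σ) y - F' (p, σ) x)‖ := by congr 1; abel
        _ ≤ _ := (norm_add_le _ _).trans (by linarith)
    · exact Filter.Eventually.of_forall fun σ y hy => hF' (p, σ) y hy.2

theorem IsSmoothFamily.integral (hU : IsOpen U) {F : P × X → E → G} (hF : IsSmoothFamily U F) :
    IsSmoothFamily U (fun p x => ∫ σ, F (p, σ) x ∂μ) := fun k => (hF k).integral μ hU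

end Integral

end FamilyCalculus

end

/-! ### The `C^∞` topology, and curvature as a smooth family -/

noncomputable section

namespace DiscMetric

variable {n : ℕ} {T : ℝ} {P : Type*} [TopologicalSpace P]

theorem continuous_jet (k : ℕ) (v w : Euc n) :
    Continuous (jet k v w : DiscMetric n T → _) := by
  refine continuous_iff_le_induced.2 ?_
  exact (iInf_le _ k).trans ((iInf_le _ v).trans (iInf_le _ w))

theorem continuous_of_jet {Φ : P → DiscMetric n T}
    (h : ∀ k v w, Continuous fun p => jet k v w (Φ p)) : Continuous Φ := by
  refine continuous_iInf_rng.2 fun k => continuous_iInf_rng.2 fun v => continuous_iInf_rng.2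
    fun w => continuous_induced_rng.2 (h k v w)

theorem iteratedFDerivWithin_disc {G : Type*} [NormedAddCommGroup G] [NormedSpace ℝ G]
    {f : Euc n → G} {x : Euc n} (hx : x ∈ Metric.ball (0 : Euc n) T) (k : ℕ) :
    iteratedFDerivWithin ℝ k f (disc n T) x = iteratedFDeriv ℝ k f x := by
  have : disc n T =ᶠ[𝓝 x] univ := by
    rw [Filter.eventuallyEq_univ]
    exact Filter.mem_of_superset (Metric.isOpen_ball.mem_nhds hx) Metric.ball_subset_closedBall
  rw [iteratedFDerivWithin_congr_set this, iteratedFDerivWithin_univ]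

/-- Joint continuity combines uniform closeness of the jets of `h` and `h₀` with continuity in `x`
of the jet of `h₀`. On the open ball the derivatives within the disc are ordinary derivatives. -/
theorem isSmoothFamily_toFun (v w : Euc n) :
    IsSmoothFamily (Metric.ball (0 : Euc n) T)
      (fun (h : DiscMetric n T) x => h.toFun x v w) := by
  have hsm : ∀ h : DiscMetric n T,
      ContDiffOn ℝ ∞ (fun x => h.toFun x v w) (Metric.ball (0 : Euc n) T) :=
    fun h => (h.smooth v w).mono Metric.ball_subset_closedBall
  intro k
  refine IsCkFamily.of_iteratedFDeriv Metric.isOpen_ball hsm fun j => ?_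
  rintro ⟨h₀, x₀⟩ ⟨-, hx₀⟩
  refine ContinuousAt.continuousWithinAt ?_
  rw [Metric.continuousAt_iff']
  intro ε hε
  have h1 : ContinuousAt (fun x => iteratedFDeriv ℝ j (fun x => h₀.toFun x v w) x) x₀ := by
    have := ((hsm h₀).continuousOn_iteratedFDerivWithin (m := j) (by exact_mod_cast le_top)
      Metric.isOpen_ball.uniqueDiffOn)
    refine (this.congr fun x hx => ?_).continuousAt (Metric.isOpen_ball.mem_nhds hx₀)
    exact (iteratedFDerivWithin_of_isOpen j Metric.isOpen_ball hx).symm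
  have h2 := (continuous_jet (T := T) j v w).continuousAt (x := h₀)
  rw [ContinuousAt, UniformFun.tendsto_iff_tendstoUniformly, Metric.tendstoUniformly_iff] at h2
  have h3 := (continuous_fst.continuousAt (x := (h₀, x₀))).eventually (h2 (ε / 2) (by positivity))
  have h4 := (continuous_snd.continuousAt (x := (h₀, x₀))).eventually
    ((Metric.continuousAt_iff'.1 h1 (ε / 2) (by positivity)).and (Metric.isOpen_ball.mem_nhds hx₀))
  filter_upwards [h3, h4] with q hq1 hq2
  have h5 := hq1 ⟨q.2, Metric.ball_subset_closedBall hq2.2⟩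
  simp only [jet, Function.comp_apply, UniformFun.toFun_ofFun] at h5
  rw [iteratedFDerivWithin_disc hq2.2, iteratedFDerivWithin_disc hq2.2, dist_comm] at h5
  calc _ ≤ _ := dist_triangle _ (iteratedFDeriv ℝ j (fun x => h₀.toFun x v w) q.2) _
    _ < ε := by linarith [hq2.1]

/-- A smooth family gives no uniform control near the boundary of the ball, but there the jets are
those of `Φ₀`. On a closed ball of radius `r'` with `r < r' < T`, compactness turns joint continuity
into uniform convergence. -/
theorem continuous_of_eq_off_ball {Φ Φ₀ : P → DiscMetric n T} (hΦ₀ : Continuous Φ₀)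
    {r : ℝ} (hr : r < T)
    (hF : ∀ v w, IsSmoothFamily (Metric.ball (0 : Euc n) T) (fun p x => (Φ p).toFun x v w))
    (heq : ∀ p x, r ≤ ‖x‖ → (Φ p).toFun x = (Φ₀ p).toFun x) : Continuous Φ := by
  refine continuous_of_jet fun k v w => ?_
  rw [continuous_iff_continuousAt]
  intro p₀
  rw [ContinuousAt, UniformFun.tendsto_iff_tendstoUniformly, Metric.tendstoUniformly_iff]
  intro ε hε
  obtain ⟨r', hr1, hr2⟩ := exists_between hr
  have h2 := ((continuous_jet (T := T) k v w).comp hΦ₀).continuousAt (x := p₀)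
  rw [ContinuousAt, UniformFun.tendsto_iff_tendstoUniformly, Metric.tendstoUniformly_iff] at h2
  have hsub : Metric.closedBall (0 : Euc n) r' ⊆ Metric.ball 0 T :=
    Metric.closedBall_subset_ball hr2
  have hc := ((hF v w k).continuousOn_iteratedFDeriv Metric.isOpen_ball)
  have hc' : Continuous fun z : P × Metric.closedBall (0 : Euc n) r' =>
      iteratedFDeriv ℝ k (fun x => (Φ z.1).toFun x v w) (z.2 : Euc n) :=
    hc.comp_continuous (f := fun z : P × Metric.closedBall (0 : Euc n) r' => (z.1, (z.2 : Euc n)))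
      (by fun_prop) fun z => ⟨mem_univ _, hsub z.2.2⟩
  have : CompactSpace (Metric.closedBall (0 : Euc n) r') :=
    isCompact_iff_compactSpace.1 (isCompact_closedBall _ _)
  let f := ContinuousMap.curry ⟨_, hc'⟩
  have h3 := Metric.continuous_iff'.1 f.continuous p₀ ε hε
  filter_upwards [h2 ε hε, h3] with p hp1 hp2 x
  simp only [jet, Function.comp_apply, UniformFun.toFun_ofFun]
  by_cases hx : ‖(x : Euc n)‖ ≤ r'
  · have hx' : (x : Euc n) ∈ Metric.closedBall (0 : Euc n) r' := by simpa using hx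
    rw [iteratedFDerivWithin_disc (hsub hx'), iteratedFDerivWithin_disc (hsub hx'), dist_comm]
    exact lt_of_le_of_lt (ContinuousMap.dist_apply_le_dist (f := f p) (g := f p₀) ⟨x, hx'⟩) hp2
  · have key : ∀ p, iteratedFDerivWithin ℝ k (fun y => (Φ p).toFun y v w) (disc n T) x
        = iteratedFDerivWithin ℝ k (fun y => (Φ₀ p).toFun y v w) (disc n T) x := by
      intro p
      have hev : (fun y => (Φ p).toFun y v w) =ᶠ[𝓝[disc n T] (x : Euc n)]
          fun y => (Φ₀ p).toFun y v w := by
        have h5 : ∀ᶠ y in 𝓝 (x : Euc n), r < ‖y‖ :=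
          continuous_norm.continuousAt.eventually_const_lt (by linarith)
        filter_upwards [mem_nhdsWithin_of_mem_nhds h5] with y hy
        rw [heq p y (le_of_lt hy)]
      exact hev.iteratedFDerivWithin_eq (by simp only [heq p x (by linarith)]) k
    rw [key, key]
    have := hp1 x
    simpa only [jet, Function.comp_apply, UniformFun.toFun_ofFun] using this

theorem partialDeriv_eq_fderiv {u : Euc n → ℝ} {x : Euc n} (hx : x ∈ Metric.ball (0 : Euc n) T)
    (k : Fin n) : partialDeriv T k u x = fderiv ℝ u x (basisVec k) := by
  rw [partialDeriv, fderivWithin_of_mem_nhds]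
  exact Filter.mem_of_superset (Metric.isOpen_ball.mem_nhds hx) Metric.ball_subset_closedBall

theorem isSmoothFamily_partialDeriv {F : P → Euc n → ℝ}
    (hF : IsSmoothFamily (Metric.ball (0 : Euc n) T) F) (k : Fin n) :
    IsSmoothFamily (Metric.ball (0 : Euc n) T) (fun p => partialDeriv T k (F p)) :=
  ((hF.fderiv Metric.isOpen_ball).clm_apply (.const continuous_const)).congr Metric.isOpen_ball
    fun _ _ hx => partialDeriv_eq_fderiv hx k

theorem isSmoothFamily_gram (i j : Fin n) :
    IsSmoothFamily (Metric.ball (0 : Euc n) T) (fun (h : DiscMetric n T) x => h.gram x i j) :=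
  isSmoothFamily_toFun _ _

theorem toFun_eq_sum (h : DiscMetric n T) (x v w : Euc n) :
    h.toFun x v w = ∑ i, ∑ j, v i * w j * h.gram x i j := by
  have hv : ∀ v : Euc n, v = ∑ i, v i • basisVec i := by
    intro v
    have := (EuclideanSpace.basisFun (Fin n) ℝ).sum_repr v
    simpa [basisVec] using this.symm
  conv_lhs => rw [hv v, hv w]
  simp only [map_sum, LinearMap.sum_apply, map_smul, LinearMap.smul_apply, smul_eq_mul, gram,
    Matrix.of_apply, mul_assoc]
  rw [Finset.sum_comm]
  refine Finset.sum_congr rfl fun i _ => ?_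
  rw [Finset.mul_sum]
  exact Finset.sum_congr rfl fun j _ => by ring

theorem gram_det_pos (h : DiscMetric n T) {x : Euc n} (hx : x ∈ disc n T) :
    0 < (h.gram x).det := by
  refine Matrix.PosDef.det_pos (Matrix.PosDef.of_dotProduct_mulVec_pos ?_ ?_)
  · ext i j
    simpa [gram] using h.symm x hx _ _
  · intro v hv
    have := h.posDef x hx (WithLp.toLp 2 v) (by simpa using hv)
    rw [toFun_eq_sum] at this
    refine lt_of_lt_of_eq this ?_
    symm
    simp only [dotProduct, Matrix.mulVec, Finset.mul_sum, Pi.star_apply, star_trivial]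
    refine Finset.sum_congr rfl fun i _ => Finset.sum_congr rfl fun j _ => by ring

/-- Cramer's rule: the entries are quotients of polynomials in the coefficients, with a positive
denominator. -/
theorem isSmoothFamily_gram_inv (i j : Fin n) :
    IsSmoothFamily (Metric.ball (0 : Euc n) T) (fun (h : DiscMetric n T) x => (h.gram x)⁻¹ i j) := by
  have hdet : ∀ M : DiscMetric n T → Euc n → Matrix (Fin n) (Fin n) ℝ,
      (∀ i j, IsSmoothFamily (Metric.ball (0 : Euc n) T) (fun h x => M h x i j)) →
      IsSmoothFamily (Metric.ball (0 : Euc n) T) (fun h x => (M h x).det) := by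
    intro M hM
    simp only [Matrix.det_apply']
    exact .sum _ fun σ _ => (IsSmoothFamily.const continuous_const).mul (.prod _ fun i _ => hM _ _)
  have : ∀ (h : DiscMetric n T) x, (h.gram x)⁻¹ i j
      = ((h.gram x).det)⁻¹ * ((h.gram x).updateRow j (Pi.single i 1)).det := by
    intro h x
    rw [Matrix.inv_def, Ring.inverse_eq_inv', Matrix.smul_apply, Matrix.adjugate_apply, smul_eq_mul]
  simp only [this]
  refine ((hdet _ isSmoothFamily_gram).inv fun h x hx =>
    (h.gram_det_pos (Metric.ball_subset_closedBall hx)).ne').mul (hdet _ fun a b => ?_)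
  by_cases hab : a = j
  · subst hab
    simpa using IsSmoothFamily.const continuous_const
  · simpa [Matrix.updateRow_apply, hab] using isSmoothFamily_gram a b

theorem isSmoothFamily_christoffel (k i j : Fin n) :
    IsSmoothFamily (Metric.ball (0 : Euc n) T) (fun (h : DiscMetric n T) => h.christoffel k i j) := by
  refine (IsSmoothFamily.const continuous_const).mul (.sum _ fun l _ =>
    (isSmoothFamily_gram_inv _ _).mul (((isSmoothFamily_partialDeriv (isSmoothFamily_gram _ _) _).add
      (isSmoothFamily_partialDeriv (isSmoothFamily_gram _ _) _)).sub
      (isSmoothFamily_partialDeriv (isSmoothFamily_gram _ _) _)))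

theorem isSmoothFamily_scalarCurvature :
    IsSmoothFamily (Metric.ball (0 : Euc n) T)
      (fun (h : DiscMetric n T) => h.scalarCurvature) := by
  have hc := @isSmoothFamily_christoffel n T
  refine .sum _ fun i _ => .sum _ fun j _ => (isSmoothFamily_gram_inv _ _).mul (.add ?_ ?_)
  · exact .sum _ fun k _ => (isSmoothFamily_partialDeriv (hc _ _ _) _).sub
      (isSmoothFamily_partialDeriv (hc _ _ _) _)
  · exact .sum _ fun k _ => .sum _ fun l _ => ((hc _ _ _).mul (hc _ _ _)).sub
      ((hc _ _ _).mul (hc _ _ _))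

/-- The scalar curvature at a point of the disc only depends on the germ of the metric there. -/
theorem scalarCurvature_congr {h₁ h₂ : DiscMetric n T} {V : Set (Euc n)} (hV : IsOpen V)
    (heq : ∀ x ∈ V, h₁.toFun x = h₂.toFun x) {x : Euc n} (hx : x ∈ V) :
    h₁.scalarCurvature x = h₂.scalarCurvature x := by
  have hg : ∀ y ∈ V, h₁.gram y = h₂.gram y := fun y hy => by simp only [gram, heq y hy]
  have hp : ∀ {u₁ u₂ : Euc n → ℝ}, (∀ y ∈ V, u₁ y = u₂ y) → ∀ y ∈ V, ∀ k,
      partialDeriv T k u₁ y = partialDeriv T k u₂ y := by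
    intro u₁ u₂ hu y hy k
    unfold partialDeriv
    rw [Filter.EventuallyEq.fderivWithin_eq (Filter.mem_of_superset
      (mem_nhdsWithin_of_mem_nhds (hV.mem_nhds hy)) fun z hz => hu z hz) (hu y hy)]
  have hc : ∀ k i j, ∀ y ∈ V, h₁.christoffel k i j y = h₂.christoffel k i j y := by
    intro k i j y hy
    have hpg : ∀ a b m, partialDeriv T m (fun y => h₁.gram y a b) y
        = partialDeriv T m (fun y => h₂.gram y a b) y :=
      fun a b m => hp (fun z hz => by rw [hg z hz]) y hy m
    simp only [christoffel, hg y hy, hpg]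
  have hpc : ∀ k i j m, partialDeriv T m (h₁.christoffel k i j) x
      = partialDeriv T m (h₂.christoffel k i j) x := fun k i j m => hp (hc k i j) x hx m
  simp only [scalarCurvature, ricci, hg x hx, hc _ _ _ x hx, hpc]

end DiscMetric

end

/-! ### Curvature of rotationally symmetric metrics in Cartesian coordinates -/

noncomputable section

/-- The gradient of `φ` at `x` is `c x`. -/
def HasRadialGrad {n : ℕ} (φ : Euc n → ℝ) (c : ℝ) (x : Euc n) : Prop :=
  HasFDerivAt φ (c • innerSL ℝ x) x

namespace HasRadialGrad

variable {n : ℕ} {φ ψ : Euc n → ℝ} {c d : ℝ} {x : Euc n}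

theorem const (a : ℝ) : HasRadialGrad (fun _ => a) 0 x := by
  simpa [HasRadialGrad] using hasFDerivAt_const a x

theorem normSq : HasRadialGrad (fun y : Euc n => ‖y‖ ^ 2) 2 x := by
  have := (hasStrictFDerivAt_norm_sq x).hasFDerivAt
  simpa [HasRadialGrad, ofNat_smul_eq_nsmul] using this

theorem add (hφ : HasRadialGrad φ c x) (hψ : HasRadialGrad ψ d x) :
    HasRadialGrad (fun y => φ y + ψ y) (c + d) x := by
  unfold HasRadialGrad
  rw [add_smul]
  exact HasFDerivAt.add hφ hψ

theorem mul (hφ : HasRadialGrad φ c x) (hψ : HasRadialGrad ψ d x) :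
    HasRadialGrad (fun y => φ y * ψ y) (c * ψ x + φ x * d) x := by
  have := HasFDerivAt.mul hφ hψ
  rw [smul_smul, smul_smul, ← add_smul] at this
  unfold HasRadialGrad
  rw [add_comm, mul_comm c]
  exact this

theorem const_mul (a : ℝ) (hφ : HasRadialGrad φ c x) :
    HasRadialGrad (fun y => a * φ y) (a * c) x := by
  simpa using (const a).mul hφ

theorem neg (hφ : HasRadialGrad φ c x) : HasRadialGrad (fun y => - φ y) (-c) x := by
  simpa using hφ.const_mul (-1)

theorem sub (hφ : HasRadialGrad φ c x) (hψ : HasRadialGrad ψ d x) :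
    HasRadialGrad (fun y => φ y - ψ y) (c - d) x := by
  simpa only [sub_eq_add_neg] using hφ.add hψ.neg

theorem scomp {g : ℝ → ℝ} {g' : ℝ} (hg : HasDerivAt g g' (φ x)) (hφ : HasRadialGrad φ c x) :
    HasRadialGrad (fun y => g (φ y)) (g' * c) x := by
  have := hg.comp_hasFDerivAt x hφ
  simpa [HasRadialGrad, smul_smul, Function.comp_def] using this

theorem inv (hφ : HasRadialGrad φ c x) (h0 : φ x ≠ 0) :
    HasRadialGrad (fun y => (φ y)⁻¹) (-c / φ x ^ 2) x := by
  have := scomp (hasDerivAt_inv h0) hφ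
  convert this using 1
  ring

theorem div (hφ : HasRadialGrad φ c x) (hψ : HasRadialGrad ψ d x) (h0 : ψ x ≠ 0) :
    HasRadialGrad (fun y => φ y / ψ y) ((c * ψ x - φ x * d) / ψ x ^ 2) x := by
  have := hφ.mul (hψ.inv h0)
  simp only [← div_eq_mul_inv] at this
  convert this using 1
  field_simp
  ring

theorem rpow (hφ : HasRadialGrad φ c x) (h0 : 0 < φ x) (r : ℝ) :
    HasRadialGrad (fun y => φ y ^ r) (r * φ x ^ r * c / φ x) x := by
  have := scomp (Real.hasDerivAt_rpow_const (p := r) (Or.inl h0.ne')) hφ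
  convert this using 1
  rw [Real.rpow_sub h0, Real.rpow_one]
  ring

theorem log (hφ : HasRadialGrad φ c x) (h0 : φ x ≠ 0) :
    HasRadialGrad (fun y => Real.log (φ y)) (c / φ x) x := by
  have := scomp (Real.hasDerivAt_log h0) hφ
  convert this using 1
  ring

theorem congr_grad (hφ : HasRadialGrad φ c x) (h : c = d) : HasRadialGrad φ d x := h ▸ hφ

theorem congr (hφ : HasRadialGrad φ c x) (h : ψ =ᶠ[𝓝 x] φ) : HasRadialGrad ψ c x :=
  HasFDerivAt.congr_of_eventuallyEq hφ h

theorem fderiv_basisVec (hφ : HasRadialGrad φ c x) (i : Fin n) :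
    fderiv ℝ φ x (DiscMetric.basisVec i) = c * x i := by
  rw [HasFDerivAt.fderiv hφ]
  simp [DiscMetric.basisVec, EuclideanSpace.inner_single_right]

end HasRadialGrad

namespace DiscMetric

variable {n : ℕ} {T : ℝ}

/-- The Kronecker symbol. -/
def kron (i j : Fin n) : ℝ := if i = j then 1 else 0

theorem kron_comm (i j : Fin n) : kron i j = kron j i := by simp [kron, eq_comm]

@[simp] theorem sum_kron_mul (i : Fin n) (g : Fin n → ℝ) : ∑ k, kron i k * g k = g i := by
  simp [kron]

@[simp] theorem sum_kron_mul' (i : Fin n) (g : Fin n → ℝ) : ∑ k, kron k i * g k = g i := by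
  simp [kron]

@[simp] theorem kron_self (i : Fin n) : kron i i = 1 := by simp [kron]

theorem sum_mul_self (x : Euc n) : ∑ k, x k * x k = ‖x‖ ^ 2 := by
  rw [EuclideanSpace.norm_sq_eq]
  simp [sq]

theorem hasFDerivAt_coord (i : Fin n) (x : Euc n) :
    HasFDerivAt (fun y : Euc n => y i) (EuclideanSpace.proj i : Euc n →L[ℝ] ℝ) x :=
  (EuclideanSpace.proj i : Euc n →L[ℝ] ℝ).hasFDerivAt

theorem proj_basisVec (i k : Fin n) :
    (EuclideanSpace.proj i : Euc n →L[ℝ] ℝ) (basisVec k) = kron i k := by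
  simp [basisVec, kron]

theorem sum_smul_add (f g : Fin n → ℝ) (a b : ℝ) :
    ∑ k, (a * f k + b * g k) = a * ∑ k, f k + b * ∑ k, g k := by
  rw [Finset.sum_add_distrib, Finset.mul_sum, Finset.mul_sum]

variable {h : DiscMetric n T} {V : Set (Euc n)} {A A₁ A₂ C C₁ C₂ : Euc n → ℝ}

/-- The Sherman–Morrison formula: the matrix is a rank-one perturbation of `a` times the identity,
and its eigenvalue in the radial direction is `a + c ‖x‖²`. -/
theorem gram_inv_of_radial {x : Euc n} {a c : ℝ} (ha : a ≠ 0) (he : a + c * ‖x‖ ^ 2 ≠ 0)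
    (hg : ∀ i j, h.gram x i j = a * kron i j + c * (x i * x j)) (i j : Fin n) :
    (h.gram x)⁻¹ i j = a⁻¹ * (kron i j - c / (a + c * ‖x‖ ^ 2) * (x i * x j)) := by
  have : (h.gram x)⁻¹ = Matrix.of fun i j =>
      a⁻¹ * (kron i j - c / (a + c * ‖x‖ ^ 2) * (x i * x j)) := by
    refine Matrix.inv_eq_right_inv ?_
    ext i j
    rw [Matrix.mul_apply]
    simp only [hg, Matrix.of_apply]
    have : ∀ k, (a * kron i k + c * (x i * x k)) *
        (a⁻¹ * (kron k j - c / (a + c * ‖x‖ ^ 2) * (x k * x j)))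
        = kron i k * (kron k j - c / (a + c * ‖x‖ ^ 2) * (x k * x j))
          + (c * a⁻¹ * x i * (kron k j * x k)
            + (- (c * a⁻¹ * c / (a + c * ‖x‖ ^ 2) * x i * x j)) * (x k * x k)) := by
      intro k; field_simp; ring
    rw [Finset.sum_congr rfl fun k _ => this k, Finset.sum_add_distrib, sum_smul_add, sum_kron_mul,
      sum_kron_mul', sum_mul_self, Matrix.one_apply]
    change kron i j - _ + _ = kron i j
    field_simp
    ring
  rw [this]; rfl

/-- Derivatives of radial coefficients are multiples of `y m`. So the symbols are combinations of
the three tensors that rotational symmetry permits, and the inverse matrix preserves this shape. -/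
theorem christoffel_of_radial (hVT : V ⊆ Metric.ball 0 T)
    (hg : ∀ y ∈ V, ∀ i j, h.gram y i j = A y * kron i j + C y * (y i * y j)) (hV : IsOpen V)
    (hA : ∀ y ∈ V, A y ≠ 0) (he : ∀ y ∈ V, A y + C y * ‖y‖ ^ 2 ≠ 0)
    (hA₁ : ∀ y ∈ V, HasRadialGrad A (A₁ y) y) (hC₁ : ∀ y ∈ V, HasRadialGrad C (C₁ y) y)
    {y : Euc n} (hy : y ∈ V) (k i j : Fin n) :
    h.christoffel k i j y = A₁ y / (2 * A y) * (y i * kron j k + y j * kron i k)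
      + (2 * C y - A₁ y) / (2 * (A y + C y * ‖y‖ ^ 2)) * (kron i j * y k)
      + (C₁ y / 2 - A₁ y * C y / A y) / (A y + C y * ‖y‖ ^ 2) * (y i * y j * y k) := by
  have hpd : ∀ a b m, partialDeriv T m (fun z => h.gram z a b) y
      = A₁ y * y m * kron a b + C₁ y * y m * (y a * y b)
        + C y * (kron a m * y b + y a * kron b m) := by
    intro a b m
    rw [partialDeriv_eq_fderiv (hVT hy)]
    have h1 : (fun z => h.gram z a b) =ᶠ[𝓝 y] fun z => A z * kron a b + C z * (z a * z b) := by
      filter_upwards [hV.mem_nhds hy] with z hz using hg z hz a b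
    have h2 := (HasFDerivAt.mul_const (hA₁ y hy) (kron a b)).add
      (HasFDerivAt.mul (hC₁ y hy) ((hasFDerivAt_coord a y).mul (hasFDerivAt_coord b y)))
    rw [h1.fderiv_eq]
    erw [h2.fderiv]
    simp only [add_apply, smul_apply, smul_eq_mul,
      proj_basisVec, innerSL_apply_apply]
    simp only [basisVec, EuclideanSpace.inner_single_right]
    simp
    ring
  have hA' := hA y hy
  have he' := he y hy
  rw [christoffel]
  simp only [hpd, gram_inv_of_radial hA' he' (hg y hy)]
  set e := A y + C y * ‖y‖ ^ 2 with hedef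
  have : ∀ l, (A y)⁻¹ * (kron k l - C y / e * (y k * y l)) *
      (A₁ y * y i * kron j l + C₁ y * y i * (y j * y l) + C y * (kron j i * y l + y j * kron l i)
      + (A₁ y * y j * kron i l + C₁ y * y j * (y i * y l) + C y * (kron i j * y l + y i * kron l j))
      - (A₁ y * y l * kron i j + C₁ y * y l * (y i * y j) + C y * (kron i l * y j + y i * kron j l)))
      = kron k l * ((A y)⁻¹ * (A₁ y * (y i * kron j l + y j * kron i l)
          + (C₁ y * (y i * y j) + (2 * C y - A₁ y) * kron i j) * y l))
        + (- ((A y)⁻¹ * C y / e * y k * A₁ y) * (kron j l * (y i * y l) + kron i l * (y j * y l))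
        + - ((A y)⁻¹ * C y / e * y k * (C₁ y * (y i * y j) + (2 * C y - A₁ y) * kron i j))
          * (y l * y l)) := by
    intro l
    rw [kron_comm l i, kron_comm l j, kron_comm j i]
    ring
  rw [Finset.sum_congr rfl fun l _ => this l, Finset.sum_add_distrib, sum_smul_add,
    Finset.sum_add_distrib, sum_kron_mul, sum_kron_mul, sum_kron_mul, sum_mul_self]
  field_simp
  rw [hedef]
  ring

section Ricci

variable {α α₁ β β₁ γ γ₁ : Euc n → ℝ}

/-- Contracting the three tensors leaves only `kron i j` and `x i * x j`. The recurring combination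
`(n + 1) α + β + γ ‖x‖²` is the coefficient of `x l` in the trace of the Christoffel symbols over
`k`. -/
theorem ricci_of_radial (hVT : V ⊆ Metric.ball 0 T) (hV : IsOpen V)
    (hc : ∀ y ∈ V, ∀ k i j, h.christoffel k i j y = α y * (y i * kron j k + y j * kron i k)
      + β y * (kron i j * y k) + γ y * (y i * y j * y k)) {x : Euc n} (hx : x ∈ V)
    (hα : HasRadialGrad α (α₁ x) x) (hβ : HasRadialGrad β (β₁ x) x)
    (hγ : HasRadialGrad γ (γ₁ x) x) (i j : Fin n) :
    h.ricci i j x =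
      (2 * α x + β₁ x * ‖x‖ ^ 2 + n * β x - ((n + 1) * α x + β x + γ x * ‖x‖ ^ 2)
        + ((n + 1) * α x + β x + γ x * ‖x‖ ^ 2) * β x * ‖x‖ ^ 2
        - 2 * α x * β x * ‖x‖ ^ 2) * kron i j
      + (2 * α₁ x + γ₁ x * ‖x‖ ^ 2 + (n + 2) * γ x
        - ((n + 1) * α₁ x + β₁ x + γ₁ x * ‖x‖ ^ 2 + 2 * γ x)
        + ((n + 1) * α x + β x + γ x * ‖x‖ ^ 2) * (2 * α x + γ x * ‖x‖ ^ 2)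
        - (α x ^ 2 * (n + 3) + 2 * α x * β x + β x ^ 2 + 4 * α x * γ x * ‖x‖ ^ 2
          + 2 * β x * γ x * ‖x‖ ^ 2 + γ x ^ 2 * (‖x‖ ^ 2) ^ 2)) * (x i * x j) := by
  have hpd : ∀ k i j m, partialDeriv T m (h.christoffel k i j) x
      = α₁ x * x m * (x i * kron j k + x j * kron i k)
        + α x * (kron i m * kron j k + kron j m * kron i k)
        + β₁ x * x m * (kron i j * x k) + β x * (kron i j * kron k m)
        + γ₁ x * x m * (x i * x j * x k)
        + γ x * (kron i m * x j * x k + x i * kron j m * x k + x i * x j * kron k m) := by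
    intro k i j m
    rw [partialDeriv_eq_fderiv (hVT hx)]
    have h1 : h.christoffel k i j =ᶠ[𝓝 x] fun y => α y * (y i * kron j k + y j * kron i k)
      + β y * (kron i j * y k) + γ y * (y i * y j * y k) := by
      filter_upwards [hV.mem_nhds hx] with z hz using hc z hz k i j
    have h2 := ((HasFDerivAt.mul hα (((hasFDerivAt_coord i x).mul_const (kron j k)).add
      ((hasFDerivAt_coord j x).mul_const (kron i k)))).add
      (HasFDerivAt.mul hβ ((hasFDerivAt_coord k x).const_mul (kron i j)))).add
      (HasFDerivAt.mul hγ (((hasFDerivAt_coord i x).mul (hasFDerivAt_coord j x)).mul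
        (hasFDerivAt_coord k x)))
    rw [h1.fderiv_eq]
    erw [h2.fderiv]
    simp only [add_apply, smul_apply, smul_eq_mul,
      proj_basisVec, innerSL_apply_apply]
    simp only [basisVec, EuclideanSpace.inner_single_right]
    simp
    ring
  have hcard : ∑ _k : Fin n, (1 : ℝ) = n := by simp
  rw [ricci]
  simp only [hpd, hc x hx]
  generalize α x = a, α₁ x = a₁, β x = b, β₁ x = b₁, γ x = c, γ₁ x = c₁
  have hs1 : ∑ k, ((a₁ * x k * (x i * kron j k + x j * kron i k)
        + a * (kron i k * kron j k + kron j k * kron i k)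
        + b₁ * x k * (kron i j * x k) + b * (kron i j * kron k k)
        + c₁ * x k * (x i * x j * x k)
        + c * (kron i k * x j * x k + x i * kron j k * x k + x i * x j * kron k k))
        - (a₁ * x j * (x i * kron k k + x k * kron i k)
        + a * (kron i j * kron k k + kron k j * kron i k)
        + b₁ * x j * (kron i k * x k) + b * (kron i k * kron k j)
        + c₁ * x j * (x i * x k * x k)
        + c * (kron i j * x k * x k + x i * kron k j * x k + x i * x k * kron k j)))
      = (2 * a + b₁ * ‖x‖ ^ 2 + n * b - ((n + 1) * a + b + c * ‖x‖ ^ 2)) * kron i j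
        + (2 * a₁ + c₁ * ‖x‖ ^ 2 + (n + 2) * c - ((n + 1) * a₁ + b₁ + c₁ * ‖x‖ ^ 2 + 2 * c))
          * (x i * x j) := by
    have : ∀ k, ((a₁ * x k * (x i * kron j k + x j * kron i k)
        + a * (kron i k * kron j k + kron j k * kron i k)
        + b₁ * x k * (kron i j * x k) + b * (kron i j * kron k k)
        + c₁ * x k * (x i * x j * x k)
        + c * (kron i k * x j * x k + x i * kron j k * x k + x i * x j * kron k k))
        - (a₁ * x j * (x i * kron k k + x k * kron i k)
        + a * (kron i j * kron k k + kron k j * kron i k)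
        + b₁ * x j * (kron i k * x k) + b * (kron i k * kron k j)
        + c₁ * x j * (x i * x k * x k)
        + c * (kron i j * x k * x k + x i * kron k j * x k + x i * x k * kron k j)))
      = kron i k * (a₁ * x j * x k + 2 * a * kron j k + c * x j * x k - a₁ * x j * x k
          - a * kron j k - b₁ * x j * x k - b * kron j k)
        + kron j k * (a₁ * x i * x k - c * x i * x k)
        + ((b * kron i j + c * x i * x j - a₁ * x i * x j - a * kron i j) * 1
        + (b₁ * kron i j + c₁ * x i * x j - c₁ * x i * x j - c * kron i j) * (x k * x k)) := by
      intro k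
      rw [kron_self, kron_comm k j]
      ring
    rw [Finset.sum_congr rfl fun k _ => this k, Finset.sum_add_distrib, Finset.sum_add_distrib,
      sum_smul_add, sum_kron_mul, sum_kron_mul, sum_mul_self, hcard, kron_comm j i]
    ring
  -- The sum over `k` alone is the trace, a multiple of `x l`. It factors out before the sum over
  -- `l` is taken.
  have hs2 : ∑ k, ∑ l, (a * (x k * kron l k + x l * kron k k) + b * (kron k l * x k)
        + c * (x k * x l * x k)) * (a * (x i * kron j l + x j * kron i l) + b * (kron i j * x l)
        + c * (x i * x j * x l))
      = ((n + 1) * a + b + c * ‖x‖ ^ 2)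
        * (2 * a * (x i * x j) + b * ‖x‖ ^ 2 * kron i j + c * ‖x‖ ^ 2 * (x i * x j)) := by
    rw [Finset.sum_comm]
    simp only [← Finset.sum_mul]
    have h1 : ∀ l, ∑ k, (a * (x k * kron l k + x l * kron k k) + b * (kron k l * x k)
        + c * (x k * x l * x k)) = ((n + 1) * a + b + c * ‖x‖ ^ 2) * x l := by
      intro l
      have : ∀ k, a * (x k * kron l k + x l * kron k k) + b * (kron k l * x k)
          + c * (x k * x l * x k) = kron l k * ((a + b) * x k)
          + (a * x l * 1 + c * x l * (x k * x k)) := by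
        intro k; rw [kron_self, kron_comm k l]; ring
      rw [Finset.sum_congr rfl fun k _ => this k, Finset.sum_add_distrib, sum_smul_add,
        sum_kron_mul, sum_mul_self, hcard]
      ring
    have h2 : ∀ l, ((n + 1) * a + b + c * ‖x‖ ^ 2) * x l *
        (a * (x i * kron j l + x j * kron i l) + b * (kron i j * x l) + c * (x i * x j * x l))
        = ((n + 1) * a + b + c * ‖x‖ ^ 2) * (kron j l * (a * x i * x l) + kron i l * (a * x j * x l))
        + (((n + 1) * a + b + c * ‖x‖ ^ 2) * (b * kron i j + c * (x i * x j))) * (x l * x l) := by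
      intro l; ring
    rw [Finset.sum_congr rfl fun l _ => by rw [h1, h2], sum_smul_add, Finset.sum_add_distrib,
      sum_kron_mul, sum_kron_mul, sum_mul_self]
    ring
  have hs3 : ∑ k, ∑ l, (a * (x j * kron l k + x l * kron j k) + b * (kron j l * x k)
        + c * (x j * x l * x k))
        * (a * (x i * kron k l + x k * kron i l) + b * (kron i k * x l) + c * (x i * x k * x l))
      = (a ^ 2 * (n + 3) + 2 * a * b + b ^ 2 + 4 * a * c * ‖x‖ ^ 2
          + 2 * b * c * ‖x‖ ^ 2 + c ^ 2 * (‖x‖ ^ 2) ^ 2) * (x i * x j)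
        + 2 * a * b * ‖x‖ ^ 2 * kron i j := by
    have h1 : ∀ k, ∑ l, (a * (x j * kron l k + x l * kron j k) + b * (kron j l * x k)
        + c * (x j * x l * x k))
        * (a * (x i * kron k l + x k * kron i l) + b * (kron i k * x l) + c * (x i * x k * x l))
        = kron i k * ((2 * a ^ 2 + 2 * a * b + b ^ 2
            + c * b * ‖x‖ ^ 2) * (x j * x k) - (a ^ 2 + a * b) * (x j * x k)
            + a * b * ‖x‖ ^ 2 * kron j k)
          + kron j k * ((2 * a ^ 2 + a * b + a * c * ‖x‖ ^ 2) * (x i * x k))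
          + (a ^ 2 * (x i * x j) * 1 + (3 * a * c * (x i * x j) + a * b * kron i j
            + b * c * (x i * x j) + c ^ 2 * ‖x‖ ^ 2 * (x i * x j)) * (x k * x k)) := by
      intro k
      have : ∀ l, (a * (x j * kron l k + x l * kron j k) + b * (kron j l * x k)
        + c * (x j * x l * x k))
        * (a * (x i * kron k l + x k * kron i l) + b * (kron i k * x l) + c * (x i * x k * x l))
        = (kron k l * (a * x j * (a * (x i * kron k l + x k * kron i l) + b * (kron i k * x l)
            + c * (x i * x k * x l)) + (a * (x l * kron j k) + b * (kron j l * x k)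
            + c * (x j * x l * x k)) * (a * x i))
          + kron i l * ((a * (x l * kron j k) + b * (kron j l * x k)
            + c * (x j * x l * x k)) * (a * x k)))
          + (kron j l * (b * x k * (b * (kron i k * x l) + c * (x i * x k * x l)))
          + ((a * kron j k + c * (x j * x k)) * (b * kron i k + c * (x i * x k))) * (x l * x l)) := by
        intro l
        rw [kron_comm l k]
        ring
      rw [Finset.sum_congr rfl fun l _ => this l, Finset.sum_add_distrib, Finset.sum_add_distrib,
        Finset.sum_add_distrib, ← Finset.mul_sum (a := (a * kron j k + c * (x j * x k)) *
          (b * kron i k + c * (x i * x k))), sum_kron_mul, sum_kron_mul, sum_kron_mul,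
        sum_mul_self, kron_self, kron_comm j i]
      ring
    rw [Finset.sum_congr rfl fun k _ => h1 k, Finset.sum_add_distrib, Finset.sum_add_distrib,
      sum_smul_add, sum_kron_mul, sum_kron_mul, sum_mul_self, hcard, kron_comm j i]
    ring
  rw [hs1]
  simp only [Finset.sum_sub_distrib]
  rw [hs2, hs3]
  ring

theorem scalarCurvature_of_ricci {x : Euc n} {a c l m : ℝ} (ha : a ≠ 0) (he : a + c * ‖x‖ ^ 2 ≠ 0)
    (hg : ∀ i j, h.gram x i j = a * kron i j + c * (x i * x j))
    (hr : ∀ i j, h.ricci i j x = l * kron i j + m * (x i * x j)) :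
    h.scalarCurvature x = a⁻¹ * (n * l + m * ‖x‖ ^ 2
      - c / (a + c * ‖x‖ ^ 2) * (l * ‖x‖ ^ 2 + m * (‖x‖ ^ 2) ^ 2)) := by
  rw [scalarCurvature]
  simp only [hr, gram_inv_of_radial ha he hg]
  generalize a + c * ‖x‖ ^ 2 = e
  have h1 : ∀ i, ∑ j, a⁻¹ * (kron i j - c / e * (x i * x j)) * (l * kron i j + m * (x i * x j))
      = a⁻¹ * l * 1 + a⁻¹ * (m - c / e * l - c / e * m * ‖x‖ ^ 2) * (x i * x i) := by
    intro i
    have : ∀ j, a⁻¹ * (kron i j - c / e * (x i * x j)) * (l * kron i j + m * (x i * x j))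
        = kron i j * (a⁻¹ * (l * kron i j + m * (x i * x j) - c / e * (x i * x j) * l))
          + (- a⁻¹ * (c / e) * m * (x i * x i)) * (x j * x j) := by
      intro j; ring
    rw [Finset.sum_congr rfl fun j _ => this j, Finset.sum_add_distrib, ← Finset.mul_sum,
      sum_kron_mul, sum_mul_self, kron_self]
    ring
  rw [Finset.sum_congr rfl fun i _ => h1 i, sum_smul_add, sum_mul_self]
  simp only [Finset.sum_const, Finset.card_univ, Fintype.card_fin, nsmul_eq_mul]
  ring

end Ricci

end DiscMetric

end

/-! ### The curvature equation in the conformal coordinate -/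

noncomputable section

namespace DiscMetric

variable {n : ℕ} {T : ℝ} {h : DiscMetric n T} {V : Set (Euc n)}

/-- The scalar curvature of `A (|dx|² + (k² - 1) dt²)`, where `w` is the derivative of
`log (t √A)` with respect to the conformal coordinate `v` with `dv = k dt / t`, and `z` is the
derivative of `w` with respect to `v`. -/
theorem scalarCurvature_mul_of_radial (hVT : V ⊆ Metric.ball 0 T) (hV : IsOpen V)
    (h0 : (0 : Euc n) ∉ V) {A k k₁ w : Euc n → ℝ} {k₂ z : ℝ}
    (hg : ∀ y ∈ V, ∀ i j,
      h.gram y i j = A y * kron i j + A y * (k y ^ 2 - 1) / ‖y‖ ^ 2 * (y i * y j))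
    (hA : ∀ y ∈ V, A y ≠ 0) (hk : ∀ y ∈ V, k y ≠ 0)
    (hA₁ : ∀ y ∈ V, HasRadialGrad A (2 * A y * (k y * w y - 1) / ‖y‖ ^ 2) y)
    (hk₁ : ∀ y ∈ V, HasRadialGrad k (k₁ y) y) {x : Euc n} (hx : x ∈ V)
    (hk₂ : HasRadialGrad k₁ k₂ x) (hw : HasRadialGrad w (k x * z / ‖x‖ ^ 2) x) :
    h.scalarCurvature x * (A x * ‖x‖ ^ 2) = (n - 1) * ((n - 2) * (1 - w x ^ 2) - 2 * z) := by
  have hρ : ∀ y ∈ V, ‖y‖ ^ 2 ≠ 0 := by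
    intro y hy
    have : y ≠ 0 := fun h => h0 (h ▸ hy)
    positivity
  have he : ∀ y ∈ V, A y + A y * (k y ^ 2 - 1) / ‖y‖ ^ 2 * ‖y‖ ^ 2 = A y * k y ^ 2 := by
    intro y hy
    rw [div_mul_cancel₀ _ (hρ y hy)]
    ring
  have he0 : ∀ y ∈ V, A y + A y * (k y ^ 2 - 1) / ‖y‖ ^ 2 * ‖y‖ ^ 2 ≠ 0 := by
    intro y hy
    rw [he y hy]
    exact mul_ne_zero (hA y hy) (pow_ne_zero _ (hk y hy))
  have hC₁ := fun y hy => ((hA₁ y hy).mul (((hk₁ y hy).mul (hk₁ y hy)).sub (.const 1))).div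
    .normSq (hρ y hy)
  -- The radial eigenvalue of the metric is `A k²`, and the gradient of `A` is a multiple of `A`.
  -- Hence `A` cancels from the Christoffel symbols, and only `k` and `w` remain.
  have hchr : ∀ y ∈ V, ∀ m i j, h.christoffel m i j y
      = (k y * w y - 1) / ‖y‖ ^ 2 * (y i * kron j m + y j * kron i m)
      + (1 - w y / k y) / ‖y‖ ^ 2 * (kron i j * y m)
      + (k₁ y / ‖y‖ ^ 2 - w y * (k y * k y - 1) / (‖y‖ ^ 2 * ‖y‖ ^ 2)) / k y
        * (y i * y j * y m) := by
    intro y hy m i j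
    have h1 := christoffel_of_radial (C := fun y => A y * (k y * k y - 1) / ‖y‖ ^ 2) hVT
      (fun y hy i j => by rw [hg y hy i j, sq (k y)]) hV hA
      (fun y hy => by simpa only [sq (k y)] using he0 y hy) hA₁ hC₁ hy m i j
    simp only at h1
    have h2 : A y + A y * (k y * k y - 1) / ‖y‖ ^ 2 * ‖y‖ ^ 2 = A y * k y ^ 2 := by
      simpa only [sq (k y)] using he y hy
    rw [h1, h2]
    have h3 := hρ y hy
    have h4 := hA y hy
    have h5 := hk y hy
    generalize ‖y‖ ^ 2 = ρ at *
    congr 1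
    · congr 1
      · congr 1
        field_simp
      · congr 1
        field_simp
        ring
    · congr 1
      field_simp
      ring
  have hα := (((hk₁ x hx).mul hw).sub (.const 1)).div .normSq (hρ x hx)
  have hβ := ((HasRadialGrad.const 1).sub (hw.div (hk₁ x hx) (hk x hx))).div .normSq (hρ x hx)
  have hγ := ((hk₂.div .normSq (hρ x hx)).sub ((hw.mul (((hk₁ x hx).mul (hk₁ x hx)).sub
    (.const 1))).div (HasRadialGrad.normSq.mul .normSq)
      (mul_ne_zero (hρ x hx) (hρ x hx)))).div (hk₁ x hx) (hk x hx)
  -- The derivative of the third coefficient enters the two parts of the Ricci tensor with opposite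
  -- signs. Its value, and with it the second derivative of `k`, is irrelevant.
  generalize hγ₁ : (_ : ℝ) / k x ^ 2 = γ₁ at hγ
  have h1 := ricci_of_radial (α₁ := fun _ => _) (β₁ := fun _ => _) (γ₁ := fun _ => γ₁)
    hVT hV hchr hx hα hβ hγ
  have h2 := scalarCurvature_of_ricci (hA x hx) (he0 x hx) (hg x hx) h1
  rw [h2, he x hx]
  have h3 := hρ x hx
  have h4 := hA x hx
  have h5 := hk x hx
  clear h1 h2 hγ hβ hα hchr hC₁ he0 he hγ₁ hk₂
  generalize ‖x‖ ^ 2 = ρ at *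
  generalize A x = a, k x = k, k₁ x = k₁, w x = w at *
  field_simp
  ring

/-- The scalar curvature of `U ^ (2 / α) (dv² + dξ²)` for `α = (n - 2) / 2`. -/
theorem scalarCurvature_conformal (hn : 3 ≤ n) (hVT : V ⊆ Metric.ball 0 T) (hV : IsOpen V)
    (h0 : (0 : Euc n) ∉ V) {α : ℝ} (hα : α = (n - 2) / 2) {U k k₁ U' : Euc n → ℝ} {k₂ U'' : ℝ}
    (hg : ∀ y ∈ V, ∀ i j, h.gram y i j = U y ^ (2 / α) / ‖y‖ ^ 2 * kron i j
      + U y ^ (2 / α) / ‖y‖ ^ 2 * (k y ^ 2 - 1) / ‖y‖ ^ 2 * (y i * y j))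
    (hU : ∀ y ∈ V, 0 < U y) (hk : ∀ y ∈ V, k y ≠ 0)
    (hU' : ∀ y ∈ V, HasRadialGrad U (k y * U' y / ‖y‖ ^ 2) y)
    (hk₁ : ∀ y ∈ V, HasRadialGrad k (k₁ y) y) {x : Euc n} (hx : x ∈ V)
    (hk₂ : HasRadialGrad k₁ k₂ x) (hU'' : HasRadialGrad U' (k x * U'' / ‖x‖ ^ 2) x) :
    α / (2 * (n - 1)) * h.scalarCurvature x * U x ^ (1 + 2 / α) = α ^ 2 * U x - U'' := by
  have hρ : ∀ y ∈ V, ‖y‖ ^ 2 ≠ 0 := by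
    intro y hy
    have : y ≠ 0 := fun h => h0 (h ▸ hy)
    positivity
  have hn' : (3 : ℝ) ≤ n := by exact_mod_cast hn
  have hα0 : α ≠ 0 := by rw [hα]; linarith
  have hn2 : (n : ℝ) - 2 = 2 * α := by rw [hα]; ring
  have hn1 : (n : ℝ) - 1 ≠ 0 := by linarith
  -- Here `log f = α⁻¹ log U`, so `w` is its first and `z` its second derivative in `v`. Because `n
  -- - 2 = 2 α`, the terms with the square of `U'` cancel, which makes the resulting expression
  -- linear in `U`.
  have h1 := scalarCurvature_mul_of_radial hVT hV h0 (w := fun y => α⁻¹ * (U' y / U y))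
    (z := α⁻¹ * ((U'' * U x - U' x * U' x) / U x ^ 2)) hg
    (fun y hy => div_ne_zero (Real.rpow_pos_of_pos (hU y hy) _).ne' (hρ y hy)) hk ?_ hk₁ hx hk₂ ?_
  · have h2 : U x ^ (1 + 2 / α) = U x * U x ^ (2 / α) := by
      rw [Real.rpow_add (hU x hx), Real.rpow_one]
    have h3 := hρ x hx
    have h4 := (hU x hx).ne'
    rw [div_mul_cancel₀ _ h3, hn2] at h1
    rw [h2]
    have h5 : α / (2 * (n - 1)) * h.scalarCurvature x * (U x * U x ^ (2 / α))
      = α / (2 * (n - 1)) * U x * (h.scalarCurvature x * U x ^ (2 / α)) := by ring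
    rw [h5, h1]
    field_simp
    ring
  · intro y hy
    refine (((hU' y hy).rpow (hU y hy) (2 / α)).div .normSq (hρ y hy)).congr_grad ?_
    have h3 := hρ y hy
    have h4 := (hU y hy).ne'
    generalize ‖y‖ ^ 2 = ρ at *
    field_simp
  · refine ((hU''.div (hU' x hx) (hU x hx).ne').const_mul α⁻¹).congr_grad ?_
    have h3 := hρ x hx
    have h4 := (hU x hx).ne'
    field_simp

end DiscMetric

end

/-! ### Radial functions and smooth division at the origin -/

noncomputable section

open MeasureTheory

section Radial

variable {n : ℕ} {T : ℝ} {P : Type*} [TopologicalSpace P]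

/-- A function on the open ball of radius `T` that only depends on the norm. -/
def IsRadialOn (T : ℝ) (φ : Euc n → ℝ) : Prop :=
  ∀ x y, ‖x‖ < T → ‖x‖ = ‖y‖ → φ x = φ y

/-- Near `x` the function is its restriction to the ray through `x`, composed with the norm. The
chain rule then leaves only the gradient of the norm. -/
theorem IsRadialOn.hasRadialGrad {φ : Euc n → ℝ} (hφ : IsRadialOn T φ) {x : Euc n} (hx0 : x ≠ 0)
    (hx : ‖x‖ < T) (hd : DifferentiableAt ℝ φ x) :
    HasRadialGrad φ (fderiv ℝ φ x x / ‖x‖ ^ 2) x := by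
  have hn : ‖x‖ ≠ 0 := norm_ne_zero_iff.2 hx0
  have h1 : φ =ᶠ[𝓝 x] fun y => φ ((‖y‖ * ‖x‖⁻¹) • x) := by
    filter_upwards [continuous_norm.continuousAt.eventually_lt_const hx] with y hy
    refine hφ _ _ hy ?_
    rw [norm_smul, norm_mul, norm_inv, norm_norm, norm_norm, inv_mul_cancel_right₀ hn]
  have h2 : HasFDerivAt (fun y : Euc n => ‖y‖) ((‖x‖⁻¹) • innerSL ℝ x) x := by
    have h3 := (hasStrictFDerivAt_norm_sq x).hasFDerivAt.sqrt (by positivity)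
    simp only [Real.sqrt_sq (norm_nonneg _)] at h3
    refine h3.congr_fderiv ?_
    ext v
    simp
    field_simp
  have h3 : HasFDerivAt (fun y : Euc n => (‖y‖ * ‖x‖⁻¹) • x)
      ((‖x‖⁻¹ • ((‖x‖⁻¹) • innerSL ℝ x)).smulRight x) x :=
    (h2.mul_const ‖x‖⁻¹).smul_const x
  have h4 : (‖x‖ * ‖x‖⁻¹) • x = x := by rw [mul_inv_cancel₀ hn, one_smul]
  have h5 : HasFDerivAt φ (fderiv ℝ φ x) ((‖x‖ * ‖x‖⁻¹) • x) := by rw [h4]; exact hd.hasFDerivAt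
  have h6 := (HasFDerivAt.comp (f := fun y : Euc n => (‖y‖ * ‖x‖⁻¹) • x) x h5 h3
    ).congr_of_eventuallyEq h1
  refine h6.congr_fderiv ?_ |>.congr_fderiv rfl
  symm
  ext v
  simp [div_eq_mul_inv, sq]
  ring

theorem HasRadialGrad.fderiv_self {φ : Euc n → ℝ} {c : ℝ} {x : Euc n} (h : HasRadialGrad φ c x) :
    fderiv ℝ φ x x = c * ‖x‖ ^ 2 := by
  rw [HasFDerivAt.fderiv h]
  simp

theorem integral_unitInterval {G : Type*} [NormedAddCommGroup G] [NormedSpace ℝ G] (f : ℝ → G) :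
    ∫ σ : unitInterval, f σ = ∫ t in (0 : ℝ)..1, f t := by
  rw [intervalIntegral.integral_of_le zero_le_one, ← integral_Icc_eq_integral_Ioc]
  exact integral_subtype measurableSet_Icc f

/-- The quotient by the coordinate `x i` of a function that vanishes where `x i = 0`. -/
def divCoord (i : Fin n) (F : Euc n → ℝ) (x : Euc n) : ℝ :=
  ∫ σ : unitInterval, fderiv ℝ F (x + (((σ : ℝ) - 1) * x i) • DiscMetric.basisVec i)
    (DiscMetric.basisVec i)

/-- This keeps the path of integration in `divCoord`, along which one coordinate grows from `0` to
`x i`, inside the ball. -/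
theorem norm_add_smul_basisVec_le (i : Fin n) (x : Euc n) {σ : ℝ} (hσ : σ ∈ Icc (0 : ℝ) 1) :
    ‖x + ((σ - 1) * x i) • DiscMetric.basisVec i‖ ≤ ‖x‖ := by
  rw [EuclideanSpace.norm_eq, EuclideanSpace.norm_eq]
  refine Real.sqrt_le_sqrt (Finset.sum_le_sum fun j _ => ?_)
  by_cases hj : j = i
  · subst hj
    simp only [DiscMetric.basisVec, PiLp.add_apply, PiLp.smul_apply, PiLp.single_apply,
      if_true, smul_eq_mul, mul_one, Real.norm_eq_abs, sq_abs]
    nlinarith [hσ.1, hσ.2, sq_nonneg (x j), mul_nonneg hσ.1 (sub_nonneg.2 hσ.2),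
      mul_nonneg (mul_nonneg (sub_nonneg.2 hσ.2) (by linarith [hσ.1] : 0 ≤ 1 + σ)) (sq_nonneg (x j))]
  · simp [DiscMetric.basisVec, hj]

theorem IsSmoothFamily.divCoord (i : Fin n) {F : P → Euc n → ℝ}
    (hF : IsSmoothFamily (Metric.ball (0 : Euc n) T) F) :
    IsSmoothFamily (Metric.ball (0 : Euc n) T) (fun p => _root_.divCoord i (F p)) := by
  refine IsSmoothFamily.integral volume Metric.isOpen_ball
    (F := fun (q : P × unitInterval) x => _root_.fderiv ℝ (F q.1)
      (x + (((q.2 : ℝ) - 1) * x i) • DiscMetric.basisVec i) (DiscMetric.basisVec i)) ?_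
  refine clm_apply (comp ((hF.fderiv Metric.isOpen_ball).comp_param continuous_fst)
    (F := fun (q : P × unitInterval) x => x + (((q.2 : ℝ) - 1) * x i) • DiscMetric.basisVec i)
    (id.add (((const (c := fun q : P × unitInterval => (q.2 : ℝ) - 1) (by fun_prop)).mul
      (clm (EuclideanSpace.proj i : Euc n →L[ℝ] ℝ))).smul (const continuous_const))) ?_)
    (const continuous_const)
  intro q x hx
  rw [mem_ball_zero_iff] at hx ⊢
  exact (norm_add_smul_basisVec_le i x q.2.2).trans_lt hx

theorem mul_divCoord (i : Fin n) {F : Euc n → ℝ} (hF : ContDiffOn ℝ ∞ F (Metric.ball 0 T))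
    {x : Euc n} (hx : ‖x‖ < T) (h0 : F (x - x i • DiscMetric.basisVec i) = 0) :
    x i * divCoord i F x = F x := by
  have hFd := (contDiffOn_infty_iff_fderiv_of_isOpen Metric.isOpen_ball).1 hF
  have hmem : ∀ σ ∈ Icc (0 : ℝ) 1, x + ((σ - 1) * x i) • DiscMetric.basisVec i
      ∈ Metric.ball (0 : Euc n) T := by
    intro σ hσ
    rw [mem_ball_zero_iff]
    exact (norm_add_smul_basisVec_le i x hσ).trans_lt hx
  have hcont : ContinuousOn (fun σ : ℝ => fderiv ℝ F
      (x + ((σ - 1) * x i) • DiscMetric.basisVec i) (DiscMetric.basisVec i)) (Icc 0 1) :=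
    (hFd.2.continuousOn.comp (by fun_prop) hmem).clm_apply continuousOn_const
  have h1 : ∫ σ in (0 : ℝ)..1, x i * fderiv ℝ F
      (x + ((σ - 1) * x i) • DiscMetric.basisVec i) (DiscMetric.basisVec i)
      = F (x + (((1 : ℝ) - 1) * x i) • DiscMetric.basisVec i)
        - F (x + (((0 : ℝ) - 1) * x i) • DiscMetric.basisVec i) := by
    refine intervalIntegral.integral_eq_sub_of_hasDerivAt
      (f := fun σ => F (x + ((σ - 1) * x i) • DiscMetric.basisVec i)) (fun σ hσ => ?_) ?_
    · rw [uIcc_of_le zero_le_one] at hσ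
      have h2 := ((hFd.1 _ (hmem σ hσ)).differentiableAt
        (Metric.isOpen_ball.mem_nhds (hmem σ hσ))).hasFDerivAt
      have h3 : HasDerivAt (fun σ : ℝ => x + ((σ - 1) * x i) • DiscMetric.basisVec i)
          ((1 * x i) • DiscMetric.basisVec i) σ :=
        ((((hasDerivAt_id σ).sub_const 1).mul_const (x i)).smul_const _).const_add x
      have := h2.comp_hasDerivAt σ h3
      simpa [Function.comp_def] using this
    · refine ContinuousOn.intervalIntegrable ?_
      rw [uIcc_of_le zero_le_one]
      exact continuousOn_const.mul hcont
  rw [divCoord, integral_unitInterval (fun σ => fderiv ℝ F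
      (x + ((σ - 1) * x i) • DiscMetric.basisVec i) (DiscMetric.basisVec i)),
    ← intervalIntegral.integral_const_mul, h1]
  simp only [sub_self, zero_mul, zero_smul, add_zero, zero_sub, neg_mul, one_mul, neg_smul,
    ← sub_eq_add_neg, h0, sub_zero]

theorem tendsto_comp_punctured {E : Type*} [TopologicalSpace E] {f : E → ℝ} {l : ℝ → E} {y : E}
    (hf : ContinuousAt f y) (hl : ContinuousAt l 0) (hy : l 0 = y) :
    Filter.Tendsto (fun s => f (l s)) (𝓝[≠] 0) (𝓝 (f y)) := by
  subst hy
  exact (hf.comp hl).tendsto.mono_left nhdsWithin_le_nhds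

theorem eventually_norm_lt_punctured {E : Type*} [SeminormedAddCommGroup E] {l : ℝ → E}
    (hl : ContinuousAt l 0) (h0 : ‖l 0‖ < T) : ∀ᶠ s in 𝓝[≠] (0 : ℝ), ‖l s‖ < T :=
  mem_nhdsWithin_of_mem_nhds (hl.norm.eventually_lt_const h0)

/-- If `F x = x i * c x` away from the origin with `c` continuous there, then `divCoord i F = c`. -/
theorem divCoord_eq {i j : Fin n} (hij : i ≠ j) {F c : Euc n → ℝ}
    (hF : ContDiffOn ℝ ∞ F (Metric.ball 0 T))
    (hc : ∀ x, x ≠ 0 → ‖x‖ < T → ContinuousAt c x)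
    (h : ∀ x, x ≠ 0 → ‖x‖ < T → F x = x i * c x) {x : Euc n} (hx0 : x ≠ 0) (hx : ‖x‖ < T) :
    divCoord i F x = c x := by
  have hT : 0 < T := (norm_nonneg x).trans_lt hx
  -- Nothing is assumed at the origin itself. The value there is a limit along the axis `j`, on
  -- which the coordinate `i` vanishes, so a second coordinate direction is needed.
  have hF0 : F 0 = 0 := by
    have h1 : Filter.Tendsto (fun s : ℝ => F (s • DiscMetric.basisVec j)) (𝓝[≠] 0) (𝓝 (F 0)) :=
      tendsto_comp_punctured (hF.continuousOn.continuousAt (Metric.ball_mem_nhds _ hT))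
        (by fun_prop) (by simp)
    refine tendsto_nhds_unique h1 (tendsto_const_nhds.congr' ?_)
    have h4 : ∀ᶠ s : ℝ in 𝓝[≠] 0, ‖s • (DiscMetric.basisVec j : Euc n)‖ < T :=
      eventually_norm_lt_punctured (by fun_prop) (by simpa using hT)
    filter_upwards [h4, self_mem_nhdsWithin] with s hs hs0
    rw [h _ ?_ hs]
    · simp [DiscMetric.basisVec, hij]
    · have : (DiscMetric.basisVec j : Euc n) ≠ 0 := by simp [DiscMetric.basisVec]
      exact smul_ne_zero hs0 this
  have hne : ∀ x : Euc n, x i ≠ 0 → ‖x‖ < T → divCoord i F x = c x := by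
    intro x hxi hx
    have hx0 : x ≠ 0 := by rintro rfl; simp at hxi
    have h1 : x i * divCoord i F x = F x := by
      refine mul_divCoord i hF hx ?_
      by_cases hz : x - x i • DiscMetric.basisVec i = 0
      · rw [hz, hF0]
      · rw [h _ hz]
        · simp [DiscMetric.basisVec]
        · have := norm_add_smul_basisVec_le i x (σ := 0) (by simp)
          simp only [zero_sub, neg_mul, one_mul, neg_smul, ← sub_eq_add_neg] at this
          linarith
    rw [h x hx0 hx] at h1
    exact mul_left_cancel₀ hxi h1
  by_cases hxi : x i ≠ 0
  · exact hne x hxi hx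
  -- On the hyperplane `x i = 0` away from the origin both sides are continuous. They agree at
  -- nearby points displaced in direction `i`.
  rw [not_not] at hxi
  have hdc : ContDiffOn ℝ ∞ (divCoord i F) (Metric.ball 0 T) :=
    ((IsSmoothFamily.of_contDiffOn (P := Unit) Metric.isOpen_ball hF).divCoord i).contDiffOn
      Metric.isOpen_ball ()
  have hl : ContinuousAt (fun s : ℝ => x + s • (DiscMetric.basisVec i : Euc n)) 0 := by fun_prop
  have h1 := tendsto_comp_punctured
    (hdc.continuousOn.continuousAt (Metric.isOpen_ball.mem_nhds (by simpa using hx))) hl (by simp)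
  have h2 := tendsto_comp_punctured (hc x hx0 hx) hl (by simp)
  refine tendsto_nhds_unique h1 (h2.congr' ?_)
  have h4 := eventually_norm_lt_punctured (T := T) hl (by simpa using hx)
  filter_upwards [h4, self_mem_nhdsWithin] with s hs hs0
  refine (hne _ ?_ hs).symm
  simpa [DiscMetric.basisVec, hxi] using hs0

/-- The factor `m` in `∇φ = m x` for a radial function `φ`. -/
def radialQuot (i : Fin n) (φ : Euc n → ℝ) : Euc n → ℝ :=
  divCoord i (fun x => fderiv ℝ φ x (DiscMetric.basisVec i))

theorem IsSmoothFamily.radialQuot (i : Fin n) {F : P → Euc n → ℝ}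
    (hF : IsSmoothFamily (Metric.ball (0 : Euc n) T) F) :
    IsSmoothFamily (Metric.ball (0 : Euc n) T) (fun p => _root_.radialQuot i (F p)) :=
  IsSmoothFamily.divCoord i ((hF.fderiv Metric.isOpen_ball).clm_apply (const continuous_const))

/-- The right side makes sense only off the origin. Division of a partial derivative by its
coordinate is the smooth extension, and it depends on `φ` through derivatives and integrals only. -/
theorem radialQuot_eq {i j : Fin n} (hij : i ≠ j) {φ : Euc n → ℝ} (hφ : IsRadialOn T φ)
    (hs : ContDiffOn ℝ ∞ φ (Metric.ball 0 T)) {x : Euc n} (hx0 : x ≠ 0) (hx : ‖x‖ < T) :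
    radialQuot i φ x = fderiv ℝ φ x x / ‖x‖ ^ 2 := by
  have hd := (contDiffOn_infty_iff_fderiv_of_isOpen Metric.isOpen_ball).1 hs
  have hmem : ∀ x : Euc n, ‖x‖ < T → Metric.ball (0 : Euc n) T ∈ 𝓝 x := fun x hx =>
    Metric.isOpen_ball.mem_nhds (by simpa using hx)
  refine divCoord_eq (c := fun x => fderiv ℝ φ x x / ‖x‖ ^ 2) hij
    (hd.2.clm_apply contDiffOn_const) ?_ ?_ hx0 hx
  · intro x hx0 hx
    exact ((hd.2.continuousOn.continuousAt (hmem x hx)).clm_apply continuousAt_id).div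
      (by fun_prop) (by simpa using hx0)
  · intro x hx0 hx
    rw [(hφ.hasRadialGrad hx0 hx ((hd.1 x (by simpa using hx)).differentiableAt
      (hmem x hx))).fderiv_basisVec, mul_comm]

end Radial

end

/-! ### The coefficients of a warped metric as smooth functions on the ball -/

noncomputable section

open MeasureTheory

/-- The metric has the form `g² dt² + f² dξ²` off the origin. -/
def DiscMetric.IsWarped {n : ℕ} {T : ℝ} (h : DiscMetric n T) : Prop :=
  ∃ g f : ℝ → ℝ, (∀ t ∈ Ioc 0 T, 0 < g t ∧ 0 < f t) ∧ HasWarpingOn h T g f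

/-- The space of warped metrics. -/
abbrev WarpedMetric (n : ℕ) (T : ℝ) : Type := {h : DiscMetric n T // h.IsWarped}

namespace DiscMetric

variable {n : ℕ} {T : ℝ} {i j : Fin n}

/-- The coefficient `g²` of `dt²` of a warped metric. -/
def radCoeff (i : Fin n) (h : DiscMetric n T) : Euc n → ℝ :=
  divCoord i (fun y => h.toFun y (basisVec i) y)

/-- The coefficient `f² / t²` of the round part of a warped metric. -/
def tanCoeff (i : Fin n) (h : DiscMetric n T) (x : Euc n) : ℝ :=
  ((∑ l, h.gram x l l) - radCoeff i h x) / (n - 1)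

/-- The derivative `k = t g / f` of the conformal coordinate with respect to `log t`. -/
def confSpeed (i : Fin n) (h : DiscMetric n T) (x : Euc n) : ℝ :=
  (radCoeff i h x / tanCoeff i h x) ^ (1 / 2 : ℝ)

theorem isSmoothFamily_radCoeff : IsSmoothFamily (Metric.ball (0 : Euc n) T)
    (fun h : DiscMetric n T => radCoeff i h) := by
  refine IsSmoothFamily.divCoord i ?_
  have : ∀ (h : DiscMetric n T) (y : Euc n), h.toFun y (basisVec i) y
      = ∑ l, y l * h.gram y i l := by
    intro h y
    rw [toFun_eq_sum]
    simp [basisVec]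
  simp only [this]
  exact .sum _ fun l _ => (IsSmoothFamily.clm (EuclideanSpace.proj l : Euc n →L[ℝ] ℝ)).mul
    (isSmoothFamily_gram _ _)

theorem isSmoothFamily_tanCoeff : IsSmoothFamily (Metric.ball (0 : Euc n) T)
    (fun h : DiscMetric n T => tanCoeff i h) := by
  unfold tanCoeff
  simp only [div_eq_mul_inv]
  exact ((IsSmoothFamily.sum _ fun l _ => isSmoothFamily_gram _ _).sub
    isSmoothFamily_radCoeff).mul (.const continuous_const)

theorem inner_basisVec (x : Euc n) (i : Fin n) : inner ℝ x (basisVec i) = x i := by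
  simp [basisVec, EuclideanSpace.inner_single_right]

theorem basisVec_inner (x : Euc n) (i : Fin n) : inner ℝ (basisVec i) x = x i := by
  rw [real_inner_comm, inner_basisVec]

theorem inner_basisVec_self (i j : Fin n) :
    inner ℝ (basisVec i : Euc n) (basisVec j) = kron i j := by
  rw [inner_basisVec]
  simp [basisVec, kron, eq_comm]

theorem ball_mem_nhds_of_norm_lt {x : Euc n} (hx : ‖x‖ < T) :
    Metric.ball (0 : Euc n) T ∈ 𝓝 x :=
  Metric.isOpen_ball.mem_nhds (by simpa using hx)

theorem mem_disc_of_norm_lt {x : Euc n} (hx : ‖x‖ < T) : x ∈ disc n T := by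
  simpa using hx.le

/-- The spherical part vanishes on the radial vector `x`. So contraction with `x` isolates `g²`,
which division by a coordinate then recovers as a smooth function. -/
theorem warpedForm_self {a b : ℝ} {x : Euc n} (hx : x ≠ 0) (v : Euc n) :
    warpedForm a b x v x = a ^ 2 * inner ℝ x v := by
  have hn : ‖x‖ ≠ 0 := norm_ne_zero_iff.2 hx
  simp only [warpedForm, sphereForm, radialForm, real_inner_self_eq_norm_sq, real_inner_comm x v]
  field_simp
  ring

section Warping

variable {h : DiscMetric n T} {g f : ℝ → ℝ}

theorem continuousAt_toFun_self {x : Euc n} (hx : ‖x‖ < T) (h : DiscMetric n T) :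
    ContinuousAt (fun y => h.toFun y y y) x := by
  simp only [toFun_eq_sum]
  have hg : ∀ i j, ContinuousAt (fun y => h.gram y i j) x := fun i j =>
    ((isSmoothFamily_gram i j).contDiffOn Metric.isOpen_ball h).continuousOn.continuousAt
      (ball_mem_nhds_of_norm_lt hx)
  fun_prop

theorem radCoeff_eq (hij : i ≠ j) (hw : HasWarpingOn h T g f) {x : Euc n} (hx0 : x ≠ 0)
    (hx : ‖x‖ < T) : radCoeff i h x = g ‖x‖ ^ 2 := by
  have hn : ∀ x : Euc n, x ≠ 0 → ‖x‖ ≠ 0 := fun x hx => norm_ne_zero_iff.2 hx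
  have key : ∀ x : Euc n, x ≠ 0 → ‖x‖ < T → h.toFun x x x / ‖x‖ ^ 2 = g ‖x‖ ^ 2 := by
    intro x hx0 hx
    rw [hw x hx0 hx.le, warpedForm_self hx0, real_inner_self_eq_norm_sq]
    have := hn x hx0
    field_simp
  rw [← key x hx0 hx]
  have hsm : ContDiffOn ℝ ∞ (fun y => h.toFun y (basisVec i) y) (Metric.ball (0 : Euc n) T) := by
    have : ∀ (y : Euc n), h.toFun y (basisVec i) y = ∑ l, y l * h.gram y i l := by
      intro y
      rw [toFun_eq_sum]
      simp [basisVec]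
    simp only [this]
    exact (IsSmoothFamily.sum (P := DiscMetric n T) Finset.univ fun l _ =>
      (IsSmoothFamily.clm (EuclideanSpace.proj l : Euc n →L[ℝ] ℝ)).mul
      (isSmoothFamily_gram i l)).contDiffOn Metric.isOpen_ball h
  refine divCoord_eq (c := fun x => h.toFun x x x / ‖x‖ ^ 2) hij hsm ?_ ?_ hx0 hx
  · intro y hy0 hy
    exact (continuousAt_toFun_self hy h).div (by fun_prop) (pow_ne_zero _ (hn y hy0))
  · intro y hy0 hy
    rw [key y hy0 hy, hw y hy0 hy.le, warpedForm_self hy0, inner_basisVec]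
    ring

/-- Once `g²` is known, the Euclidean trace determines `f² / t²`, which avoids any division at the
origin. -/
theorem sum_warpedForm {a b : ℝ} {x : Euc n} (hx : x ≠ 0) :
    ∑ l, warpedForm a b x (basisVec l) (basisVec l)
      = a ^ 2 + (n - 1) * (b ^ 2 / ‖x‖ ^ 2) := by
  have hn : ‖x‖ ≠ 0 := norm_ne_zero_iff.2 hx
  have : ∀ l, warpedForm a b x (basisVec l) (basisVec l)
      = (b ^ 2 / ‖x‖ ^ 2) * 1
        + (a ^ 2 / ‖x‖ ^ 2 - b ^ 2 / ‖x‖ ^ 4) * (x l * x l) := by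
    intro l
    simp only [warpedForm, sphereForm, radialForm, inner_basisVec_self, kron_self]
    simp only [inner_basisVec]
    field_simp
    ring
  rw [Finset.sum_congr rfl fun l _ => this l, sum_smul_add, sum_mul_self]
  simp
  field_simp
  ring

theorem tanCoeff_eq (hn : 2 ≤ n) (hij : i ≠ j) (hw : HasWarpingOn h T g f) {x : Euc n}
    (hx0 : x ≠ 0) (hx : ‖x‖ < T) : tanCoeff i h x = f ‖x‖ ^ 2 / ‖x‖ ^ 2 := by
  have hn' : (2 : ℝ) ≤ n := by exact_mod_cast hn
  have h1 : (n : ℝ) - 1 ≠ 0 := by linarith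
  have h2 : ∑ l, h.gram x l l = g ‖x‖ ^ 2 + (n - 1) * (f ‖x‖ ^ 2 / ‖x‖ ^ 2) := by
    rw [← sum_warpedForm hx0]
    exact Finset.sum_congr rfl fun l _ => hw x hx0 hx.le _ _
  rw [tanCoeff, radCoeff_eq hij hw hx0 hx, h2]
  field_simp
  ring

theorem toFun_eq_of_warping (hn : 2 ≤ n) (hij : i ≠ j) (hw : HasWarpingOn h T g f) {x : Euc n}
    (hx0 : x ≠ 0) (hx : ‖x‖ < T) (v w : Euc n) :
    h.toFun x v w = tanCoeff i h x * inner ℝ v w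
      + (radCoeff i h x - tanCoeff i h x) / ‖x‖ ^ 2 * (inner ℝ x v * inner ℝ x w) := by
  have hn0 : ‖x‖ ≠ 0 := norm_ne_zero_iff.2 hx0
  rw [hw x hx0 hx.le, tanCoeff_eq hn hij hw hx0 hx, radCoeff_eq hij hw hx0 hx]
  simp only [warpedForm, sphereForm, radialForm]
  field_simp
  ring

end Warping

section IsWarped

variable {h : DiscMetric n T}

theorem tendsto_toFun_smul_zero (hT : 0 < T) (l : Fin n) (v w : Euc n) (h : DiscMetric n T) :
    Filter.Tendsto (fun s : ℝ => h.toFun (s • basisVec l) v w) (𝓝[≠] 0) (𝓝 (h.toFun 0 v w)) :=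
  tendsto_comp_punctured (f := fun x => h.toFun x v w) (((isSmoothFamily_toFun v w).contDiffOn
    Metric.isOpen_ball h).continuousOn.continuousAt (Metric.ball_mem_nhds _ hT))
    (by fun_prop) (by simp)

theorem basisVec_ne_zero (l : Fin n) : (basisVec l : Euc n) ≠ 0 := by simp [basisVec]

/-- At the origin both coefficients agree with every diagonal coefficient of the metric. -/
theorem coeff_zero (hn : 2 ≤ n) (hij : i ≠ j) (hT : 0 < T) (hh : h.IsWarped) :
    0 < tanCoeff i h 0 ∧ radCoeff i h 0 = tanCoeff i h 0 := by
  obtain ⟨g, f, -, hw⟩ := hh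
  have hev : ∀ l : Fin n, ∀ᶠ s : ℝ in 𝓝[≠] 0, s • (basisVec l : Euc n) ≠ 0 ∧
      ‖s • (basisVec l : Euc n)‖ < T := by
    intro l
    filter_upwards [eventually_norm_lt_punctured (l := fun s : ℝ => s • (basisVec l : Euc n))
      (T := T) (by fun_prop) (by simpa using hT), self_mem_nhdsWithin] with s hs hs0
    exact ⟨smul_ne_zero hs0 (basisVec_ne_zero l), hs⟩
  have hlim : ∀ {c : Euc n → ℝ}, ContDiffOn ℝ ∞ c (Metric.ball 0 T) → ∀ l : Fin n,
      Filter.Tendsto (fun s : ℝ => c (s • basisVec l)) (𝓝[≠] 0) (𝓝 (c 0)) := fun hc l =>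
    tendsto_comp_punctured (hc.continuousOn.continuousAt (Metric.ball_mem_nhds _ hT))
      (by fun_prop) (by simp)
  -- On the axis `l` the vector `basisVec m` with `m ≠ l` is tangential to the spheres, whereas
  -- `basisVec l` is radial. Letting the point tend to the origin along suitable axes compares the
  -- two coefficients.
  have htan : ∀ l m : Fin n, l ≠ m → tanCoeff i h 0 = h.toFun 0 (basisVec m) (basisVec m) := by
    intro l m hlm
    refine tendsto_nhds_unique (hlim (isSmoothFamily_tanCoeff.contDiffOn Metric.isOpen_ball h) l)
      ((tendsto_toFun_smul_zero hT l _ _ h).congr' ?_)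
    filter_upwards [hev l] with s hs
    rw [toFun_eq_of_warping hn hij hw hs.1 hs.2, inner_basisVec_self, kron_self, inner_basisVec]
    simp [basisVec, hlm.symm]
  have hrad : radCoeff i h 0 = h.toFun 0 (basisVec i) (basisVec i) := by
    refine tendsto_nhds_unique (hlim (isSmoothFamily_radCoeff.contDiffOn Metric.isOpen_ball h) i)
      ((tendsto_toFun_smul_zero hT i _ _ h).congr' ?_)
    filter_upwards [hev i] with s hs
    have hs0 : s ≠ 0 := fun h => hs.1 (by simp [h])
    rw [toFun_eq_of_warping hn hij hw hs.1 hs.2, inner_basisVec_self, kron_self, inner_basisVec,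
      norm_smul]
    simp [basisVec]
    field_simp
    ring
  refine ⟨?_, hrad.trans (htan j i hij.symm).symm⟩
  rw [htan j i hij.symm]
  exact h.posDef 0 (mem_disc_of_norm_lt (by simpa using hT)) _ (basisVec_ne_zero i)

theorem toFun_zero (hn : 2 ≤ n) (hij : i ≠ j) (hT : 0 < T) (hh : h.IsWarped) (v w : Euc n) :
    h.toFun 0 v w = tanCoeff i h 0 * inner ℝ v w := by
  obtain ⟨g, f, -, hw⟩ := id hh
  have h0 := (coeff_zero hn hij hT hh).2
  have hcont : ∀ {c : Euc n → ℝ}, ContDiffOn ℝ ∞ c (Metric.ball 0 T) → 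
      Filter.Tendsto (fun s : ℝ => c (s • basisVec i)) (𝓝[≠] 0) (𝓝 (c 0)) := fun hc =>
    tendsto_comp_punctured (hc.continuousOn.continuousAt (Metric.ball_mem_nhds _ hT))
      (by fun_prop) (by simp)
  have h1 := hcont (isSmoothFamily_tanCoeff (i := i).contDiffOn Metric.isOpen_ball h)
  have h2 := hcont (isSmoothFamily_radCoeff (i := i).contDiffOn Metric.isOpen_ball h)
  have h3 := (h1.mul_const (inner ℝ v w)).add ((h2.sub h1).mul_const (v i * w i))
  rw [h0, sub_self, zero_mul, add_zero] at h3
  refine tendsto_nhds_unique (tendsto_toFun_smul_zero hT i v w h) (h3.congr' ?_)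
  filter_upwards [eventually_norm_lt_punctured (l := fun s : ℝ => s • (basisVec i : Euc n))
      (T := T) (by fun_prop) (by simpa using hT), self_mem_nhdsWithin] with s hs hs0
  have hs0 : s ≠ 0 := hs0
  rw [toFun_eq_of_warping hn hij hw (smul_ne_zero hs0 (basisVec_ne_zero i)) hs, norm_smul,
    real_inner_smul_left, real_inner_smul_left, basisVec_inner, basisVec_inner, mul_pow,
    Real.norm_eq_abs, sq_abs]
  simp only [basisVec, PiLp.norm_single, norm_one, one_pow, mul_one]
  field_simp

theorem coeff_pos (hn : 2 ≤ n) (hij : i ≠ j) (hh : h.IsWarped) {x : Euc n} (hx : ‖x‖ < T) :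
    0 < tanCoeff i h x ∧ 0 < radCoeff i h x := by
  by_cases hx0 : x = 0
  · subst hx0
    have := coeff_zero hn hij (by simpa using hx) hh
    exact ⟨this.1, this.2 ▸ this.1⟩
  · obtain ⟨g, f, hpos, hw⟩ := hh
    have hn0 : 0 < ‖x‖ := norm_pos_iff.2 hx0
    have := hpos ‖x‖ ⟨hn0, hx.le⟩
    rw [tanCoeff_eq hn hij hw hx0 hx, radCoeff_eq hij hw hx0 hx]
    exact ⟨div_pos (pow_pos this.2 2) (by positivity), pow_pos this.1 2⟩

theorem eq_zero_of_norm_eq {x y : Euc n} (hx : x = 0) (hxy : ‖x‖ = ‖y‖) : y = 0 := by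
  subst hx
  simpa using hxy.symm

theorem isRadialOn_coeff (hn : 2 ≤ n) (hij : i ≠ j) (hh : h.IsWarped) :
    IsRadialOn T (tanCoeff i h) ∧ IsRadialOn T (radCoeff i h) := by
  obtain ⟨g, f, hpos, hw⟩ := hh
  have key : ∀ x y : Euc n, ‖x‖ < T → ‖x‖ = ‖y‖ →
      tanCoeff i h x = tanCoeff i h y ∧ radCoeff i h x = radCoeff i h y := by
    intro x y hx hxy
    by_cases hx0 : x = 0
    · rw [eq_zero_of_norm_eq hx0 hxy, hx0]
      exact ⟨rfl, rfl⟩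
    · have hy0 : y ≠ 0 := fun hy => hx0 (eq_zero_of_norm_eq hy hxy.symm)
      rw [tanCoeff_eq hn hij hw hx0 hx, radCoeff_eq hij hw hx0 hx,
        tanCoeff_eq hn hij hw hy0 (hxy ▸ hx), radCoeff_eq hij hw hy0 (hxy ▸ hx), hxy]
      exact ⟨rfl, rfl⟩
  exact ⟨fun x y hx hxy => (key x y hx hxy).1, fun x y hx hxy => (key x y hx hxy).2⟩

theorem isRadialOn_confSpeed (hn : 2 ≤ n) (hij : i ≠ j) (hh : h.IsWarped) :
    IsRadialOn T (confSpeed i h) := by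
  intro x y hx hxy
  have := isRadialOn_coeff hn hij hh
  rw [confSpeed, confSpeed, this.1 x y hx hxy, this.2 x y hx hxy]

theorem confSpeed_pos (hn : 2 ≤ n) (hij : i ≠ j) (hh : h.IsWarped) {x : Euc n} (hx : ‖x‖ < T) :
    0 < confSpeed i h x :=
  Real.rpow_pos_of_pos (div_pos (coeff_pos hn hij hh hx).2 (coeff_pos hn hij hh hx).1) _

theorem confSpeed_zero (hn : 2 ≤ n) (hij : i ≠ j) (hT : 0 < T) (hh : h.IsWarped) :
    confSpeed i h 0 = 1 := by
  have := coeff_zero hn hij hT hh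
  rw [confSpeed, this.2, div_self this.1.ne', Real.one_rpow]

theorem confSpeed_sq (hn : 2 ≤ n) (hij : i ≠ j) (hh : h.IsWarped) {x : Euc n} (hx : ‖x‖ < T) :
    confSpeed i h x ^ 2 = radCoeff i h x / tanCoeff i h x := by
  rw [confSpeed, ← Real.sqrt_eq_rpow, Real.sq_sqrt]
  exact (div_pos (coeff_pos hn hij hh hx).2 (coeff_pos hn hij hh hx).1).le

theorem isSmoothFamily_confSpeed (hn : 2 ≤ n) (hij : i ≠ j) :
    IsSmoothFamily (Metric.ball (0 : Euc n) T)
      (fun h : WarpedMetric n T => confSpeed i h.1) := by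
  have hpos : ∀ (h : WarpedMetric n T), ∀ x ∈ Metric.ball (0 : Euc n) T,
      0 < tanCoeff i h.1 x ∧ 0 < radCoeff i h.1 x := fun h x hx =>
    coeff_pos hn hij h.2 (by simpa using hx)
  exact ((isSmoothFamily_radCoeff.comp_param continuous_subtype_val).div
    (isSmoothFamily_tanCoeff.comp_param continuous_subtype_val)
    fun h x hx => (hpos h x hx).1.ne').rpow_const _
    fun h x hx => div_pos (hpos h x hx).2 (hpos h x hx).1

end IsWarped

end DiscMetric

/-! ### Primitives along rays -/

section RadialPrimitive

variable {n : ℕ} {T : ℝ} {P : Type*} [TopologicalSpace P]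

/-- The averaged derivative `ω`, which satisfies `ω(x) x = k x - k 0`. -/
def avgDeriv (k : Euc n → ℝ) (x : Euc n) : Euc n →L[ℝ] ℝ :=
  ∫ σ : unitInterval, fderiv ℝ k ((σ : ℝ) • x)

/-- The primitive of `(k - k 0) / t` along rays from the origin. -/
def rayPrimitive (k : Euc n → ℝ) (x : Euc n) : ℝ :=
  ∫ σ : unitInterval, avgDeriv k ((σ : ℝ) • x) x

theorem unitInterval_smul_mem_ball {x : Euc n} (hx : x ∈ Metric.ball (0 : Euc n) T)
    (σ : unitInterval) : (σ : ℝ) • x ∈ Metric.ball (0 : Euc n) T := by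
  rw [mem_ball_zero_iff] at hx ⊢
  rw [norm_smul, Real.norm_of_nonneg σ.2.1]
  nlinarith [σ.2.1, σ.2.2, norm_nonneg x]

theorem IsSmoothFamily.smul_unitInterval :
    IsSmoothFamily (Metric.ball (0 : Euc n) T)
      (fun (q : P × unitInterval) (x : Euc n) => (q.2 : ℝ) • x) :=
  (const (c := fun q : P × unitInterval => (q.2 : ℝ)) (by fun_prop)).smul id

theorem IsSmoothFamily.avgDeriv {k : P → Euc n → ℝ}
    (hk : IsSmoothFamily (Metric.ball (0 : Euc n) T) k) :
    IsSmoothFamily (Metric.ball (0 : Euc n) T) (fun p => _root_.avgDeriv (k p)) :=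
  IsSmoothFamily.integral volume Metric.isOpen_ball
    (F := fun (q : P × unitInterval) x => _root_.fderiv ℝ (k q.1) ((q.2 : ℝ) • x))
    (comp (H := fun q : P × unitInterval => _root_.fderiv ℝ (k q.1))
      (comp_param (F := fun p => _root_.fderiv ℝ (k p)) continuous_fst
        (hk.fderiv Metric.isOpen_ball)) smul_unitInterval
      fun q _ hx => unitInterval_smul_mem_ball hx q.2)

theorem IsSmoothFamily.rayPrimitive {k : P → Euc n → ℝ}
    (hk : IsSmoothFamily (Metric.ball (0 : Euc n) T) k) :
    IsSmoothFamily (Metric.ball (0 : Euc n) T) (fun p => _root_.rayPrimitive (k p)) :=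
  IsSmoothFamily.integral volume Metric.isOpen_ball
    (F := fun (q : P × unitInterval) x => _root_.avgDeriv (k q.1) ((q.2 : ℝ) • x) x)
    ((comp (H := fun q : P × unitInterval => _root_.avgDeriv (k q.1)) (comp_param
      (F := fun p => _root_.avgDeriv (k p)) continuous_fst hk.avgDeriv) smul_unitInterval
      fun q _ hx => unitInterval_smul_mem_ball hx q.2).clm_apply id)

variable {k : Euc n → ℝ}

theorem avgDeriv_apply (hk : ContDiffOn ℝ ∞ k (Metric.ball 0 T)) {x : Euc n} (hx : ‖x‖ < T) :
    avgDeriv k x x = k x - k 0 := by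
  have hd := (contDiffOn_infty_iff_fderiv_of_isOpen Metric.isOpen_ball).1 hk
  have hmem : ∀ σ ∈ Icc (0 : ℝ) 1, σ • x ∈ Metric.ball (0 : Euc n) T := fun σ hσ =>
    unitInterval_smul_mem_ball (by simpa using hx) ⟨σ, hσ⟩
  have hcont : ContinuousOn (fun σ : ℝ => fderiv ℝ k (σ • x)) (Icc 0 1) :=
    hd.2.continuousOn.comp (by fun_prop) hmem
  have hint : IntervalIntegrable (fun σ : ℝ => fderiv ℝ k (σ • x)) volume 0 1 := by
    refine ContinuousOn.intervalIntegrable ?_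
    rwa [uIcc_of_le zero_le_one]
  rw [avgDeriv, integral_unitInterval (fun σ => fderiv ℝ k (σ • x)),
    ContinuousLinearMap.intervalIntegral_apply hint,
    intervalIntegral.integral_eq_sub_of_hasDerivAt (f := fun σ : ℝ => k (σ • x))]
  · simp
  · intro σ hσ
    rw [uIcc_of_le zero_le_one] at hσ
    have h1 := ((hd.1 _ (hmem σ hσ)).differentiableAt
      (Metric.isOpen_ball.mem_nhds (hmem σ hσ))).hasFDerivAt
    have h2 : HasDerivAt (fun σ : ℝ => σ • x) ((1 : ℝ) • x) σ := (hasDerivAt_id σ).smul_const x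
    simpa [Function.comp_def] using h1.comp_hasDerivAt σ h2
  · refine ContinuousOn.intervalIntegrable ?_
    rw [uIcc_of_le zero_le_one]
    exact hcont.clm_apply continuousOn_const

theorem rayPrimitive_zero : rayPrimitive k 0 = 0 := by simp [rayPrimitive]

theorem abs_rayPrimitive_le {x : Euc n} {M : ℝ}
    (hM : ∀ y : Euc n, ‖y‖ ≤ ‖x‖ → ‖avgDeriv k y‖ ≤ M) : |rayPrimitive k x| ≤ M * ‖x‖ := by
  rw [← Real.norm_eq_abs, rayPrimitive]
  have := norm_integral_le_of_norm_le_const (μ := (volume : Measure unitInterval))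
    (f := fun σ : unitInterval => avgDeriv k ((σ : ℝ) • x) x) (C := M * ‖x‖)
    (Filter.Eventually.of_forall fun σ => by
      refine (ContinuousLinearMap.le_opNorm _ _).trans ?_
      refine mul_le_mul_of_nonneg_right (hM _ ?_) (norm_nonneg _)
      rw [norm_smul, Real.norm_of_nonneg σ.2.1]
      nlinarith [σ.2.1, σ.2.2, norm_nonneg x])
  simpa using this

theorem isRadialOn_rayPrimitive (hk : ContDiffOn ℝ ∞ k (Metric.ball 0 T)) (hr : IsRadialOn T k) :
    IsRadialOn T (rayPrimitive k) := by
  intro x y hx hxy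
  rw [rayPrimitive, rayPrimitive, integral_unitInterval (fun σ => avgDeriv k (σ • x) x),
    integral_unitInterval (fun σ => avgDeriv k (σ • y) y)]
  refine intervalIntegral.integral_congr_ae (Filter.Eventually.of_forall fun σ hσ => ?_)
  rw [uIoc_of_le zero_le_one] at hσ
  -- For `σ > 0` the integrand is `(k (σ z) - k 0) / σ`, in which only the norm of `z` matters.
  have key : ∀ z : Euc n, ‖z‖ < T → avgDeriv k (σ • z) z = σ⁻¹ * (k (σ • z) - k 0) := by
    intro z hz
    have h1 := unitInterval_smul_mem_ball (T := T) (x := z) (by simpa using hz)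
      ⟨σ, Ioc_subset_Icc_self hσ⟩
    rw [← avgDeriv_apply hk (by simpa using h1), map_smul, smul_eq_mul,
      inv_mul_cancel_left₀ hσ.1.ne']
  have h1 := unitInterval_smul_mem_ball (T := T) (x := x) (by simpa using hx)
      ⟨σ, Ioc_subset_Icc_self hσ⟩
  rw [key x hx, key y (hxy ▸ hx), hr (σ • x) (σ • y) (by simpa using h1)
    (by rw [norm_smul, norm_smul, hxy])]

/-- By substitution the value at `s • x` is the integral from `0` to `s` of a fixed function, so the
fundamental theorem of calculus applies at `s = 1`. If `k 0 = 1`, then `log t` plus this primitive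
has `t`-derivative `k / t`, as required of a conformal coordinate. -/
theorem fderiv_rayPrimitive (hk : ContDiffOn ℝ ∞ k (Metric.ball 0 T)) {x : Euc n} (hx : ‖x‖ < T) :
    fderiv ℝ (rayPrimitive k) x x = k x - k 0 := by
  have hsf := IsSmoothFamily.of_contDiffOn (P := Unit) Metric.isOpen_ball hk
  have hJ := hsf.rayPrimitive.contDiffOn Metric.isOpen_ball ()
  have hω := (hsf.avgDeriv.contDiffOn Metric.isOpen_ball ()).continuousOn
  have hxb : x ∈ Metric.ball (0 : Euc n) T := by simpa using hx
  have h1 : HasDerivAt (fun s : ℝ => rayPrimitive k (s • x)) (fderiv ℝ (rayPrimitive k) x x) 1 := by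
    have h2 : HasFDerivAt (rayPrimitive k) (fderiv ℝ (rayPrimitive k) x) ((1 : ℝ) • x) := by
      rw [one_smul]
      exact ((hJ.differentiableOn (by simp) x hxb).differentiableAt
        (Metric.isOpen_ball.mem_nhds hxb)).hasFDerivAt
    have h3 : HasDerivAt (fun σ : ℝ => σ • x) ((1 : ℝ) • x) 1 := (hasDerivAt_id _).smul_const x
    have := h2.comp_hasDerivAt 1 h3
    rwa [one_smul] at this
  set φ : ℝ → ℝ := fun r => avgDeriv k (r • x) x with hφ
  have h2 : ∀ s : ℝ, rayPrimitive k (s • x) = ∫ r in (0 : ℝ)..s, φ r := by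
    intro s
    rw [rayPrimitive, integral_unitInterval (fun σ => avgDeriv k (σ • s • x) (s • x))]
    have := intervalIntegral.mul_integral_comp_mul_right (f := φ) (a := 0) (b := 1) s
    rw [zero_mul, one_mul] at this
    rw [← this, ← intervalIntegral.integral_const_mul]
    simp only [hφ, map_smul, smul_eq_mul, smul_smul]
  set O : Set ℝ := {r | ‖r • x‖ < T} with hO
  have hOo : IsOpen O := isOpen_lt (by fun_prop) continuous_const
  have hφc : ContinuousOn φ O :=
    (hω.comp (by fun_prop) fun r hr => mem_ball_zero_iff.2 hr).clm_apply continuousOn_const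
  have hsub : Icc (0 : ℝ) 1 ⊆ O := fun σ hσ =>
    mem_ball_zero_iff.1 (unitInterval_smul_mem_ball hxb ⟨σ, hσ⟩)
  have h1O : (1 : ℝ) ∈ O := hsub (by simp)
  have h3 : HasDerivAt (fun s : ℝ => ∫ r in (0 : ℝ)..s, φ r) (φ 1) 1 := by
    refine intervalIntegral.integral_hasDerivAt_right ?_
      (hφc.stronglyMeasurableAtFilter hOo 1 h1O) (hφc.continuousAt (hOo.mem_nhds h1O))
    refine ContinuousOn.intervalIntegrable ?_
    rw [uIcc_of_le zero_le_one]
    exact hφc.mono hsub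
  simp only [← h2] at h3
  rw [h1.unique h3, hφ]
  simp only [one_smul]
  exact avgDeriv_apply hk hx

end RadialPrimitive

end

/-! ### The torpedo function and its conformal coordinate -/

noncomputable section

/-- The warping function of a torpedo, extended beyond its neck as a cylinder. -/
def torpedoExt (ε T : ℝ) (f : ℝ → ℝ) (s : ℝ) : ℝ := if s < T then f s else ε

namespace IsTorpedoFunction

variable {ε T : ℝ} {f : ℝ → ℝ} (hf : IsTorpedoFunction ε T f)

include hf

theorem size_pos : 0 < T := by
  obtain ⟨a, ha, -⟩ := hf.cap
  exact ha.1.trans ha.2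

theorem apply_zero : f 0 = 0 := by
  obtain ⟨a, ha, h⟩ := hf.cap
  simpa using h 0 ⟨le_rfl, ha.1.le⟩

theorem apply_size : f T = ε := by
  obtain ⟨b, hb, h⟩ := hf.neck
  exact h T ⟨hb.2.le, le_rfl⟩

/-- The slope `f s / s` does not increase, since `f` is concave and vanishes at `0`. -/
theorem mul_apply_le {s s' : ℝ} (hs' : 0 < s') (hss : s' ≤ s) (hsT : s ≤ T) :
    s' * f s ≤ s * f s' := by
  have hs : 0 < s := hs'.trans_le hss
  have h1 := hf.concave.2 (show s ∈ Icc 0 T from ⟨hs.le, hsT⟩)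
    (show (0 : ℝ) ∈ Icc 0 T from ⟨le_rfl, hs.le.trans hsT⟩)
    (show 0 ≤ s' / s by positivity) (show 0 ≤ 1 - s' / s by
      rw [sub_nonneg, div_le_one hs]; exact hss) (by ring)
  simp only [hf.apply_zero, smul_eq_mul, mul_zero, add_zero, div_mul_cancel₀ _ hs.ne'] at h1
  rw [div_mul_eq_mul_div, div_le_iff₀ hs] at h1
  linarith

theorem apply_pos {s : ℝ} (hs : 0 < s) (hsT : s ≤ T) : 0 < f s := by
  have h1 := hf.mul_apply_le hs hsT le_rfl
  rw [hf.apply_size] at h1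
  have := mul_pos hs hf.radius_pos
  exact pos_of_mul_pos_right (this.trans_le h1) (hs.le.trans hsT)

/-- The slope `f s / s` is at most its value in the cap, where `sin u ≤ u` bounds it by `1`. -/
theorem apply_le {s : ℝ} (hs : 0 < s) (hsT : s ≤ T) : f s ≤ s := by
  obtain ⟨a, ha, h⟩ := hf.cap
  have h0 : 0 < min a s := lt_min ha.1 hs
  have h1 := hf.mul_apply_le h0 (min_le_right _ _) hsT
  have h2 : f (min a s) ≤ min a s := by
    rw [h _ ⟨h0.le, min_le_left _ _⟩]
    have := Real.sin_le (div_nonneg h0.le hf.radius_pos.le)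
    calc ε * Real.sin (min a s / ε) ≤ ε * (min a s / ε) :=
          mul_le_mul_of_nonneg_left this hf.radius_pos.le
      _ = min a s := by field_simp [hf.radius_pos.ne']
  have h3 : min a s * f s ≤ min a s * s := h1.trans (by nlinarith)
  exact le_of_mul_le_mul_left h3 h0

theorem ext_eq {s : ℝ} (hsT : s ≤ T) : torpedoExt ε T f s = f s := by
  rcases hsT.lt_or_eq with h | rfl
  · rw [torpedoExt, if_pos h]
  · rw [torpedoExt, if_neg (lt_irrefl _), hf.apply_size]

theorem exists_ext_eq_radius : ∃ b ∈ Ioo 0 T, ∀ s, b ≤ s → torpedoExt ε T f s = ε := by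
  obtain ⟨b, hb, h⟩ := hf.neck
  refine ⟨b, hb, fun s hs => ?_⟩
  rw [torpedoExt]
  split_ifs with hT
  · exact h s ⟨hs, hT.le⟩
  · rfl

theorem ext_pos {s : ℝ} (hs : 0 < s) : 0 < torpedoExt ε T f s := by
  rw [torpedoExt]
  split_ifs with hT
  · exact hf.apply_pos hs hT.le
  · exact hf.radius_pos

theorem ext_le {s : ℝ} (hs : 0 < s) : torpedoExt ε T f s ≤ s := by
  rw [torpedoExt]
  split_ifs with hT
  · exact hf.apply_le hs hT.le
  · have := hf.apply_le hf.size_pos le_rfl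
    rw [hf.apply_size] at this
    linarith

theorem contDiffAt_ext {s : ℝ} (hs : 0 < s) : ContDiffAt ℝ ∞ (torpedoExt ε T f) s := by
  obtain ⟨b, hb, hbe⟩ := hf.exists_ext_eq_radius
  rcases lt_or_ge s T with h | h
  · have h1 : ContDiffAt ℝ ∞ f s := hf.smooth.contDiffAt (Icc_mem_nhds hs h)
    refine h1.congr_of_eventuallyEq ?_
    filter_upwards [Iio_mem_nhds h] with r hr
    exact hf.ext_eq (le_of_lt hr)
  · refine (contDiffAt_const (c := ε)).congr_of_eventuallyEq ?_
    filter_upwards [Ioi_mem_nhds (hb.2.trans_le h)] with r hr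
    exact hbe r (le_of_lt hr)

end IsTorpedoFunction

/-- The derivative of the conformal coordinate of a torpedo with respect to `log t`. -/
def torpedoSpeed (ε T : ℝ) (f : ℝ → ℝ) (τ : ℝ) : ℝ := Real.exp τ / torpedoExt ε T f (Real.exp τ)

/-- The conformal coordinate of a torpedo as a function of `log t`, normalised to vanish at the
boundary of the disc. -/
def torpedoCoord (ε T : ℝ) (f : ℝ → ℝ) (τ : ℝ) : ℝ :=
  ∫ r in (Real.log T)..τ, torpedoSpeed ε T f r

theorem torpedoCoord_log_size {ε T : ℝ} {f : ℝ → ℝ} : torpedoCoord ε T f (Real.log T) = 0 := by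
  simp [torpedoCoord]

namespace IsTorpedoFunction

variable {ε T : ℝ} {f : ℝ → ℝ} (hf : IsTorpedoFunction ε T f)

include hf

/-- Since `f t ≤ t`, the coordinate grows at least as fast as `log t`. This makes it a bijection of
the line with smooth inverse. -/
theorem one_le_speed (τ : ℝ) : 1 ≤ torpedoSpeed ε T f τ :=
  (one_le_div (hf.ext_pos (Real.exp_pos _))).2 (hf.ext_le (Real.exp_pos _))

theorem contDiff_ext_exp : ContDiff ℝ ∞ (fun τ => torpedoExt ε T f (Real.exp τ)) :=
  contDiff_iff_contDiffAt.2 fun τ => (hf.contDiffAt_ext (Real.exp_pos τ)).comp τ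
    Real.contDiff_exp.contDiffAt

theorem contDiff_speed : ContDiff ℝ ∞ (torpedoSpeed ε T f) :=
  Real.contDiff_exp.div hf.contDiff_ext_exp fun _ => (hf.ext_pos (Real.exp_pos _)).ne'

theorem hasDerivAt_coord (τ : ℝ) : HasDerivAt (torpedoCoord ε T f) (torpedoSpeed ε T f τ) τ :=
  intervalIntegral.integral_hasDerivAt_right (hf.contDiff_speed.continuous.intervalIntegrable _ _)
    (hf.contDiff_speed.continuous.stronglyMeasurableAtFilter _ _)
    hf.contDiff_speed.continuous.continuousAt

theorem contDiff_coord : ContDiff ℝ ∞ (torpedoCoord ε T f) := by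
  rw [contDiff_infty_iff_deriv]
  refine ⟨fun τ => (hf.hasDerivAt_coord τ).differentiableAt, ?_⟩
  rw [funext fun τ => (hf.hasDerivAt_coord τ).deriv]
  exact hf.contDiff_speed

theorem strictMono_coord : StrictMono (torpedoCoord ε T f) :=
  strictMono_of_deriv_pos fun τ => by
    rw [(hf.hasDerivAt_coord τ).deriv]
    linarith [hf.one_le_speed τ]

theorem coord_sub_ge {τ₁ τ₂ : ℝ} (h : τ₁ ≤ τ₂) :
    τ₂ - τ₁ ≤ torpedoCoord ε T f τ₂ - torpedoCoord ε T f τ₁ := by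
  have : Monotone fun τ => torpedoCoord ε T f τ - τ := by
    refine monotone_of_deriv_nonneg
      (fun τ => ((hf.hasDerivAt_coord τ).sub (hasDerivAt_id τ)).differentiableAt) fun τ => ?_
    have h2 : deriv (fun τ => torpedoCoord ε T f τ - τ) τ = torpedoSpeed ε T f τ - 1 :=
      ((hf.hasDerivAt_coord τ).sub (hasDerivAt_id τ)).deriv
    rw [h2]
    linarith [hf.one_le_speed τ]
  have := this h
  simp only at this
  linarith

theorem surjective_coord : Function.Surjective (torpedoCoord ε T f) := by
  refine hf.contDiff_coord.continuous.surjective ?_ ?_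
  · refine Filter.tendsto_atTop_mono' _ (f₁ := fun τ => τ + torpedoCoord ε T f 0) ?_
      (Filter.tendsto_atTop_add_const_right _ _ Filter.tendsto_id)
    filter_upwards [Filter.eventually_ge_atTop 0] with τ hτ
    linarith [hf.coord_sub_ge hτ]
  · refine Filter.tendsto_atBot_mono' _ (f₂ := torpedoCoord ε T f)
      (f₁ := fun τ => τ + torpedoCoord ε T f 0) ?_ (Filter.tendsto_atBot_add_const_right _ _ Filter.tendsto_id)
    filter_upwards [Filter.eventually_le_atBot 0] with τ hτ
    linarith [hf.coord_sub_ge hτ]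

theorem exists_inverse : ∃ σ : ℝ → ℝ, ContDiff ℝ ∞ σ ∧ (∀ w, torpedoCoord ε T f (σ w) = w) ∧
    (∀ τ, σ (torpedoCoord ε T f τ) = τ) ∧ StrictMono σ := by
  let e := hf.strictMono_coord.orderIsoOfSurjective _ hf.surjective_coord
  refine ⟨e.symm, ?_, fun w => e.apply_symm_apply w, fun τ => e.symm_apply_apply τ,
    e.symm.strictMono⟩
  exact e.toHomeomorph.contDiff_symm_deriv (f' := torpedoSpeed ε T f)
    (fun τ => by linarith [hf.one_le_speed τ] |> ne_of_gt) (fun τ => hf.hasDerivAt_coord τ) hf.contDiff_coord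

theorem coord_eq_of_size_le {s : ℝ} (hs : T ≤ s) :
    torpedoCoord ε T f (Real.log s) = (s - T) / ε := by
  have hT := hf.size_pos
  have h1 : ∀ r ∈ uIcc (Real.log T) (Real.log s), HasDerivAt (fun r => Real.exp r / ε)
      (torpedoSpeed ε T f r) r := by
    intro r hr
    rw [uIcc_of_le (Real.log_le_log hT hs)] at hr
    have h2 : T ≤ Real.exp r := by
      rw [← Real.exp_log hT]
      exact Real.exp_le_exp.2 hr.1
    rw [torpedoSpeed, torpedoExt, if_neg (not_lt.2 h2)]
    exact (Real.hasDerivAt_exp r).div_const ε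
  rw [torpedoCoord, intervalIntegral.integral_eq_sub_of_hasDerivAt h1
    (hf.contDiff_speed.continuous.intervalIntegrable _ _), Real.exp_log hT,
    Real.exp_log (hT.trans_le hs)]
  ring

/-- Near the pole the conformal coordinate is `log (tan (t / (2 ε)))` up to a constant. -/
theorem exists_coord_eq_log_tan : ∃ a ∈ Ioo 0 T, a ≤ ε ∧
    (∀ s ∈ Icc 0 a, f s = ε * Real.sin (s / ε)) ∧
    ∃ C : ℝ, ∀ s ∈ Ioc 0 a,
      torpedoCoord ε T f (Real.log s) = Real.log (Real.tan (s / (2 * ε))) + C := by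
  obtain ⟨a, ha, hcap⟩ := hf.cap
  have hε := hf.radius_pos
  have hm : 0 < min a ε := lt_min ha.1 hε
  -- Radii of at most `ε` keep the angle `t / (2 ε)` below `1 / 2`, where sine, cosine and tangent
  -- are positive.
  refine ⟨min a ε, ⟨hm, (min_le_left _ _).trans_lt ha.2⟩, min_le_right _ _,
    fun s hs => hcap s ⟨hs.1, hs.2.trans (min_le_left _ _)⟩, ?_⟩
  set a' := min a ε with ha'
  refine ⟨torpedoCoord ε T f (Real.log a') - Real.log (Real.tan (a' / (2 * ε))), fun s hs => ?_⟩
  have hderiv : ∀ r ∈ uIcc (Real.log s) (Real.log a'),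
      HasDerivAt (fun r => Real.log (Real.tan (Real.exp r / (2 * ε)))) (torpedoSpeed ε T f r) r := by
    intro r hr
    rw [uIcc_of_le (Real.log_le_log hs.1 hs.2)] at hr
    have h2 : Real.exp r ≤ a' := by
      rw [← Real.exp_log hm]
      exact Real.exp_le_exp.2 hr.2
    have h3 := Real.exp_pos r
    set t := Real.exp r with ht
    have h4 : 0 < t / (2 * ε) := by positivity
    have h5 : t / (2 * ε) ≤ 1 / 2 := by
      rw [div_le_iff₀ (by positivity)]
      linarith [min_le_right a ε]
    have h6 : t / (2 * ε) < Real.pi / 2 := by linarith [Real.pi_gt_three]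
    have hc : 0 < Real.cos (t / (2 * ε)) :=
      Real.cos_pos_of_mem_Ioo ⟨by linarith, h6⟩
    have hs' : 0 < Real.sin (t / (2 * ε)) := Real.sin_pos_of_pos_of_lt_pi h4 (by linarith)
    have h7 := ((Real.hasDerivAt_tan hc.ne').comp r
      ((Real.hasDerivAt_exp r).div_const (2 * ε))).log (by
        simp only [Function.comp_apply]
        rw [← ht, Real.tan_eq_sin_div_cos]
        positivity)
    refine h7.congr_deriv ?_
    have h8 : f t = ε * Real.sin (t / ε) :=
      hcap t ⟨h3.le, h2.trans (min_le_left _ _)⟩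
    have h9 : Real.sin (t / ε) = 2 * Real.sin (t / (2 * ε)) * Real.cos (t / (2 * ε)) := by
      rw [← Real.sin_two_mul]
      congr 1
      field_simp
    simp only [Function.comp_apply]
    rw [torpedoSpeed, ← ht, hf.ext_eq (h2.trans ((min_le_left _ _).trans ha.2.le)), h8, h9,
      Real.tan_eq_sin_div_cos]
    field_simp
  have h1 := intervalIntegral.integral_eq_sub_of_hasDerivAt hderiv
    (hf.contDiff_speed.continuous.intervalIntegrable _ _)
  have h2 := intervalIntegral.integral_eq_sub_of_hasDerivAt
    (fun r _ => hf.hasDerivAt_coord r)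
    (hf.contDiff_speed.continuous.intervalIntegrable (Real.log s) (Real.log a'))
  rw [Real.exp_log hs.1, Real.exp_log hm] at h1
  linarith

end IsTorpedoFunction

end

/-! ### The conformal factor and coordinate of the torpedo metric -/

noncomputable section

theorem HasRadialGrad.comp_log_norm {n : ℕ} {g : ℝ → ℝ} {g' : ℝ} {x : Euc n} (hx : x ≠ 0)
    (hg : HasDerivAt g g' (Real.log ‖x‖)) :
    HasRadialGrad (fun y => g (Real.log ‖y‖)) (g' / ‖x‖ ^ 2) x := by
  have hn : ‖x‖ ≠ 0 := norm_ne_zero_iff.2 hx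
  have h1 : HasRadialGrad (fun y : Euc n => Real.log ‖y‖) (1 / ‖x‖ ^ 2) x := by
    have h2 := (HasRadialGrad.log (HasRadialGrad.normSq (x := x)) (by positivity)).const_mul (1 / 2)
    refine (h2.congr (Filter.Eventually.of_forall fun y => ?_)).congr_grad (by ring)
    simp only [Real.log_pow]
    push_cast
    ring
  exact (h1.scomp hg).congr_grad (by ring)

theorem ContDiff.hasDerivAt_deriv_top {f : ℝ → ℝ} (hf : ContDiff ℝ ∞ f) (x : ℝ) :
    HasDerivAt f (deriv f x) x := (hf.differentiable (by simp) x).hasDerivAt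

theorem ContDiff.deriv_top {f : ℝ → ℝ} (hf : ContDiff ℝ ∞ f) : ContDiff ℝ ∞ (deriv f) :=
  (contDiff_infty_iff_deriv.1 hf).2

section Torpedo

variable {n : ℕ} {ε T : ℝ} {f : ℝ → ℝ} {g₀ : DiscMetric n T}

theorem IsTorpedoFunction.isWarped (hf : IsTorpedoFunction ε T f)
    (hg₀ : HasWarpingOn g₀ T (fun _ => 1) f) : g₀.IsWarped :=
  ⟨_, f, fun _ ht => ⟨one_pos, hf.apply_pos ht.1 ht.2⟩, hg₀⟩

/-- Off the origin the formula is visibly smooth. Across the origin it agrees, up to a constant,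
with the ray primitive of the smooth function `confSpeed` of `g₀`. -/
theorem IsTorpedoFunction.exists_radial_coord (hf : IsTorpedoFunction ε T f) (hn : 2 ≤ n)
    (hg₀ : HasWarpingOn g₀ T (fun _ => 1) f) : ∃ J : Euc n → ℝ, ContDiff ℝ ∞ J ∧
      ∀ x, x ≠ 0 → J x = torpedoCoord ε T f (Real.log ‖x‖) - Real.log ‖x‖ := by
  let i : Fin n := ⟨0, by omega⟩
  let j : Fin n := ⟨1, by omega⟩
  have hij : i ≠ j := by simp [i, j]
  have hT := hf.size_pos
  have hw := hf.isWarped hg₀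
  set k := DiscMetric.confSpeed i g₀ with hk
  have hks : ContDiffOn ℝ ∞ k (Metric.ball 0 T) :=
    (DiscMetric.isSmoothFamily_confSpeed hn hij).contDiffOn Metric.isOpen_ball
      (⟨g₀, hw⟩ : WarpedMetric n T)
  have hsf := (IsSmoothFamily.of_contDiffOn (P := Unit) Metric.isOpen_ball hks).rayPrimitive
  have hJs := hsf.contDiffOn Metric.isOpen_ball ()
  have hkv : ∀ x : Euc n, x ≠ 0 → ‖x‖ < T → k x = torpedoSpeed ε T f (Real.log ‖x‖) := by
    intro x hx0 hx
    have hn0 : 0 < ‖x‖ := norm_pos_iff.2 hx0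
    have h1 := DiscMetric.confSpeed_sq hn hij hw hx
    have hfp := hf.apply_pos hn0 hx.le
    rw [DiscMetric.radCoeff_eq hij hg₀ hx0 hx, DiscMetric.tanCoeff_eq hn hij hg₀ hx0 hx] at h1
    rw [torpedoSpeed, Real.exp_log hn0, hf.ext_eq hx.le]
    refine (sq_eq_sq₀ (DiscMetric.confSpeed_pos hn hij hw hx).le (by positivity)).1 ?_
    rw [h1]
    field_simp
  set e : Euc n := DiscMetric.basisVec i with he
  have hen : ‖e‖ = 1 := by simp [he, DiscMetric.basisVec]
  have hse : ∀ s : ℝ, 0 < s → ‖s • e‖ = s := fun s hs => by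
    rw [norm_smul, hen, mul_one, Real.norm_of_nonneg hs.le]
  have hd1 : ∀ s ∈ Ioo 0 T, HasDerivAt (fun s : ℝ => rayPrimitive k (s • e))
      ((torpedoSpeed ε T f (Real.log s) - 1) / s) s := by
    intro s hs
    have hmem : s • e ∈ Metric.ball (0 : Euc n) T := by simpa [hse s hs.1] using hs.2
    have h1 := ((hJs.differentiableOn (by simp) _ hmem).differentiableAt
      (Metric.isOpen_ball.mem_nhds hmem)).hasFDerivAt
    have h2 : HasDerivAt (fun σ : ℝ => σ • e) ((1 : ℝ) • e) s := (hasDerivAt_id s).smul_const e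
    have h3 := h1.comp_hasDerivAt s h2
    refine h3.congr_deriv ?_
    have h4 := fderiv_rayPrimitive hks (x := s • e) (by rw [hse s hs.1]; exact hs.2)
    rw [hkv (s • e) (by rw [← norm_pos_iff, hse s hs.1]; exact hs.1) (by rw [hse s hs.1]; exact hs.2),
      show k 0 = 1 from DiscMetric.confSpeed_zero hn hij hT hw, hse s hs.1, map_smul,
      smul_eq_mul] at h4
    rw [one_smul, ← h4]
    have := hs.1.ne'
    field_simp
  have hd2 : ∀ s ∈ Ioo 0 T, HasDerivAt
      (fun s : ℝ => torpedoCoord ε T f (Real.log s) - Real.log s)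
      ((torpedoSpeed ε T f (Real.log s) - 1) / s) s := by
    intro s hs
    have h1 := Real.hasDerivAt_log hs.1.ne'
    refine (((hf.hasDerivAt_coord (Real.log s)).comp s h1).sub h1).congr_deriv ?_
    rw [sub_div, div_eq_mul_inv, one_div]
  -- Both functions have the same derivative on `(0, T)`. The constant `C` is the value that `J`
  -- must take at the origin.
  obtain ⟨C, hC⟩ := isOpen_Ioo.exists_eq_add_of_deriv_eq isPreconnected_Ioo
    (fun s hs => (hd2 s hs).differentiableAt.differentiableWithinAt)
    (fun s hs => (hd1 s hs).differentiableAt.differentiableWithinAt)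
    (fun s hs => (hd2 s hs).deriv.trans (hd1 s hs).deriv.symm)
  have hrad := isRadialOn_rayPrimitive hks (DiscMetric.isRadialOn_confSpeed hn hij hw)
  let J : Euc n → ℝ := fun x => if x = 0 then C else
    torpedoCoord ε T f (Real.log ‖x‖) - Real.log ‖x‖
  have hJ : ∀ x, ‖x‖ < T → J x = rayPrimitive k x + C := by
    intro x hx
    by_cases hx0 : x = 0
    · simp only [J, if_pos hx0]
      rw [hx0, rayPrimitive_zero, zero_add]
    · have hn0 : 0 < ‖x‖ := norm_pos_iff.2 hx0
      simp only [J, if_neg hx0]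
      have h1 := hC (x := ‖x‖) ⟨hn0, hx⟩
      simp only at h1
      rw [h1, hrad x (‖x‖ • e) hx (hse _ hn0).symm]
  refine ⟨J, contDiff_iff_contDiffAt.2 fun x => ?_, fun x hx => if_neg hx⟩
  by_cases hx : ‖x‖ < T
  · have h1 : ContDiffAt ℝ ∞ (fun x => rayPrimitive k x + C) x :=
      (hJs.contDiffAt (Metric.isOpen_ball.mem_nhds (by simpa using hx))).add contDiffAt_const
    refine h1.congr_of_eventuallyEq ?_
    filter_upwards [Metric.isOpen_ball.mem_nhds (show x ∈ Metric.ball 0 T by simpa using hx)]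
      with z hz using hJ z (by simpa using hz)
  · have hx0 : x ≠ 0 := by
      rintro rfl
      exact hx (by simpa using hT)
    have h1 : ContDiffAt ℝ ∞ (fun x : Euc n => Real.log ‖x‖) x :=
      (contDiffAt_norm ℝ hx0).log (norm_ne_zero_iff.2 hx0)
    have h2 : ContDiffAt ℝ ∞ (fun x : Euc n =>
        torpedoCoord ε T f (Real.log ‖x‖) - Real.log ‖x‖) x :=
      (hf.contDiff_coord.contDiffAt.comp x h1).sub h1
    refine h2.congr_of_eventuallyEq ?_
    filter_upwards [isOpen_ne.mem_nhds hx0] with z hz using if_neg hz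

/-- The conformal factor `U = f ^ α` of the extended torpedo as a function of the conformal
coordinate satisfies the differential inequality that expresses the curvature bound. -/
theorem IsTorpedoFunction.exists_conformal_factor (hf : IsTorpedoFunction ε T f) (hn : 3 ≤ n)
    (hg₀ : HasWarpingOn g₀ T (fun _ => 1) f) {B : ℝ}
    (hS : ∀ x ∈ disc n T, B < g₀.scalarCurvature x)
    {α : ℝ} (hα : α = (n - 2) / 2) :
    ∃ (B' δ : ℝ) (y : ℝ → ℝ), B < B' ∧ 0 < δ ∧ ContDiff ℝ ∞ y ∧ (∀ w, 0 < y w) ∧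
      (∀ τ, y (torpedoCoord ε T f τ) = torpedoExt ε T f (Real.exp τ) ^ α) ∧
      (∀ w, -δ ≤ w → y w = ε ^ α) ∧
      ∀ w, α / (2 * (n - 1)) * B' * y w ^ (1 + 2 / α) < α ^ 2 * y w - deriv (deriv y) w := by
  have hT := hf.size_pos
  have hn' : (3 : ℝ) ≤ n := by exact_mod_cast hn
  have hα0 : 0 < α := by rw [hα]; linarith
  obtain ⟨σ, hσ, hσ1, hσ2, hσm⟩ := hf.exists_inverse
  obtain ⟨b, hb, hbe⟩ := hf.exists_ext_eq_radius
  -- The radius `b'` lies beyond the start `b` of the neck, so its inequality is that of the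
  -- cylinder. It is less than `T`, so that the closed disc stays in the open ball where the
  -- curvature is known to be continuous.
  obtain ⟨b', hbb', hb'T⟩ := exists_between hb.2
  have hb' : 0 < b' := hb.1.trans hbb'
  set y : ℝ → ℝ := fun w => torpedoExt ε T f (Real.exp (σ w)) ^ α with hy
  have hys : ContDiff ℝ ∞ y := contDiff_iff_contDiffAt.2 fun w =>
    ((hf.contDiff_ext_exp.comp hσ).contDiffAt).rpow_const_of_ne (hf.ext_pos (Real.exp_pos _)).ne'
  have hyp : ∀ w, 0 < y w := fun w => Real.rpow_pos_of_pos (hf.ext_pos (Real.exp_pos _)) _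
  have hycoord : ∀ τ, y (torpedoCoord ε T f τ) = torpedoExt ε T f (Real.exp τ) ^ α := by
    intro τ
    simp only [hy, hσ2]
  set θ := torpedoCoord ε T f with hθ
  have hconst : ∀ w, θ (Real.log b) ≤ w → y w = ε ^ α := by
    intro w hw
    simp only [hy]
    rw [hbe]
    have := hσm.monotone hw
    rw [hσ2] at this
    calc b = Real.exp (Real.log b) := (Real.exp_log hb.1).symm
      _ ≤ _ := Real.exp_le_exp.2 this
  -- the lower curvature bound on a smaller disc
  have hSc : ContinuousOn g₀.scalarCurvature (Metric.closedBall 0 b') :=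
    ((DiscMetric.isSmoothFamily_scalarCurvature.contDiffOn Metric.isOpen_ball g₀).continuousOn).mono
      (Metric.closedBall_subset_ball hb'T)
  obtain ⟨x₀, hx₀, hmin⟩ := (isCompact_closedBall (0 : Euc n) b').exists_isMinOn
    ⟨0, by simpa using hb'.le⟩ hSc
  obtain ⟨B', hBB', hB'⟩ := exists_between (hS x₀ (Metric.closedBall_subset_closedBall hb'T.le hx₀))
  let i : Fin n := ⟨0, by omega⟩
  let j : Fin n := ⟨1, by omega⟩
  have hij : i ≠ j := by simp [i, j]
  have hcurv : ∀ τ, Real.exp τ < T → α / (2 * (n - 1)) *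
      g₀.scalarCurvature (Real.exp τ • DiscMetric.basisVec i) * y (θ τ) ^ (1 + 2 / α)
      = α ^ 2 * y (θ τ) - deriv (deriv y) (θ τ) := by
    intro τ hτ
    set x : Euc n := Real.exp τ • DiscMetric.basisVec i with hx
    have hxn : ‖x‖ = Real.exp τ := by
      simp [hx, norm_smul, DiscMetric.basisVec]
    set V : Set (Euc n) := Metric.ball 0 T ∩ {0}ᶜ with hV
    have hV0 : ∀ z ∈ V, z ≠ 0 ∧ ‖z‖ < T := fun z hz => ⟨hz.2, by simpa using hz.1⟩
    have hxV : x ∈ V := by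
      refine ⟨by simpa [hxn] using hτ, ?_⟩
      have : x ≠ 0 := norm_pos_iff.1 (by rw [hxn]; exact Real.exp_pos _)
      exact this
    have hspeed := hf.contDiff_speed
    have hgradθ : ∀ {φ : ℝ → ℝ}, ContDiff ℝ ∞ φ → ∀ z ∈ V,
        HasRadialGrad (fun z : Euc n => φ (θ (Real.log ‖z‖)))
          (torpedoSpeed ε T f (Real.log ‖z‖) * deriv φ (θ (Real.log ‖z‖)) / ‖z‖ ^ 2) z := by
      intro φ hφ z hz
      have h1 : HasDerivAt (fun τ => φ (θ τ)) _ (Real.log ‖z‖) :=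
        (hφ.hasDerivAt_deriv_top (θ (Real.log ‖z‖))).comp (Real.log ‖z‖)
          (hf.hasDerivAt_coord (Real.log ‖z‖))
      exact (HasRadialGrad.comp_log_norm (hV0 z hz).1 h1).congr_grad (by ring)
    have h := DiscMetric.scalarCurvature_conformal (h := g₀) (V := V)
      (U := fun z => y (θ (Real.log ‖z‖))) (k := fun z => torpedoSpeed ε T f (Real.log ‖z‖))
      (k₁ := fun z => deriv (torpedoSpeed ε T f) (Real.log ‖z‖) / ‖z‖ ^ 2)
      (U' := fun z => deriv y (θ (Real.log ‖z‖))) (U'' := deriv (deriv y) (θ (Real.log ‖x‖)))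
      hn inter_subset_left (Metric.isOpen_ball.inter isOpen_compl_singleton)
      (fun h0 => (hV0 0 h0).1 rfl) hα ?_ (fun z _ => hyp _)
      (fun z _ => by linarith [hf.one_le_speed (Real.log ‖z‖)] |> ne_of_gt)
      (hgradθ hys) (fun z hz => HasRadialGrad.comp_log_norm (hV0 z hz).1
        (hspeed.hasDerivAt_deriv_top _)) hxV
      ((HasRadialGrad.comp_log_norm (hV0 x hxV).1
        (hspeed.deriv_top.hasDerivAt_deriv_top _)).div .normSq
        (pow_ne_zero _ (norm_ne_zero_iff.2 (hV0 x hxV).1)))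
      (hgradθ hys.deriv_top x hxV)
    · rw [hxn, Real.log_exp] at h
      exact h
    · intro z hz a b
      obtain ⟨hz0, hzT⟩ := hV0 z hz
      have hn0 : 0 < ‖z‖ := norm_pos_iff.2 hz0
      have hfp := hf.apply_pos hn0 hzT.le
      have h1 : y (θ (Real.log ‖z‖)) ^ (2 / α) = f ‖z‖ ^ 2 := by
        rw [hycoord, Real.exp_log hn0, hf.ext_eq hzT.le, ← Real.rpow_mul hfp.le,
          mul_div_cancel₀ _ hα0.ne']
        norm_cast
      simp only [h1]
      have h2 := DiscMetric.toFun_eq_of_warping (by omega) hij hg₀ hz0 hzT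
        (DiscMetric.basisVec a) (DiscMetric.basisVec b)
      rw [DiscMetric.tanCoeff_eq (by omega) hij hg₀ hz0 hzT,
        DiscMetric.radCoeff_eq hij hg₀ hz0 hzT, DiscMetric.inner_basisVec_self,
        DiscMetric.inner_basisVec, DiscMetric.inner_basisVec] at h2
      rw [DiscMetric.gram, Matrix.of_apply, h2, torpedoSpeed, Real.exp_log hn0, hf.ext_eq hzT.le]
      field_simp
  have hode1 : ∀ τ, Real.exp τ ≤ b' → α / (2 * (n - 1)) * B' * y (θ τ) ^ (1 + 2 / α)
      < α ^ 2 * y (θ τ) - deriv (deriv y) (θ τ) := by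
    intro τ hτ
    rw [← hcurv τ (hτ.trans_lt hb'T)]
    have h1 : B' < g₀.scalarCurvature (Real.exp τ • DiscMetric.basisVec i) := by
      refine hB'.trans_le (hmin ?_)
      simpa [norm_smul, DiscMetric.basisVec] using hτ
    have h2 : 0 < α / (2 * ((n : ℝ) - 1)) := div_pos hα0 (by linarith)
    exact mul_lt_mul_of_pos_right (mul_lt_mul_of_pos_left h1 h2) (Real.rpow_pos_of_pos (hyp _) _)
  have hlog : θ (Real.log b) < θ (Real.log b') := hf.strictMono_coord (Real.log_lt_log hb.1 hbb')
  have hder : ∀ w, θ (Real.log b) < w → deriv (deriv y) w = 0 := by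
    intro w hw
    have h1 : ∀ w, θ (Real.log b) < w → y =ᶠ[𝓝 w] fun _ => ε ^ α := by
      intro w hw
      filter_upwards [Ioi_mem_nhds hw] with r hr using hconst r (le_of_lt hr)
    have h2 : deriv y =ᶠ[𝓝 w] fun _ => 0 := by
      filter_upwards [Ioi_mem_nhds hw] with r hr
      rw [(h1 r hr).deriv_eq, deriv_const]
    rw [h2.deriv_eq, deriv_const]
  have hb0 : θ (Real.log b) < 0 := by
    rw [← torpedoCoord_log_size (ε := ε) (T := T) (f := f)]
    exact hf.strictMono_coord (Real.log_lt_log hb.1 hb.2)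
  refine ⟨B', -θ (Real.log b), y, hBB', by linarith, hys, hyp, hycoord, fun w hw =>
    hconst w (by linarith), fun w => ?_⟩
  by_cases hw : w ≤ θ (Real.log b')
  · have h1 := hode1 (σ w) (by
      rw [← Real.le_log_iff_exp_le hb']
      have := hσm.monotone hw
      rwa [hσ2] at this)
    rwa [hσ1] at h1
  -- Beyond `b'` the factor is the same constant as at `b'`, and its second derivative vanishes in
  -- both places.
  · rw [not_le] at hw
    have h1 := hode1 (Real.log b') (by rw [Real.exp_log hb'])
    rw [hconst _ hlog.le, hder _ hlog] at h1
    rw [hconst w (hlog.trans hw).le, hder w (hlog.trans hw)]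
    exact h1

end Torpedo

end

/-! ### The torpedo followed by a narrowing tube -/

noncomputable section

/-- A smooth positive function which is `1` for `z ≤ 0` and `exp (-z)` for `z ≥ 1`. -/
def smoothDecay (z : ℝ) : ℝ := Real.exp (-(z * Real.smoothTransition z))

theorem contDiff_smoothTransition : ContDiff ℝ ∞ Real.smoothTransition :=
  Real.smoothTransition.contDiff

theorem contDiff_smoothDecay : ContDiff ℝ ∞ smoothDecay :=
  Real.contDiff_exp.comp (contDiff_id.mul contDiff_smoothTransition).neg

theorem smoothDecay_pos (z : ℝ) : 0 < smoothDecay z := Real.exp_pos _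

theorem smoothDecay_of_nonpos {z : ℝ} (hz : z ≤ 0) : smoothDecay z = 1 := by
  rw [smoothDecay, Real.smoothTransition.zero_of_nonpos hz]
  simp

theorem smoothDecay_of_one_le {z : ℝ} (hz : 1 ≤ z) : smoothDecay z = Real.exp (-z) := by
  rw [smoothDecay, Real.smoothTransition.one_of_one_le hz, mul_one]

theorem smoothDecay_le_one (z : ℝ) : smoothDecay z ≤ 1 := by
  rcases le_total z 0 with h | h
  · rw [smoothDecay_of_nonpos h]
  · rw [smoothDecay, Real.exp_le_one_iff, neg_nonpos]
    exact mul_nonneg h (Real.smoothTransition.nonneg z)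

theorem deriv_smoothDecay_of_neg {z : ℝ} (hz : z < 0) :
    deriv smoothDecay z = 0 ∧ deriv (deriv smoothDecay) z = 0 := by
  have h1 : ∀ z < 0, deriv smoothDecay z = 0 := by
    intro z hz
    have : smoothDecay =ᶠ[𝓝 z] fun _ => 1 := by
      filter_upwards [Iio_mem_nhds hz] with r hr using smoothDecay_of_nonpos (le_of_lt hr)
    rw [this.deriv_eq, deriv_const]
  refine ⟨h1 z hz, ?_⟩
  have : deriv smoothDecay =ᶠ[𝓝 z] fun _ => 0 := by
    filter_upwards [Iio_mem_nhds hz] with r hr using h1 r hr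
  rw [this.deriv_eq, deriv_const]

theorem deriv_smoothDecay_of_one_lt {z : ℝ} (hz : 1 < z) :
    deriv smoothDecay z = -Real.exp (-z) ∧ deriv (deriv smoothDecay) z = Real.exp (-z) := by
  have h0 : ∀ z : ℝ, HasDerivAt (fun z => Real.exp (-z)) (-Real.exp (-z)) z := by
    intro z
    simpa using (hasDerivAt_neg z).exp
  have h1 : ∀ z, 1 < z → deriv smoothDecay z = -Real.exp (-z) := by
    intro z hz
    have : smoothDecay =ᶠ[𝓝 z] fun z => Real.exp (-z) := by
      filter_upwards [Ioi_mem_nhds hz] with r hr using smoothDecay_of_one_le (le_of_lt hr)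
    rw [this.deriv_eq, (h0 z).deriv]
  refine ⟨h1 z hz, ?_⟩
  have : deriv smoothDecay =ᶠ[𝓝 z] fun z => -Real.exp (-z) := by
    filter_upwards [Ioi_mem_nhds hz] with r hr using h1 r hr
  rw [this.deriv_eq, (h0 z).fun_neg.deriv, neg_neg]

/-- The quotient of the second derivative by the function is `0` for `z < 0`, `1` for `z > 1`, and
bounded on `[0, 1]` by continuity. Slowing the decay by a factor `β` multiplies the bound by `β²`,
hence makes it arbitrarily small. -/
theorem exists_deriv_deriv_smoothDecay_le :
    ∃ C : ℝ, 0 < C ∧ ∀ z, deriv (deriv smoothDecay) z ≤ C * smoothDecay z := by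
  have hc : Continuous fun z => deriv (deriv smoothDecay) z / smoothDecay z :=
    (contDiff_smoothDecay.deriv_top.deriv_top.continuous).div contDiff_smoothDecay.continuous
      fun z => (smoothDecay_pos z).ne'
  obtain ⟨C, hC⟩ := (isCompact_Icc (a := (0 : ℝ)) (b := 1)).bddAbove_image hc.continuousOn
  refine ⟨max C 1, lt_max_of_lt_right one_pos, fun z => ?_⟩
  rw [← div_le_iff₀ (smoothDecay_pos z)]
  by_cases h0 : z < 0
  · rw [(deriv_smoothDecay_of_neg h0).2, zero_div]
    exact le_max_of_le_right zero_le_one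
  by_cases h1 : 1 < z
  · rw [(deriv_smoothDecay_of_one_lt h1).2, smoothDecay_of_one_le h1.le,
      div_self (Real.exp_pos _).ne']
    exact le_max_right _ _
  · exact le_max_of_le_left (hC (mem_image_of_mem _ ⟨not_lt.1 h0, not_lt.1 h1⟩))

/-- The data of a torpedo followed by a narrowing tube: the conformal factor `y` of
`y ^ (2 / α) (dv² + dξ²)` as a function of the conformal coordinate `v`, and the conformal
coordinate `log |x| + J x` of the torpedo. -/
structure TorpedoProfile (n : ℕ) (T α c B w₁ : ℝ) (f₀ : ℝ → ℝ) where
  y : ℝ → ℝ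
  yhat : ℝ → ℝ
  J : Euc n → ℝ
  E₀ : ℝ
  κ : ℝ
  r₀ : ℝ
  w₁_pos : 0 < w₁
  E₀_pos : 0 < E₀
  κ_pos : 0 < κ
  r₀_pos : 0 < r₀
  y_smooth : ContDiff ℝ ∞ y
  y_pos : ∀ w, 0 < y w
  ode : ∀ w, c * B * y w ^ (1 + 2 / α) < α ^ 2 * y w - deriv (deriv y) w
  -- The slack `κ * y w`, proportional to `y`, persists along the whole narrowing tube and pays for
  -- the gluing errors.
  ode_neck : ∀ w, w₁ ≤ w →
    κ * y w + c * B * y w ^ (1 + 2 / α) ≤ α ^ 2 * y w - deriv (deriv y) w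
  y_le : ∀ w, w₁ ≤ w → y w ≤ E₀
  flat : ∀ w ∈ Icc w₁ (w₁ + 1), y w = E₀
  y_tendsto : Filter.Tendsto y Filter.atTop (𝓝 0)
  y'_tendsto : Filter.Tendsto (deriv y) Filter.atTop (𝓝 0)
  y''_tendsto : Filter.Tendsto (deriv (deriv y)) Filter.atTop (𝓝 0)
  -- The variable of `yhat` is `exp (2 w)`, which extends smoothly by `0` over the pole where `w →
  -- -∞`. The domain is an open neighbourhood of `[0, ∞)`.
  yhat_smooth : ContDiffOn ℝ ∞ yhat (Ioi (-r₀))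
  yhat_exp : ∀ w, yhat (Real.exp (2 * w)) = y w * Real.exp (-(α * w))
  yhat_zero_pos : 0 < yhat 0
  J_smooth : ContDiff ℝ ∞ J
  J_radial : ∀ x z, ‖x‖ = ‖z‖ → J x = J z
  J_speed_pos : ∀ x, 0 < 1 + fderiv ℝ J x x
  J_speed_eq : ∀ x, x ≠ 0 → ‖x‖ ≤ T → 1 + fderiv ℝ J x x = ‖x‖ / f₀ ‖x‖
  y_coord : ∀ x, x ≠ 0 → ‖x‖ ≤ T → y (Real.log ‖x‖ + J x) = f₀ ‖x‖ ^ α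
  -- Even at twice the size of the torpedo the coordinate is three units short of the cutoff at
  -- `w₁`. This is the room in which the coordinate of `h` is exchanged for that of the torpedo.
  coord_le : ∀ x, x ≠ 0 → ‖x‖ ≤ 2 * T → Real.log ‖x‖ + J x ≤ w₁ - 3

/-- On the cylinder the inequality has the strict gap `2 κ E₀`. Multiplying the constant `E₀` by a
slowly decaying `η ≤ 1` costs only `η'' ≤ κ η`, half of the gap, and the nonlinear term does not get
worse because `η ^ q ≤ η`. -/
theorem IsTorpedoFunction.exists_torpedoProfile {n : ℕ} {ε T : ℝ} {f : ℝ → ℝ}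
    {g₀ : DiscMetric n T} (hf : IsTorpedoFunction ε T f) (hn : 3 ≤ n)
    (hg₀ : HasWarpingOn g₀ T (fun _ => 1) f) {B : ℝ} (hB : 0 ≤ B)
    (hS : ∀ x ∈ disc n T, B < g₀.scalarCurvature x) {α : ℝ} (hα : α = (n - 2) / 2) :
    ∃ B' w₁ : ℝ, B < B' ∧ Nonempty (TorpedoProfile n T α (α / (2 * (n - 1))) B' w₁ f) := by
  have hT := hf.size_pos
  have hε := hf.radius_pos
  have hn' : (3 : ℝ) ≤ n := by exact_mod_cast hn
  have hα0 : 0 < α := by rw [hα]; linarith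
  obtain ⟨B', δ, y₀, hBB', hδ, hy₀s, hy₀p, hy₀c, hy₀e, hode⟩ :=
    hf.exists_conformal_factor hn hg₀ hS hα
  obtain ⟨J, hJs, hJ⟩ := hf.exists_radial_coord (by omega : 2 ≤ n) hg₀
  obtain ⟨a, ha, haε, hcap, C₁, hC₁⟩ := hf.exists_coord_eq_log_tan
  obtain ⟨C, hC, hCle⟩ := exists_deriv_deriv_smoothDecay_le
  set c := α / (2 * ((n : ℝ) - 1)) with hc
  have hc0 : 0 < c := div_pos hα0 (by linarith)
  set q := 1 + 2 / α with hq
  set E₀ := ε ^ α with hE₀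
  have hE₀p : 0 < E₀ := Real.rpow_pos_of_pos hε _
  -- Along the cylinder `dv = dt / ε`, so the radius `2 * T` has coordinate `T / ε`. The `3` is the
  -- margin in `coord_le`.
  set w₁ := T / ε + 3 with hw₁
  have hw₁0 : 3 < w₁ := by
    have := div_pos hT hε
    linarith
  -- the cylindrical end of the torpedo leaves room for a slow decay
  have hdd₀ : deriv (deriv y₀) 0 = 0 := by
    have h1 : ∀ w, -δ < w → deriv y₀ w = 0 := by
      intro w hw
      have : y₀ =ᶠ[𝓝 w] fun _ => E₀ := by
        filter_upwards [Ioi_mem_nhds hw] with r hr using hy₀e r (le_of_lt hr)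
      rw [this.deriv_eq, deriv_const]
    have : deriv y₀ =ᶠ[𝓝 0] fun _ => 0 := by
      filter_upwards [Ioi_mem_nhds (neg_lt_zero.2 hδ)] with r hr using h1 r hr
    rw [this.deriv_eq, deriv_const]
  have hgap := hode 0
  rw [hy₀e 0 (by linarith), hdd₀, sub_zero] at hgap
  set κ := (α ^ 2 * E₀ - c * B' * E₀ ^ q) / (2 * E₀) with hκ
  have hκ0 : 0 < κ := div_pos (by linarith) (by linarith)
  have hκe : c * B' * E₀ ^ q = (α ^ 2 - 2 * κ) * E₀ := by
    rw [hκ]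
    field_simp
    ring
  -- With this rate the second derivative of the decay factor is at most `β² C = κ` times the
  -- factor.
  set β := Real.sqrt (κ / C) with hβ
  have hβ0 : 0 < β := Real.sqrt_pos.2 (div_pos hκ0 hC)
  have hβ2 : β ^ 2 * C = κ := by
    rw [hβ, Real.sq_sqrt (div_pos hκ0 hC).le, div_mul_cancel₀ _ hC.ne']
  set y : ℝ → ℝ := fun w => y₀ w * smoothDecay (β * (w - w₁ - 2)) with hy
  have hηs : ContDiff ℝ ∞ fun w : ℝ => smoothDecay (β * (w - w₁ - 2)) :=
    contDiff_smoothDecay.comp (by fun_prop)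
  have hys : ContDiff ℝ ∞ y := hy₀s.mul hηs
  have hy1 : ∀ w ≤ w₁ + 2, y w = y₀ w := by
    intro w hw
    simp only [hy]
    rw [smoothDecay_of_nonpos (mul_nonpos_of_nonneg_of_nonpos hβ0.le (by linarith)), mul_one]
  have hy2 : ∀ w, -δ ≤ w → y w = E₀ * smoothDecay (β * (w - w₁ - 2)) := by
    intro w hw
    simp only [hy]
    rw [hy₀e w hw]
  have hdη : ∀ {φ : ℝ → ℝ}, ContDiff ℝ ∞ φ → ∀ w, HasDerivAt (fun w => φ (β * (w - w₁ - 2)))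
      (β * deriv φ (β * (w - w₁ - 2))) w := by
    intro φ hφ w
    have h1 : HasDerivAt (fun w => β * (w - w₁ - 2)) β w := by
      simpa using (((hasDerivAt_id w).sub_const w₁).sub_const 2).const_mul β
    exact ((hφ.hasDerivAt_deriv_top _).comp w h1).congr_deriv (by ring)
  have hdy : ∀ w, -δ < w → deriv y w = E₀ * (β * deriv smoothDecay (β * (w - w₁ - 2))) := by
    intro w hw
    have : y =ᶠ[𝓝 w] fun w => E₀ * smoothDecay (β * (w - w₁ - 2)) := by
      filter_upwards [Ioi_mem_nhds hw] with r hr using hy2 r (le_of_lt hr)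
    rw [this.deriv_eq, ((hdη contDiff_smoothDecay w).const_mul E₀).deriv]
  have hddy : ∀ w, -δ < w →
      deriv (deriv y) w = E₀ * (β * (β * deriv (deriv smoothDecay) (β * (w - w₁ - 2)))) := by
    intro w hw
    have : deriv y =ᶠ[𝓝 w] fun w => E₀ * (β * deriv smoothDecay (β * (w - w₁ - 2))) := by
      filter_upwards [Ioi_mem_nhds hw] with r hr using hdy r hr
    rw [this.deriv_eq,
      (((hdη contDiff_smoothDecay.deriv_top w).const_mul β).const_mul E₀).deriv]
  have hneck : ∀ w, -δ < w → κ * y w + c * B' * y w ^ q ≤ α ^ 2 * y w - deriv (deriv y) w := by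
    intro w hw
    have h1 := smoothDecay_pos (β * (w - w₁ - 2))
    have h2 := smoothDecay_le_one (β * (w - w₁ - 2))
    have h3 := hCle (β * (w - w₁ - 2))
    rw [hddy w hw, hy2 w hw.le]
    set η := smoothDecay (β * (w - w₁ - 2)) with hη
    have h4 : η ^ q ≤ η := by
      calc η ^ q ≤ η ^ (1 : ℝ) := Real.rpow_le_rpow_of_exponent_ge h1 h2
            (by rw [hq]; linarith [div_pos two_pos hα0])
        _ = η := Real.rpow_one _
    have h5 : c * B' * (E₀ * η) ^ q ≤ (α ^ 2 - 2 * κ) * E₀ * η := by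
      rw [Real.mul_rpow hE₀p.le h1.le, ← mul_assoc, hκe]
      refine mul_le_mul_of_nonneg_left h4 ?_
      rw [← hκe]
      have : 0 ≤ B' := by linarith
      positivity
    have h6 : E₀ * (β * (β * deriv (deriv smoothDecay) (β * (w - w₁ - 2)))) ≤ κ * (E₀ * η) := by
      have : E₀ * (β * (β * deriv (deriv smoothDecay) (β * (w - w₁ - 2))))
          ≤ E₀ * (β * (β * (C * η))) := by gcongr
      refine this.trans_eq ?_
      rw [← hβ2]; ring
    linarith
  have hev : ∀ᶠ w in Filter.atTop, -δ < w ∧ 1 < β * (w - w₁ - 2) := by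
    filter_upwards [Filter.eventually_gt_atTop (-δ),
      Filter.eventually_gt_atTop (1 / β + w₁ + 2)] with w h1 h2
    refine ⟨h1, ?_⟩
    have : 1 / β < w - w₁ - 2 := by linarith
    rwa [div_lt_iff₀' hβ0] at this
  have hlim : Filter.Tendsto (fun w : ℝ => Real.exp (-(β * (w - w₁ - 2)))) Filter.atTop (𝓝 0) := by
    refine Real.tendsto_exp_neg_atTop_nhds_zero.comp (Filter.Tendsto.const_mul_atTop hβ0 ?_)
    refine Filter.tendsto_atTop_add_const_right _ (-2) ?_
    exact Filter.tendsto_atTop_add_const_right _ (-w₁) Filter.tendsto_id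
  -- the smooth extension of the conformal factor through the origin
  have hsurj := hf.surjective_coord
  set z₀ := Real.exp (2 * torpedoCoord ε T f (Real.log a)) with hz₀
  have hca : torpedoCoord ε T f (Real.log a) < 0 := by
    rw [← torpedoCoord_log_size (ε := ε) (T := T) (f := f)]
    exact hf.strictMono_coord (Real.log_lt_log ha.1 ha.2)
  -- In the cap `exp (w - C₁) = tan (t / (2 ε))` and `f = 2 ε tan / (1 + tan²)`. Hence `f exp (-w) =
  -- 2 ε exp (-C₁) / (1 + exp (2 w) exp (-2 C₁))`, smooth in `z = exp (2 w)` as long as `z > -exp (2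
  -- C₁)`.
  set yhat : ℝ → ℝ := fun z => if z < z₀ then
      (2 * ε * Real.exp (-C₁) / (1 + z * Real.exp (-(2 * C₁)))) ^ α
    else y (Real.log z / 2) * Real.exp (-(α * (Real.log z / 2))) with hyhat
  have hyexp : ∀ w, yhat (Real.exp (2 * w)) = y w * Real.exp (-(α * w)) := by
    intro w
    simp only [hyhat, hz₀, Real.exp_lt_exp, Real.log_exp]
    rw [mul_div_cancel_left₀ _ (two_ne_zero' ℝ)]
    split_ifs with hw
    · obtain ⟨τ, rfl⟩ := hsurj w
      have h1 : τ < Real.log a := hf.strictMono_coord.lt_iff_lt.1 (by linarith)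
      have h2 : Real.exp τ < a := (Real.lt_log_iff_exp_lt ha.1).1 h1
      have h0 := Real.exp_pos τ
      have h3 := hC₁ (Real.exp τ) ⟨h0, h2.le⟩
      rw [Real.log_exp] at h3
      rw [hy1 _ (by linarith), hy₀c, hf.ext_eq (h2.trans ha.2).le, hcap _ ⟨h0.le, h2.le⟩]
      set s := Real.exp τ with hs
      have h4 : 0 < s / (2 * ε) := by positivity
      have h5 : s / (2 * ε) ≤ 1 / 2 := by
        rw [div_le_iff₀ (by positivity)]
        linarith
      have hcos : 0 < Real.cos (s / (2 * ε)) :=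
        Real.cos_pos_of_mem_Ioo ⟨by linarith [Real.pi_gt_three], by linarith [Real.pi_gt_three]⟩
      have hsin : 0 < Real.sin (s / (2 * ε)) :=
        Real.sin_pos_of_pos_of_lt_pi h4 (by linarith [Real.pi_gt_three])
      have h9 : Real.sin (s / ε) = 2 * Real.sin (s / (2 * ε)) * Real.cos (s / (2 * ε)) := by
        rw [← Real.sin_two_mul]
        congr 1
        field_simp
      have htan : 0 < Real.tan (s / (2 * ε)) := by
        rw [Real.tan_eq_sin_div_cos]; positivity
      rw [h3, h9]
      have h10 : Real.exp (-(α * (Real.log (Real.tan (s / (2 * ε))) + C₁)))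
          = (Real.exp (-C₁) / Real.tan (s / (2 * ε))) ^ α := by
        rw [Real.rpow_def_of_pos (by positivity), Real.log_div (Real.exp_pos _).ne' htan.ne',
          Real.log_exp]
        congr 1
        ring
      rw [h10, ← Real.mul_rpow (by positivity) (by positivity)]
      congr 1
      have h11 : Real.exp (2 * (Real.log (Real.tan (s / (2 * ε))) + C₁)) * Real.exp (-(2 * C₁))
          = Real.tan (s / (2 * ε)) ^ 2 := by
        rw [← Real.exp_add]
        have : 2 * (Real.log (Real.tan (s / (2 * ε))) + C₁) + -(2 * C₁)
            = Real.log (Real.tan (s / (2 * ε))) + Real.log (Real.tan (s / (2 * ε))) := by ring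
        rw [this, Real.exp_add, Real.exp_log htan, sq]
      rw [h11, Real.tan_eq_sin_div_cos]
      have h12 := Real.sin_sq_add_cos_sq (s / (2 * ε))
      generalize Real.sin (s / (2 * ε)) = S at *
      generalize Real.cos (s / (2 * ε)) = K at *
      have h13 : 1 + (S / K) ^ 2 = 1 / K ^ 2 := by
        field_simp
        linarith
      rw [h13]
      field_simp
    · rfl
  have hyhatpos : ∀ z, 0 < z → yhat z = y (Real.log z / 2) * Real.exp (-(α * (Real.log z / 2))) := by
    intro z hz
    rw [← hyexp]
    congr 1
    rw [mul_div_cancel₀ _ (two_ne_zero' ℝ), Real.exp_log hz]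
  have hspeed : ∀ x : Euc n, x ≠ 0 →
      1 + fderiv ℝ J x x = torpedoSpeed ε T f (Real.log ‖x‖) := by
    intro x hx
    have h1 : HasDerivAt (fun τ => torpedoCoord ε T f τ - τ)
        (torpedoSpeed ε T f (Real.log ‖x‖) - 1) (Real.log ‖x‖) :=
      (hf.hasDerivAt_coord _).sub (hasDerivAt_id _)
    have h2 : HasRadialGrad J ((torpedoSpeed ε T f (Real.log ‖x‖) - 1) / ‖x‖ ^ 2) x := by
      refine (HasRadialGrad.comp_log_norm hx h1).congr ?_
      filter_upwards [isOpen_ne.mem_nhds hx] with z hz using hJ z hz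
    rw [h2.fderiv_self, div_mul_cancel₀ _ (pow_ne_zero _ (norm_ne_zero_iff.2 hx))]
    ring
  have hcoord : ∀ x : Euc n, x ≠ 0 →
      Real.log ‖x‖ + J x = torpedoCoord ε T f (Real.log ‖x‖) := by
    intro x hx
    rw [hJ x hx]
    ring
  refine ⟨B', w₁, hBB', ⟨{
    y := y, yhat := yhat, J := J, E₀ := E₀, κ := κ, r₀ := Real.exp (2 * C₁)
    w₁_pos := by linarith
    E₀_pos := hE₀p
    κ_pos := hκ0
    r₀_pos := Real.exp_pos _
    y_smooth := hys
    y_pos := fun w => mul_pos (hy₀p w) (smoothDecay_pos _)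
    ode := ?_
    ode_neck := fun w hw => hneck w (by linarith)
    y_le := fun w hw => ?_
    flat := fun w hw => ?_
    y_tendsto := ?_
    y'_tendsto := ?_
    y''_tendsto := ?_
    yhat_smooth := ?_
    yhat_exp := hyexp
    yhat_zero_pos := ?_
    J_smooth := hJs
    J_radial := ?_
    J_speed_pos := ?_
    J_speed_eq := ?_
    y_coord := ?_
    coord_le := ?_ }⟩⟩
  · intro w
    by_cases hw : -δ < w
    · have := hneck w hw
      have h2 : 0 < κ * y w := mul_pos hκ0 (mul_pos (hy₀p w) (smoothDecay_pos _))
      linarith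
    · have h1 : y =ᶠ[𝓝 w] y₀ := by
        filter_upwards [Iio_mem_nhds (show w < w₁ + 2 by linarith)] with r hr
          using hy1 r (le_of_lt hr)
      rw [h1.deriv.deriv_eq, h1.eq_of_nhds]
      exact hode w
  · rw [hy2 w (by linarith)]
    exact mul_le_of_le_one_right hE₀p.le (smoothDecay_le_one _)
  · rw [hy1 w (by linarith [hw.2]), hy₀e w (by linarith [hw.1])]
  · have h1 := hlim.const_mul E₀
    rw [mul_zero] at h1
    refine h1.congr' ?_
    filter_upwards [hev] with w hw
    rw [hy2 w hw.1.le, smoothDecay_of_one_le hw.2.le]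
  · have h1 := ((hlim.neg).const_mul β).const_mul E₀
    rw [neg_zero, mul_zero, mul_zero] at h1
    refine h1.congr' ?_
    filter_upwards [hev] with w hw
    rw [hdy w hw.1, (deriv_smoothDecay_of_one_lt hw.2).1]
  · have h1 := ((hlim.const_mul β).const_mul β).const_mul E₀
    rw [mul_zero, mul_zero, mul_zero] at h1
    refine h1.congr' ?_
    filter_upwards [hev] with w hw
    rw [hddy w hw.1, (deriv_smoothDecay_of_one_lt hw.2).2]
  · intro z hz
    refine ContDiffAt.contDiffWithinAt ?_
    by_cases h : z < z₀
    · have hz' : 0 < 1 + z * Real.exp (-(2 * C₁)) := by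
        have h1 : -Real.exp (2 * C₁) < z := hz
        have h2 : Real.exp (2 * C₁) * Real.exp (-(2 * C₁)) = 1 := by
          rw [← Real.exp_add, add_neg_cancel, Real.exp_zero]
        nlinarith [mul_lt_mul_of_pos_right h1 (Real.exp_pos (-(2 * C₁)))]
      have h1 : ContDiffAt ℝ ∞ (fun z =>
          (2 * ε * Real.exp (-C₁) / (1 + z * Real.exp (-(2 * C₁)))) ^ α) z := by
        refine ContDiffAt.rpow_const_of_ne (contDiffAt_const.div (by fun_prop) hz'.ne') ?_
        have := Real.exp_pos (-C₁)
        positivity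
      refine h1.congr_of_eventuallyEq ?_
      filter_upwards [Iio_mem_nhds h] with r hr using if_pos hr
    · have hz0 : 0 < z := (Real.exp_pos _).trans_le (not_lt.1 h)
      have h1 : ContDiffAt ℝ ∞ (fun z => Real.log z / 2) z :=
        (contDiffAt_id.log hz0.ne').div_const 2
      have h2 : ContDiffAt ℝ ∞ (fun z =>
          y (Real.log z / 2) * Real.exp (-(α * (Real.log z / 2)))) z :=
        (hys.contDiffAt.comp z h1).mul (contDiffAt_const.mul h1).neg.exp
      refine h2.congr_of_eventuallyEq ?_
      filter_upwards [Ioi_mem_nhds hz0] with r hr using hyhatpos r hr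
  · simp only [hyhat]
    rw [if_pos (Real.exp_pos _)]
    have := Real.exp_pos (-C₁)
    simp only [zero_mul, add_zero, div_one]
    positivity
  · intro x z hxz
    by_cases hx : x = 0
    · have hz : z = 0 := DiscMetric.eq_zero_of_norm_eq hx hxz
      rw [hx, hz]
    · have hz : z ≠ 0 := fun h => hx (DiscMetric.eq_zero_of_norm_eq h hxz.symm)
      rw [hJ x hx, hJ z hz, hxz]
  · intro x
    by_cases hx : x = 0
    · rw [hx]; simp
    · rw [hspeed x hx]
      linarith [hf.one_le_speed (Real.log ‖x‖)]
  · intro x hx hxT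
    rw [hspeed x hx, torpedoSpeed, Real.exp_log (norm_pos_iff.2 hx), hf.ext_eq hxT]
  · intro x hx hxT
    have h0 : 0 < ‖x‖ := norm_pos_iff.2 hx
    have h1 : torpedoCoord ε T f (Real.log ‖x‖) ≤ 0 := by
      rw [← torpedoCoord_log_size (ε := ε) (T := T) (f := f)]
      exact hf.strictMono_coord.monotone (Real.log_le_log h0 hxT)
    rw [hcoord x hx, hy1 _ (by linarith), hy₀c, Real.exp_log h0, hf.ext_eq hxT]
  · intro x hx hxT
    have h0 : 0 < ‖x‖ := norm_pos_iff.2 hx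
    rw [hcoord x hx]
    refine (hf.strictMono_coord.monotone (Real.log_le_log h0 hxT)).trans ?_
    rw [hf.coord_eq_of_size_le (by linarith)]
    have : (2 * T - T) / ε = T / ε := by ring
    linarith

end

/-! ### Cutoffs and the gluing inequality -/

noncomputable section

/-- A cutoff function which vanishes for `w ≤ w₁` and is `1` for `w ≥ w₁ + 1`. -/
def innerCut (w₁ w : ℝ) : ℝ := Real.smoothTransition (Real.exp (2 * w) - Real.exp (2 * w₁))

/-- A cutoff function which is `1` for `v ≤ -1` and vanishes for `v ≥ 0`. -/
def outerCut (v : ℝ) : ℝ := Real.smoothTransition (2 - 2 * Real.exp (2 * v))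

theorem contDiff_innerCut (w₁ : ℝ) : ContDiff ℝ ∞ (innerCut w₁) :=
  contDiff_smoothTransition.comp
    ((Real.contDiff_exp.comp (contDiff_const.mul contDiff_id)).sub contDiff_const)

theorem contDiff_outerCut : ContDiff ℝ ∞ outerCut :=
  contDiff_smoothTransition.comp (contDiff_const.sub
    (contDiff_const.mul (Real.contDiff_exp.comp (contDiff_const.mul contDiff_id))))

theorem innerCut_of_le {w₁ w : ℝ} (h : w ≤ w₁) : innerCut w₁ w = 0 :=
  Real.smoothTransition.zero_of_nonpos (by
    have := Real.exp_le_exp.2 (show 2 * w ≤ 2 * w₁ by linarith)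
    linarith)

theorem exp_two_mul_add_one_le {w₁ w : ℝ} (hw₁ : 0 ≤ w₁) (h : w₁ + 1 ≤ w) :
    1 + Real.exp (2 * w₁) ≤ Real.exp (2 * w) := by
  have h1 : Real.exp (2 * w₁) * Real.exp 2 ≤ Real.exp (2 * w) := by
    rw [← Real.exp_add]
    exact Real.exp_le_exp.2 (by linarith)
  have h2 := Real.add_one_le_exp (2 : ℝ)
  have h3 := Real.one_le_exp (show 0 ≤ 2 * w₁ by linarith)
  nlinarith

theorem innerCut_of_ge {w₁ w : ℝ} (hw₁ : 0 ≤ w₁) (h : w₁ + 1 ≤ w) : innerCut w₁ w = 1 :=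
  Real.smoothTransition.one_of_one_le (by linarith [exp_two_mul_add_one_le hw₁ h])

theorem outerCut_of_le {v : ℝ} (h : v ≤ -1 / 2) : outerCut v = 1 :=
  Real.smoothTransition.one_of_one_le (by
    have h1 : Real.exp (2 * v) * Real.exp 1 ≤ 1 := by
      rw [← Real.exp_add, Real.exp_le_one_iff]
      linarith
    have h2 := Real.add_one_le_exp (1 : ℝ)
    nlinarith [Real.exp_pos (2 * v)])

theorem outerCut_of_nonneg {v : ℝ} (h : 0 ≤ v) : outerCut v = 0 :=
  Real.smoothTransition.zero_of_nonpos (by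
    have := Real.one_le_exp (show 0 ≤ 2 * v by linarith)
    linarith)

/-- Where a function is locally constant its first two derivatives vanish. -/
theorem deriv_eq_zero_of_eventually_const {f : ℝ → ℝ} {x C : ℝ} (h : ∀ᶠ z in 𝓝 x, f z = C) :
    deriv f x = 0 ∧ deriv (deriv f) x = 0 := by
  have h1 : deriv f =ᶠ[𝓝 x] fun _ => 0 := by
    filter_upwards [eventually_eventually_nhds.2 h] with z hz
    rw [Filter.EventuallyEq.deriv_eq hz, deriv_const]
  exact ⟨h1.eq_of_nhds, by rw [h1.deriv_eq, deriv_const]⟩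

theorem exists_bound_deriv {f : ℝ → ℝ} (hf : ContDiff ℝ ∞ f) (a b : ℝ) :
    ∃ K, 0 ≤ K ∧ ∀ x ∈ Icc a b, |f x| ≤ K ∧ |deriv f x| ≤ K ∧ |deriv (deriv f) x| ≤ K := by
  have hc : Continuous fun x => |f x| + |deriv f x| + |deriv (deriv f) x| := by
    have := hf.continuous
    have := hf.deriv_top.continuous
    have := hf.deriv_top.deriv_top.continuous
    fun_prop
  obtain ⟨K, hK⟩ := (isCompact_Icc (a := a) (b := b)).bddAbove_image hc.continuousOn
  refine ⟨max K 0, le_max_right _ _, fun x hx => ?_⟩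
  have h1 : |f x| + |deriv f x| + |deriv (deriv f) x| ≤ max K 0 :=
    (hK (mem_image_of_mem _ hx)).trans (le_max_left _ _)
  have := abs_nonneg (f x)
  have := abs_nonneg (deriv f x)
  have := abs_nonneg (deriv (deriv f) x)
  exact ⟨by linarith, by linarith, by linarith⟩

/-- Used when one summand dominates: the nonlinear term of the sum then exceeds that of the larger
summand by an arbitrarily small proportion. -/
theorem exists_one_add_rpow_le {q : ℝ} (hq : 0 < q) {η : ℝ} (hη : 0 < η) :
    ∃ τ, 0 < τ ∧ (1 + τ) ^ q ≤ 1 + η := by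
  have h1 : ContinuousAt (fun τ : ℝ => (1 + τ) ^ q) 0 :=
    (by fun_prop : ContinuousAt (fun τ : ℝ => 1 + τ) 0).rpow_const (Or.inr hq.le)
  have h2 : ∀ᶠ τ in 𝓝[>] (0 : ℝ), (1 + τ) ^ q < 1 + η :=
    mem_nhdsWithin_of_mem_nhds (h1.eventually_lt_const (by simpa using hη))
  obtain ⟨τ, hτ1, hτ2⟩ := (h2.and self_mem_nhdsWithin).exists
  exact ⟨τ, hτ2, hτ1.le⟩

theorem eventually_mul_exp_le {α : ℝ} (hα : 0 < α) (D C : ℝ) {η : ℝ} (hη : 0 < η) :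
    ∀ᶠ a in Filter.atBot, D * Real.exp (α * (a + C)) ≤ η := by
  have h1 : Filter.Tendsto (fun a : ℝ => D * Real.exp (α * (a + C))) Filter.atBot (𝓝 (D * 0)) :=
    (Real.tendsto_exp_atBot.comp ((Filter.tendsto_atBot_add_const_right _ C
      Filter.tendsto_id).const_mul_atBot hα)).const_mul D
  rw [mul_zero] at h1
  exact (h1.eventually_lt_const hη).mono fun a ha => le_of_lt ha

set_option maxHeartbeats 2000000 in
/-- Gluing a torpedo with a narrowing tube, placed far out at `v = a`, to a metric whose conformal
factor `U` decays like `exp (α v)`, preserves the curvature bound. -/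
theorem TorpedoProfile.glue_ineq {n : ℕ} {T α c B w₁ : ℝ} {f₀ : ℝ → ℝ}
    (pr : TorpedoProfile n T α c B w₁ f₀) (hα : 0 < α) (hc : 0 < c) (hB : 0 ≤ B)
    {M : ℝ} (hM : 0 < M) :
    ∃ a₀ : ℝ, ∀ a ≤ a₀, ∀ b ∈ Icc 0 B, ∀ v ≤ 0, ∀ U U' L : ℝ,
      Real.exp (α * v) / M ≤ U → U ≤ M * Real.exp (α * v) → |U'| ≤ M * Real.exp (α * v) →
      c * (b + 1 / M) * U ^ (1 + 2 / α) ≤ L →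
      c * b * (innerCut w₁ (v - a) * U + outerCut v * pr.y (v - a)) ^ (1 + 2 / α)
        < innerCut w₁ (v - a) * L - deriv (deriv (innerCut w₁)) (v - a) * U
          - 2 * deriv (innerCut w₁) (v - a) * U' + α ^ 2 * (outerCut v * pr.y (v - a))
          - (deriv (deriv outerCut) v * pr.y (v - a) + 2 * deriv outerCut v * deriv pr.y (v - a)
            + outerCut v * deriv (deriv pr.y) (v - a)) := by
  set q := 1 + 2 / α with hq
  have hq1 : 1 < q := by rw [hq]; linarith [div_pos two_pos hα]
  have hq0 : 0 < q := by linarith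
  have hw₁ := pr.w₁_pos
  have hE := pr.E₀_pos
  have hκ := pr.κ_pos
  obtain ⟨K₁, hK₁, hK₁b⟩ := exists_bound_deriv (contDiff_innerCut w₁) w₁ (w₁ + 1)
  obtain ⟨K₂, hK₂, hK₂b⟩ := exists_bound_deriv contDiff_outerCut (-1) 0
  -- the constants
  have hDpos : 0 < c * B * pr.E₀ ^ (q - 1) + 1 := by positivity
  obtain ⟨τ, hτ, hτq⟩ := exists_one_add_rpow_le hq0
    (show 0 < pr.κ / (4 * (c * B * pr.E₀ ^ (q - 1) + 1)) by positivity)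
  -- Where `y ≤ μ U`, the nonlinear term of the sum is at most that of `U` with `b` raised by `1 /
  -- (2 M)`, half of the curvature margin of `h`.
  obtain ⟨μ, hμ, hμq⟩ := exists_one_add_rpow_le hq0 (show 0 < 1 / (2 * M * (B + 1)) by positivity)
  have hμB : ∀ b ∈ Icc 0 B, b * (1 + μ) ^ q ≤ b + 1 / (2 * M) := by
    intro b hb
    have h1 : b * (1 + μ) ^ q ≤ b * (1 + 1 / (2 * M * (B + 1))) :=
      mul_le_mul_of_nonneg_left hμq hb.1
    have h2 : b * (1 / (2 * M * (B + 1))) ≤ 1 / (2 * M) := by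
      rw [mul_one_div, div_le_div_iff₀ (by positivity) (by positivity)]
      have := hb.2
      nlinarith
    linarith
  have hysplit : ∀ w, pr.y w ^ q = pr.y w ^ (q - 1) * pr.y w := by
    intro w
    rw [Real.rpow_sub_one (pr.y_pos w).ne', div_mul_cancel₀ _ (pr.y_pos w).ne']
  -- Where `U < y / μ`, the nonlinear term is at most a constant times `y ^ q`. As `q - 1 > 0`, this
  -- is at most `κ / 2 * y` once `y ≤ η`.
  obtain ⟨η, hη, hηle⟩ : ∃ η, 0 < η ∧ c * B * (1 + 1 / μ) ^ q * η ^ (q - 1) ≤ pr.κ / 2 := by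
    have h1 : ContinuousAt (fun η : ℝ => c * B * (1 + 1 / μ) ^ q * η ^ (q - 1)) 0 :=
      continuousAt_const.mul (continuousAt_id.rpow_const (Or.inr (by linarith)))
    have h2 : ∀ᶠ η in 𝓝[>] (0 : ℝ), c * B * (1 + 1 / μ) ^ q * η ^ (q - 1) < pr.κ / 2 :=
      mem_nhdsWithin_of_mem_nhds (h1.eventually_lt_const (by
        show c * B * (1 + 1 / μ) ^ q * (0 : ℝ) ^ (q - 1) < pr.κ / 2
        rw [Real.zero_rpow (by linarith)]; simpa using hκ))
    obtain ⟨η, h3, h4⟩ := (h2.and self_mem_nhdsWithin).exists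
    exact ⟨η, h4, h3.le⟩
  obtain ⟨w₃, hw₃⟩ := Filter.eventually_atTop.1 (pr.y_tendsto.eventually_lt_const hη)
  set u₀ := Real.exp (-α) / M with hu₀
  have hu₀p : 0 < u₀ := by positivity
  -- Where the outer cutoff varies, `U` is at least `u₀`. The first bound makes the torpedo term at
  -- most `μ U`, and the second lets the remaining half of the margin pay for all derivatives of the
  -- cut-off tube.
  set η₂ := min (μ * u₀ / (K₂ + 1)) (c / (2 * M) * u₀ ^ q / (8 * (K₂ + 1))) with hη₂
  have hη₂p : 0 < η₂ := lt_min (by positivity) (by positivity)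
  obtain ⟨w₄, hw₄⟩ := Filter.eventually_atTop.1 (((pr.y_tendsto.abs).eventually_lt_const
    (show |(0 : ℝ)| < η₂ by simpa using hη₂p)).and (((pr.y'_tendsto.abs).eventually_lt_const
    (show |(0 : ℝ)| < η₂ by simpa using hη₂p)).and ((pr.y''_tendsto.abs).eventually_lt_const
    (show |(0 : ℝ)| < η₂ by simpa using hη₂p))))
  -- The bound `e1` makes the errors of the inner cutoff smaller than `κ E₀ / 4`; the `3` counts one
  -- term with `U` and two with `U'`. By `e2`, `U > τ y` can hold only beyond the inner cutoff, and
  -- by `e3` only where `y ≤ η`.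
  have e1 := eventually_mul_exp_le hα (3 * K₁ * M) (w₁ + 1) (show 0 < pr.κ * pr.E₀ / 4 by positivity)
  have e2 := eventually_mul_exp_le hα M (w₁ + 1) (show 0 < τ * pr.E₀ by positivity)
  have e3 := eventually_mul_exp_le hα M w₃ (show 0 < τ * η by positivity)
  obtain ⟨a₀, ha₀⟩ := Filter.eventually_atBot.1 (e1.and (e2.and (e3.and
    ((Filter.eventually_le_atBot (-w₁ - 3)).and (Filter.eventually_le_atBot (-1 - w₄))))))
  refine ⟨a₀, fun a ha b hb v hv U U' L hU1 hU2 hU' hL => ?_⟩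
  obtain ⟨a1, a2, a3, a4, a5⟩ := ha₀ a ha
  have hUpos : 0 < U := lt_of_lt_of_le (by positivity) hU1
  have hUq : 0 < U ^ q := Real.rpow_pos_of_pos hUpos q
  have hcM : 0 < 1 / M := by positivity
  have hL0 : 0 < L := lt_of_lt_of_le (mul_pos (mul_pos hc (by linarith [hb.1])) hUq) hL
  set w := v - a with hw
  have hy := pr.y_pos w
  have hcb : 0 ≤ c * b := mul_nonneg hc.le hb.1
  have hcbB : c * b ≤ c * B := mul_le_mul_of_nonneg_left hb.2 hc.le
  have hvw : v = a + w := by rw [hw]; ring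
  have hχ : v ≤ -1 → outerCut v = 1 ∧ deriv outerCut v = 0 ∧ deriv (deriv outerCut) v = 0 := by
    intro h
    refine ⟨outerCut_of_le (by linarith), deriv_eq_zero_of_eventually_const (C := 1) ?_⟩
    filter_upwards [Iio_mem_nhds (show v < -1 / 2 by linarith)] with z hz
      using outerCut_of_le (le_of_lt hz)
  have hP1 : w₁ + 1 < w → innerCut w₁ w = 1 ∧ deriv (innerCut w₁) w = 0 ∧
      deriv (deriv (innerCut w₁)) w = 0 := by
    intro h
    refine ⟨innerCut_of_ge hw₁.le h.le, deriv_eq_zero_of_eventually_const (C := 1) ?_⟩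
    filter_upwards [Ioi_mem_nhds h] with z hz using innerCut_of_ge hw₁.le (le_of_lt hz)
  rcases lt_or_ge w w₁ with hww | hww
  · -- inside the torpedo
    obtain ⟨c1, c2, c3⟩ := hχ (by linarith)
    have hP : innerCut w₁ w = 0 ∧ deriv (innerCut w₁) w = 0 ∧
        deriv (deriv (innerCut w₁)) w = 0 := by
      refine ⟨innerCut_of_le hww.le, deriv_eq_zero_of_eventually_const (C := 0) ?_⟩
      filter_upwards [Iio_mem_nhds hww] with z hz using innerCut_of_le (le_of_lt hz)
    rw [c1, c2, c3, hP.1, hP.2.1, hP.2.2]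
    have h1 := pr.ode w
    have h2 : c * b * pr.y w ^ q ≤ c * B * pr.y w ^ q :=
      mul_le_mul_of_nonneg_right hcbB (Real.rpow_nonneg hy.le _)
    simp only [zero_mul, mul_zero, zero_add, sub_zero, one_mul]
    linarith
  have hyE := pr.y_le w hww
  have hneck := pr.ode_neck w hww
  have hyq : 0 ≤ pr.y w ^ q := Real.rpow_nonneg hy.le _
  rcases le_or_gt v (-1) with hv1 | hv1
  · obtain ⟨c1, c2, c3⟩ := hχ hv1
    rw [c1, c2, c3]
    simp only [zero_mul, mul_zero, zero_add, one_mul]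
    -- If the torpedo dominates, its slack `κ y` pays for the nonlinear excess and for the cutoff
    -- errors, each of which is at most `κ / 4 * y`.
    rcases le_or_gt U (τ * pr.y w) with hUτ | hUτ
    · have hP0 : 0 ≤ innerCut w₁ w := Real.smoothTransition.nonneg _
      have hP1' : innerCut w₁ w ≤ 1 := Real.smoothTransition.le_one _
      have h1 : c * b * (innerCut w₁ w * U + pr.y w) ^ q
          ≤ c * B * pr.y w ^ q + pr.κ / 4 * pr.y w := by
        have h2 : innerCut w₁ w * U + pr.y w ≤ (1 + τ) * pr.y w := by nlinarith
        have h3 : (innerCut w₁ w * U + pr.y w) ^ q ≤ (1 + τ) ^ q * pr.y w ^ q := by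
          rw [← Real.mul_rpow (by linarith) hy.le]
          exact Real.rpow_le_rpow (by positivity) h2 hq0.le
        have h4 : (1 + τ) ^ q * pr.y w ^ q
            ≤ (1 + pr.κ / (4 * (c * B * pr.E₀ ^ (q - 1) + 1))) * pr.y w ^ q :=
          mul_le_mul_of_nonneg_right hτq hyq
        have h5 : c * B * (pr.κ / (4 * (c * B * pr.E₀ ^ (q - 1) + 1)) * pr.y w ^ q)
            ≤ pr.κ / 4 * pr.y w := by
          have h6 : pr.y w ^ (q - 1) ≤ pr.E₀ ^ (q - 1) :=
            Real.rpow_le_rpow hy.le hyE (by linarith)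
          have h7 : c * B * pr.y w ^ (q - 1) ≤ c * B * pr.E₀ ^ (q - 1) + 1 := by
            have := mul_le_mul_of_nonneg_left h6 (mul_nonneg hc.le hB)
            linarith
          rw [hysplit]
          have : c * B * (pr.κ / (4 * (c * B * pr.E₀ ^ (q - 1) + 1))
              * (pr.y w ^ (q - 1) * pr.y w)) = pr.κ / 4 * pr.y w *
              (c * B * pr.y w ^ (q - 1) / (c * B * pr.E₀ ^ (q - 1) + 1)) := by
            field_simp
          rw [this]
          exact mul_le_of_le_one_right (by positivity) ((div_le_one hDpos).2 h7)
        calc _ ≤ c * b * ((1 + τ) ^ q * pr.y w ^ q) := mul_le_mul_of_nonneg_left h3 hcb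
          _ ≤ c * B * ((1 + τ) ^ q * pr.y w ^ q) :=
            mul_le_mul_of_nonneg_right hcbB (by positivity)
          _ ≤ c * B * ((1 + pr.κ / (4 * (c * B * pr.E₀ ^ (q - 1) + 1))) * pr.y w ^ q) :=
            mul_le_mul_of_nonneg_left h4 (mul_nonneg hc.le hB)
          _ ≤ _ := by linarith
      have h2 : -(pr.κ / 4 * pr.y w) ≤ - deriv (deriv (innerCut w₁)) w * U
          - 2 * deriv (innerCut w₁) w * U' := by
        rcases le_or_gt w (w₁ + 1) with h | h
        · obtain ⟨-, d1, d2⟩ := hK₁b w ⟨hww, h⟩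
          rw [pr.flat w ⟨hww, h⟩]
          have h3 : M * Real.exp (α * v) ≤ M * Real.exp (α * (a + (w₁ + 1))) := by
            have := Real.exp_le_exp.2 (mul_le_mul_of_nonneg_left
              (show v ≤ a + (w₁ + 1) by linarith) hα.le)
            exact mul_le_mul_of_nonneg_left this hM.le
          have h4 : |deriv (deriv (innerCut w₁)) w * U| ≤ K₁ * (M * Real.exp (α * v)) := by
            rw [abs_mul, abs_of_pos hUpos]
            exact mul_le_mul d2 hU2 hUpos.le hK₁
          have h5 : |deriv (innerCut w₁) w * U'| ≤ K₁ * (M * Real.exp (α * v)) := by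
            rw [abs_mul]
            exact mul_le_mul d1 hU' (abs_nonneg _) hK₁
          have h6 := (abs_le.1 h4).2
          have h7 := (abs_le.1 h5).2
          have h8 := mul_le_mul_of_nonneg_left h3 hK₁
          linarith
        · rw [(hP1 h).2.1, (hP1 h).2.2]
          have : 0 < pr.κ / 4 * pr.y w := by positivity
          simp only [neg_zero, zero_mul, mul_zero, sub_zero]
          linarith
      have h3 : 0 ≤ innerCut w₁ w * L := mul_nonneg hP0 hL0.le
      have h4 : 0 < pr.κ * pr.y w := mul_pos hκ hy
      linarith
    · have hw1 : w₁ + 1 < w := by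
        by_contra hcon
        rw [not_lt] at hcon
        rw [pr.flat w ⟨hww, hcon⟩] at hUτ
        have : M * Real.exp (α * v) ≤ M * Real.exp (α * (a + (w₁ + 1))) := by
          have := Real.exp_le_exp.2 (mul_le_mul_of_nonneg_left
            (show v ≤ a + (w₁ + 1) by linarith) hα.le)
          exact mul_le_mul_of_nonneg_left this hM.le
        linarith
      rw [(hP1 hw1).1, (hP1 hw1).2.1, (hP1 hw1).2.2]
      simp only [zero_mul, mul_zero, one_mul, sub_zero]
      have hκy : 0 < pr.κ * pr.y w := mul_pos hκ hy
      have hBy : 0 ≤ c * B * pr.y w ^ q := by positivity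
      -- The inner cutoff is now identically `1`. Either the margin of `h` absorbs the excess, or
      -- `y` is at least comparable with `U` and also at most `η`, so that the slack of the tube
      -- suffices.
      rcases le_or_gt (pr.y w) (μ * U) with hyμ | hyμ
      · have h1 : (U + pr.y w) ^ q ≤ (1 + μ) ^ q * U ^ q := by
          rw [← Real.mul_rpow (by linarith) hUpos.le]
          exact Real.rpow_le_rpow (by positivity) (by linarith) hq0.le
        have h2 : c * b * (U + pr.y w) ^ q ≤ c * (b + 1 / M) * U ^ q := by
          calc _ ≤ c * b * ((1 + μ) ^ q * U ^ q) := mul_le_mul_of_nonneg_left h1 hcb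
            _ = c * (b * (1 + μ) ^ q) * U ^ q := by ring
            _ ≤ c * (b + 1 / M) * U ^ q := by
              have h4 : 1 / (2 * M) ≤ 1 / M := one_div_le_one_div_of_le hM (by linarith)
              have h3 : b * (1 + μ) ^ q ≤ b + 1 / M := (hμB b hb).trans (by linarith)
              gcongr
        linarith
      · have hyη : pr.y w ≤ η := by
          rcases le_or_gt w₃ w with h | h
          · exact (hw₃ w h).le
          · have h1 : M * Real.exp (α * v) ≤ M * Real.exp (α * (a + w₃)) := by
              have := Real.exp_le_exp.2 (mul_le_mul_of_nonneg_left
                (show v ≤ a + w₃ by linarith) hα.le)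
              exact mul_le_mul_of_nonneg_left this hM.le
            have h2 : τ * pr.y w ≤ τ * η := by linarith
            exact le_of_mul_le_mul_left h2 hτ
        have h1 : (U + pr.y w) ^ q ≤ (1 + 1 / μ) ^ q * pr.y w ^ q := by
          rw [← Real.mul_rpow (by positivity) hy.le]
          refine Real.rpow_le_rpow (by positivity) ?_ hq0.le
          have : U ≤ 1 / μ * pr.y w := by
            rw [one_div, ← div_eq_inv_mul, le_div_iff₀ hμ]
            linarith
          linarith
        have h2 : c * b * (U + pr.y w) ^ q ≤ pr.κ / 2 * pr.y w := by
          calc _ ≤ c * b * ((1 + 1 / μ) ^ q * pr.y w ^ q) := mul_le_mul_of_nonneg_left h1 hcb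
            _ ≤ c * B * ((1 + 1 / μ) ^ q * pr.y w ^ q) :=
              mul_le_mul_of_nonneg_right hcbB (by positivity)
            _ = c * B * (1 + 1 / μ) ^ q * pr.y w ^ (q - 1) * pr.y w := by rw [hysplit]; ring
            _ ≤ c * B * (1 + 1 / μ) ^ q * η ^ (q - 1) * pr.y w := by
              have := Real.rpow_le_rpow hy.le hyη (show 0 ≤ q - 1 by linarith)
              gcongr
            _ ≤ _ := mul_le_mul_of_nonneg_right hηle hy.le
        linarith
  · have hw1 : w₁ + 1 < w := by linarith
    rw [(hP1 hw1).1, (hP1 hw1).2.1, (hP1 hw1).2.2]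
    simp only [zero_mul, mul_zero, one_mul, sub_zero]
    obtain ⟨k1, k2, k3⟩ := hK₂b v ⟨hv1.le, hv⟩
    obtain ⟨d1, d2, d3⟩ := hw₄ w (by linarith)
    rw [abs_of_pos hy] at d1
    have hχ0 : 0 ≤ outerCut v := Real.smoothTransition.nonneg _
    rw [abs_of_nonneg hχ0] at k1
    have hUu : u₀ ≤ U := by
      refine le_trans ?_ hU1
      rw [hu₀]
      have := Real.exp_le_exp.2 (show -α ≤ α * v by nlinarith)
      gcongr
    have hX : outerCut v * pr.y w ≤ μ * U := by
      have h1 : η₂ ≤ μ * u₀ / (K₂ + 1) := min_le_left _ _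
      rw [le_div_iff₀ (by positivity)] at h1
      have h2 : outerCut v * pr.y w ≤ K₂ * η₂ := mul_le_mul k1 d1.le hy.le hK₂
      have h3 := mul_le_mul_of_nonneg_left hUu hμ.le
      linarith
    have hX0 : 0 ≤ outerCut v * pr.y w := mul_nonneg hχ0 hy.le
    have h1 : (U + outerCut v * pr.y w) ^ q ≤ (1 + μ) ^ q * U ^ q := by
      rw [← Real.mul_rpow (by linarith) hUpos.le]
      exact Real.rpow_le_rpow (by positivity) (by linarith) hq0.le
    have h2 : c * b * (U + outerCut v * pr.y w) ^ q ≤ c * (b + 1 / (2 * M)) * U ^ q := by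
      calc _ ≤ c * b * ((1 + μ) ^ q * U ^ q) := mul_le_mul_of_nonneg_left h1 hcb
        _ = c * (b * (1 + μ) ^ q) * U ^ q := by ring
        _ ≤ _ := by
          have := hμB b hb
          gcongr
    have h3 : c * (b + 1 / M) * U ^ q = c * (b + 1 / (2 * M)) * U ^ q + c / (2 * M) * U ^ q := by
      field_simp
      ring
    have h4 : c / (2 * M) * u₀ ^ q ≤ c / (2 * M) * U ^ q := by
      have := Real.rpow_le_rpow hu₀p.le hUu hq0.le
      gcongr
    have h5 : η₂ ≤ c / (2 * M) * u₀ ^ q / (8 * (K₂ + 1)) := min_le_right _ _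
    rw [le_div_iff₀ (by positivity)] at h5
    have f1 : |deriv (deriv outerCut) v * pr.y w| ≤ K₂ * η₂ := by
      rw [abs_mul, abs_of_pos hy]
      exact mul_le_mul k3 d1.le hy.le hK₂
    have f2 : |deriv outerCut v * deriv pr.y w| ≤ K₂ * η₂ := by
      rw [abs_mul]
      exact mul_le_mul k2 d2.le (abs_nonneg _) hK₂
    have f3 : |outerCut v * deriv (deriv pr.y) w| ≤ K₂ * η₂ := by
      rw [abs_mul, abs_of_nonneg hχ0]
      exact mul_le_mul k1 d3.le (abs_nonneg _) hK₂
    have g1 := (abs_le.1 f1).2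
    have g2 := (abs_le.1 f2).2
    have g3 := (abs_le.1 f3).2
    have g4 : 0 ≤ K₂ * η₂ := by positivity
    have g5 : 0 ≤ α ^ 2 * (outerCut v * pr.y w) := by positivity
    linarith

end

/-! ### Metrics with prescribed conformal factor and coordinate -/

noncomputable section

section Euler

variable {n : ℕ} {T : ℝ} {φ ψ : Euc n → ℝ} {x : Euc n}

/-- The derivative `t ∂_t φ` in the direction of the Euler field. -/
def eulerDeriv (φ : Euc n → ℝ) (x : Euc n) : ℝ := fderiv ℝ φ x x

/-- A smooth radial function on the open ball of radius `T`. -/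
structure IsSmoothRadial (T : ℝ) (φ : Euc n → ℝ) : Prop where
  smooth : ContDiffOn ℝ ∞ φ (Metric.ball 0 T)
  radial : IsRadialOn T φ

namespace IsSmoothRadial

theorem differentiableAt (hφ : IsSmoothRadial T φ) (hx : ‖x‖ < T) : DifferentiableAt ℝ φ x :=
  (hφ.smooth.differentiableOn (by simp)).differentiableAt (DiscMetric.ball_mem_nhds_of_norm_lt hx)

theorem hasRadialGrad (hφ : IsSmoothRadial T φ) (hx0 : x ≠ 0) (hx : ‖x‖ < T) :
    HasRadialGrad φ (eulerDeriv φ x / ‖x‖ ^ 2) x :=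
  hφ.radial.hasRadialGrad hx0 hx (hφ.differentiableAt hx)

theorem eulerDeriv (hφ : IsSmoothRadial T φ) : IsSmoothRadial T (eulerDeriv φ) where
  smooth := ((contDiffOn_infty_iff_fderiv_of_isOpen Metric.isOpen_ball).1 hφ.smooth).2.clm_apply
    contDiffOn_id
  radial := by
    -- The Euler derivative is the rate of change under dilation, and dilations preserve equality of
    -- norms.
    have key : ∀ z : Euc n, ‖z‖ < T →
        HasDerivAt (fun s : ℝ => φ ((1 + s) • z)) (_root_.eulerDeriv φ z) 0 := by
      intro z hz
      have h1 : HasDerivAt (fun s : ℝ => (1 + s) • z) ((1 : ℝ) • z) 0 :=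
        ((hasDerivAt_id (0 : ℝ)).const_add 1).smul_const z
      have h2 : HasFDerivAt φ (fderiv ℝ φ z) ((1 + (0 : ℝ)) • z) := by
        simpa using (hφ.differentiableAt hz).hasFDerivAt
      simpa using! h2.comp_hasDerivAt 0 h1
    intro x y hx hxy
    refine (key x hx).unique ((key y (hxy ▸ hx)).congr_of_eventuallyEq ?_)
    have h1 : ContinuousAt (fun s : ℝ => ‖(1 + s) • x‖) 0 := by fun_prop
    filter_upwards [h1.eventually_lt_const (by simpa using hx)] with s hs
    exact hφ.radial _ _ hs (by rw [norm_smul, norm_smul, hxy])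

theorem const (c : ℝ) : IsSmoothRadial T fun _ : Euc n => c := ⟨contDiffOn_const, fun _ _ _ _ => rfl⟩

theorem add (hφ : IsSmoothRadial T φ) (hψ : IsSmoothRadial T ψ) :
    IsSmoothRadial T fun x => φ x + ψ x :=
  ⟨hφ.smooth.add hψ.smooth, fun x y hx h => by rw [hφ.radial x y hx h, hψ.radial x y hx h]⟩

theorem mul (hφ : IsSmoothRadial T φ) (hψ : IsSmoothRadial T ψ) :
    IsSmoothRadial T fun x => φ x * ψ x :=
  ⟨hφ.smooth.mul hψ.smooth, fun x y hx h => by rw [hφ.radial x y hx h, hψ.radial x y hx h]⟩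

end IsSmoothRadial

theorem HasRadialGrad.eulerDeriv {c : ℝ} (h : HasRadialGrad φ c x) :
    _root_.eulerDeriv φ x = c * ‖x‖ ^ 2 := h.fderiv_self

theorem HasRadialGrad.log_norm (hx : x ≠ 0) :
    HasRadialGrad (fun y : Euc n => Real.log ‖y‖) (1 / ‖x‖ ^ 2) x :=
  HasRadialGrad.comp_log_norm (g := id) hx (hasDerivAt_id _)

theorem HasRadialGrad.norm_rpow (hx : x ≠ 0) (α : ℝ) :
    HasRadialGrad (fun y : Euc n => ‖y‖ ^ α) (α * ‖x‖ ^ α / ‖x‖ ^ 2) x := by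
  have h0 : 0 < ‖x‖ ^ 2 := by positivity
  have h1 : ∀ y : Euc n, (‖y‖ ^ 2) ^ (α / 2) = ‖y‖ ^ α := by
    intro y
    rw [← Real.rpow_natCast, ← Real.rpow_mul (norm_nonneg y)]
    congr 1
    push_cast
    ring
  have h2 := (HasRadialGrad.normSq (x := x)).rpow h0 (α / 2)
  simp only [h1] at h2
  exact h2.congr_grad (by ring)

end Euler

section ConformalForm

variable {n : ℕ} {T α : ℝ} {i j : Fin n} {u J : Euc n → ℝ} {x : Euc n}

/-- The form `u^{2/α} (|dx|² + (k² - 1) dt²)` with `k = 1 + t ∂_t J`: the metric that in the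
conformal coordinate `v = log t + J` has the conformal factor `(t^α u)^{2/α}` over the cylinder
`dv² + dξ²`. -/
def conformalForm (i : Fin n) (α : ℝ) (u J : Euc n → ℝ) (x : Euc n) :
    LinearMap.BilinForm ℝ (Euc n) :=
  u x ^ (2 / α) • (innerₗ (Euc n) + (2 * radialQuot i J x + ‖x‖ ^ 2 * radialQuot i J x ^ 2) •
    ((innerₗ (Euc n) x).smulRight (innerₗ (Euc n) x)))

theorem conformalForm_apply (x v w : Euc n) : conformalForm i α u J x v w =
    u x ^ (2 / α) * (inner ℝ v w + (2 * radialQuot i J x + ‖x‖ ^ 2 * radialQuot i J x ^ 2) *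
      (inner ℝ x v * inner ℝ x w)) := by
  simp [conformalForm]
  ring

theorem conformalForm_symm (x v w : Euc n) :
    conformalForm i α u J x v w = conformalForm i α u J x w v := by
  rw [conformalForm_apply, conformalForm_apply, real_inner_comm, mul_comm (inner ℝ x v)]

theorem IsSmoothFamily.conformalForm {P : Type*} [TopologicalSpace P] {u J : P → Euc n → ℝ}
    (hu : IsSmoothFamily (Metric.ball (0 : Euc n) T) u)
    (hJ : IsSmoothFamily (Metric.ball (0 : Euc n) T) J) (hpos : ∀ p x, ‖x‖ < T → 0 < u p x)
    (v w : Euc n) : IsSmoothFamily (Metric.ball (0 : Euc n) T)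
      (fun p x => _root_.conformalForm i α (u p) (J p) x v w) := by
  have hin : ∀ v : Euc n, IsSmoothFamily (P := P) (Metric.ball (0 : Euc n) T)
      (fun _ x => (inner ℝ x v : ℝ)) := by
    intro v
    refine (clm (innerSL ℝ v)).congr Metric.isOpen_ball fun p x _ => ?_
    rw [innerSL_apply_apply, real_inner_comm]
  have hn2 : IsSmoothFamily (P := P) (Metric.ball (0 : Euc n) T) (fun _ x => ‖x‖ ^ 2) :=
    of_contDiffOn Metric.isOpen_ball (contDiff_norm_sq ℝ).contDiffOn
  have hq := hJ.radialQuot i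
  simp only [conformalForm_apply]
  exact (hu.rpow_const _ fun p x hx => hpos p x (by simpa using hx)).mul
    ((const continuous_const).add ((((const continuous_const).mul hq).add
      (hn2.mul (hq.pow 2))).mul ((hin v).mul (hin w))))

/-- If the gradient of `J` is `m x`, then `t ∂_t J = m t²` and `((1 + m t²)² - 1) / t² = 2 m + t²
m²`. The definition uses the latter form, which is smooth at the origin. -/
theorem conformalForm_eq (hij : i ≠ j) (hJ : IsSmoothRadial T J) (hx0 : x ≠ 0) (hx : ‖x‖ < T)
    (v w : Euc n) : conformalForm i α u J x v w = u x ^ (2 / α) * (inner ℝ v w +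
      ((1 + eulerDeriv J x) ^ 2 - 1) / ‖x‖ ^ 2 * (inner ℝ x v * inner ℝ x w)) := by
  have h0 : ‖x‖ ≠ 0 := norm_ne_zero_iff.2 hx0
  rw [conformalForm_apply, radialQuot_eq hij hJ.radial hJ.smooth hx0 hx]
  change _ * (_ + (2 * (eulerDeriv J x / _) + _ * (eulerDeriv J x / _) ^ 2) * _) = _
  congr 3
  field_simp
  ring

theorem conformalForm_eq_warpedForm (hij : i ≠ j) (hJ : IsSmoothRadial T J) (hx0 : x ≠ 0)
    (hx : ‖x‖ < T) (hu : 0 < u x) (v w : Euc n) : conformalForm i α u J x v w =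
      warpedForm (u x ^ (1 / α) * (1 + eulerDeriv J x)) (u x ^ (1 / α) * ‖x‖) x v w := by
  have h0 : ‖x‖ ≠ 0 := norm_ne_zero_iff.2 hx0
  have h1 : u x ^ (2 / α) = (u x ^ (1 / α)) ^ 2 := by
    rw [← Real.rpow_natCast, ← Real.rpow_mul hu.le]
    congr 1
    push_cast
    ring
  rw [conformalForm_eq hij hJ hx0 hx, h1, warpedForm, sphereForm, radialForm, radialForm]
  field_simp
  ring

theorem conformalForm_pos (hij : i ≠ j) (hJ : IsSmoothRadial T J) (hx : ‖x‖ < T) (hu : 0 < u x)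
    (hk : 0 < 1 + eulerDeriv J x) {v : Euc n} (hv : v ≠ 0) : 0 < conformalForm i α u J x v v := by
  have hv2 : 0 < ‖v‖ ^ 2 := by positivity
  have hup := Real.rpow_pos_of_pos hu (2 / α)
  rcases eq_or_ne x 0 with rfl | hx0
  · rw [conformalForm_apply]
    simp only [inner_zero_left, mul_zero, add_zero, real_inner_self_eq_norm_sq]
    positivity
  have hx2 : 0 < ‖x‖ ^ 2 := by positivity
  rw [conformalForm_eq hij hJ hx0 hx, real_inner_self_eq_norm_sq]
  refine mul_pos hup ?_
  -- By Cauchy–Schwarz the tangential part of `v` has nonnegative square. The radial part is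
  -- weighted by the positive number `(1 + eulerDeriv J x) ^ 2`.
  have hcs : inner ℝ x v * inner ℝ x v ≤ ‖x‖ ^ 2 * ‖v‖ ^ 2 := by
    have := real_inner_mul_inner_self_le x v
    rwa [real_inner_self_eq_norm_sq, real_inner_self_eq_norm_sq] at this
  set r := inner ℝ x v * inner ℝ x v with hr
  have hr0 : 0 ≤ r := mul_self_nonneg _
  have h1 : ‖v‖ ^ 2 + ((1 + eulerDeriv J x) ^ 2 - 1) / ‖x‖ ^ 2 * r
      = (‖x‖ ^ 2 * ‖v‖ ^ 2 - r + (1 + eulerDeriv J x) ^ 2 * r) / ‖x‖ ^ 2 := by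
    field_simp
    ring
  rw [h1]
  refine div_pos ?_ hx2
  rcases hr0.eq_or_lt with h | h
  · rw [← h]
    have : 0 < ‖x‖ ^ 2 * ‖v‖ ^ 2 := by positivity
    linarith
  · have : 0 < (1 + eulerDeriv J x) ^ 2 * r := by positivity
    linarith

namespace DiscMetric

/-- The scalar curvature of a metric in terms of its conformal factor `U^{2/α}` over the cylinder
`dv² + dξ²`. Here `U'` and `U''` are the derivatives of `U` with respect to `v`. -/
theorem scalarCurvature_of_conformalForm {h : DiscMetric n T} {V : Set (Euc n)} (hn : 3 ≤ n)
    (hij : i ≠ j) (hα : α = (n - 2) / 2) (hV : IsOpen V) (hVT : V ⊆ Metric.ball 0 T)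
    (h0 : (0 : Euc n) ∉ V) (hJ : IsSmoothRadial T J) {U U' : Euc n → ℝ} {U'' : ℝ}
    (hform : ∀ y ∈ V, h.toFun y = conformalForm i α u J y) (hu : ∀ y ∈ V, 0 < u y)
    (hU : ∀ y ∈ V, U y = ‖y‖ ^ α * u y) (hk : ∀ y ∈ V, 0 < 1 + eulerDeriv J y)
    (hU' : ∀ y ∈ V, HasRadialGrad U ((1 + eulerDeriv J y) * U' y / ‖y‖ ^ 2) y) (hx : x ∈ V)
    (hU'' : HasRadialGrad U' ((1 + eulerDeriv J x) * U'' / ‖x‖ ^ 2) x) :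
    α / (2 * (n - 1)) * h.scalarCurvature x * U x ^ (1 + 2 / α) = α ^ 2 * U x - U'' := by
  have hn' : (3 : ℝ) ≤ n := by exact_mod_cast hn
  have hα0 : 0 < α := by rw [hα]; linarith
  have hne : ∀ y ∈ V, y ≠ 0 := fun y hy h => h0 (h ▸ hy)
  have hlt : ∀ y ∈ V, ‖y‖ < T := fun y hy => by simpa using hVT hy
  have hk' : ∀ {y : Euc n}, y ∈ V → HasRadialGrad (fun z => 1 + eulerDeriv J z)
      (eulerDeriv (eulerDeriv J) y / ‖y‖ ^ 2) y := fun hy =>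
    ((HasRadialGrad.const 1).add (hJ.eulerDeriv.hasRadialGrad (hne _ hy) (hlt _ hy))).congr_grad
      (zero_add _)
  refine scalarCurvature_conformal hn hVT hV h0 hα (k := fun y => 1 + eulerDeriv J y)
    (k₁ := fun y => eulerDeriv (eulerDeriv J) y / ‖y‖ ^ 2) ?_ ?_ (fun y hy => (hk y hy).ne') hU'
    (fun y hy => hk' hy) hx ((hJ.eulerDeriv.eulerDeriv.hasRadialGrad (hne x hx) (hlt x hx)).div
      .normSq (by have := hne x hx; positivity)) hU''
  · intro y hy i' j'
    have hy0 := hne y hy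
    have h1 : U y ^ (2 / α) / ‖y‖ ^ 2 = u y ^ (2 / α) := by
      have h2 : (‖y‖ ^ α) ^ (2 / α) = ‖y‖ ^ 2 := by
        rw [← Real.rpow_mul (norm_nonneg y), mul_div_cancel₀ _ hα0.ne', ← Real.rpow_natCast]
        norm_cast
      rw [hU y hy, Real.mul_rpow (by positivity) (hu y hy).le, h2]
      field_simp
    change h.toFun y (basisVec i') (basisVec j') = _
    rw [hform y hy, conformalForm_eq hij hJ hy0 (hlt y hy), h1, inner_basisVec_self,
      inner_basisVec, inner_basisVec]
    ring
  · intro y hy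
    have := hne y hy
    have := hu y hy
    rw [hU y hy]
    positivity

/-- A metric which is given by `F` on the open disc and agrees with `h` near the boundary. -/
def splice (h : DiscMetric n T) (F : Euc n → LinearMap.BilinForm ℝ (Euc n))
    (hsymm : ∀ x, ‖x‖ < T → ∀ v w, F x v w = F x w v)
    (hpos : ∀ x, ‖x‖ < T → ∀ v, v ≠ 0 → 0 < F x v v)
    (hsmooth : ∀ v w, ContDiffOn ℝ ∞ (fun x => F x v w) (Metric.ball 0 T))
    {r : ℝ} (hr : r < T) (heq : ∀ x, r ≤ ‖x‖ → ‖x‖ < T → F x = h.toFun x) : DiscMetric n T where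
  toFun x := if ‖x‖ < T then F x else h.toFun x
  symm x hx v w := by
    split_ifs with h1
    · exact hsymm x h1 v w
    · exact h.symm x hx v w
  posDef x hx v hv := by
    split_ifs with h1
    · exact hpos x h1 v hv
    · exact h.posDef x hx v hv
  smooth v w x hx := by
    rcases lt_or_ge ‖x‖ T with h1 | h1
    · have h2 : ContDiffAt ℝ ∞ (fun x => F x v w) x :=
        (hsmooth v w).contDiffAt (ball_mem_nhds_of_norm_lt h1)
      refine (h2.congr_of_eventuallyEq ?_).contDiffWithinAt
      filter_upwards [ball_mem_nhds_of_norm_lt h1] with y hy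
      rw [if_pos (by simpa using hy)]
    · refine (h.smooth v w x hx).congr_of_eventuallyEq_of_mem ?_ hx
      have h2 : ∀ᶠ y : Euc n in 𝓝 x, r < ‖y‖ :=
        continuous_norm.continuousAt.eventually_const_lt (hr.trans_le h1)
      filter_upwards [mem_nhdsWithin_of_mem_nhds h2] with y hy
      split_ifs with h3
      · rw [heq y hy.le h3]
      · rfl
  zero_off x hx := by
    rw [if_neg fun h1 => hx (mem_disc_of_norm_lt h1), h.zero_off x hx]

end DiscMetric

end ConformalForm

end

/-! ### The conformal data of an arbitrary warped metric -/

noncomputable section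

section CoordDeriv

variable {n : ℕ} {T α : ℝ} {J φ : Euc n → ℝ} {x : Euc n}

/-- The function `φ'` such that `t^α φ'` is the derivative of `t^α φ` with respect to the coordinate
`log t + J`. -/
def coordDeriv (α : ℝ) (J φ : Euc n → ℝ) (x : Euc n) : ℝ :=
  (α * φ x + eulerDeriv φ x) / (1 + eulerDeriv J x)

theorem IsSmoothRadial.coordDeriv (hJ : IsSmoothRadial T J) (hφ : IsSmoothRadial T φ)
    (hk : ∀ x, ‖x‖ < T → 0 < 1 + _root_.eulerDeriv J x) :
    IsSmoothRadial T (coordDeriv α J φ) := by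
  have h1 := ((IsSmoothRadial.const (T := T) 1).add hJ.eulerDeriv)
  have h2 := (((IsSmoothRadial.const α).mul hφ).add hφ.eulerDeriv)
  refine ⟨h2.smooth.div h1.smooth fun x hx => (hk x (by simpa using hx)).ne', fun x y hx hxy => ?_⟩
  exact congrArg₂ (· / ·) (h2.radial x y hx hxy) (h1.radial x y hx hxy)

theorem IsSmoothRadial.hasRadialGrad_coordDeriv (hφ : IsSmoothRadial T φ) (hx0 : x ≠ 0)
    (hx : ‖x‖ < T) (hk : 0 < 1 + _root_.eulerDeriv J x) :
    HasRadialGrad (fun y => ‖y‖ ^ α * φ y)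
      ((1 + _root_.eulerDeriv J x) * (‖x‖ ^ α * _root_.coordDeriv α J φ x) / ‖x‖ ^ 2) x := by
  refine ((HasRadialGrad.norm_rpow hx0 α).mul (hφ.hasRadialGrad hx0 hx)).congr_grad ?_
  have h0 : ‖x‖ ≠ 0 := norm_ne_zero_iff.2 hx0
  rw [_root_.coordDeriv]
  field_simp

theorem IsSmoothRadial.hasRadialGrad_coord (hJ : IsSmoothRadial T J) (hx0 : x ≠ 0)
    (hx : ‖x‖ < T) : HasRadialGrad (fun y => Real.log ‖y‖ + J y)
      ((1 + _root_.eulerDeriv J x) / ‖x‖ ^ 2) x :=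
  ((HasRadialGrad.log_norm hx0).add (hJ.hasRadialGrad hx0 hx)).congr_grad (by ring)

/-- The coordinate `log t + J` increases with `t` if its speed is positive. -/
theorem IsSmoothRadial.coord_mono (hJ : IsSmoothRadial T J)
    (hk : ∀ x, ‖x‖ < T → 0 < 1 + _root_.eulerDeriv J x) {z : Euc n} (hx0 : x ≠ 0)
    (hxz : ‖x‖ ≤ ‖z‖) (hz : ‖z‖ < T) : Real.log ‖x‖ + J x ≤ Real.log ‖z‖ + J z := by
  have hxn : 0 < ‖x‖ := norm_pos_iff.2 hx0
  set l : ℝ → Euc n := fun t => (t / ‖x‖) • x with hl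
  have hln : ∀ t, 0 < t → ‖l t‖ = t := by
    intro t ht
    rw [hl, norm_smul, norm_div, norm_norm, div_mul_cancel₀ _ hxn.ne', Real.norm_of_nonneg ht.le]
  have hd : ∀ t ∈ Icc ‖x‖ ‖z‖, HasDerivAt (fun t => Real.log ‖l t‖ + J (l t))
      ((1 + _root_.eulerDeriv J (l t)) / t) t := by
    intro t ht
    have ht0 : 0 < t := hxn.trans_le ht.1
    have h0 : l t ≠ 0 := norm_pos_iff.1 (by rw [hln t ht0]; exact ht0)
    have h1 : HasDerivAt l ((1 / ‖x‖) • x) t := ((hasDerivAt_id t).div_const _).smul_const x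
    have h2 := HasFDerivAt.comp_hasDerivAt t
      (hJ.hasRadialGrad_coord h0 (by rw [hln t ht0]; exact ht.2.trans_lt hz)) h1
    refine h2.congr_deriv ?_
    have h3 : inner ℝ (l t) ((1 / ‖x‖) • x) = t := by
      simp only [hl, inner_smul_left, inner_smul_right, real_inner_self_eq_norm_sq]
      simp
      field_simp
    rw [smul_apply, innerSL_apply_apply, h3, hln t ht0, smul_eq_mul]
    field_simp
  have hmono : MonotoneOn (fun t => Real.log ‖l t‖ + J (l t)) (Icc ‖x‖ ‖z‖) := by
    refine monotoneOn_of_deriv_nonneg (convex_Icc _ _)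
      (fun t ht => (hd t ht).continuousAt.continuousWithinAt)
      (fun t ht => (hd t (interior_subset ht)).differentiableAt.differentiableWithinAt) ?_
    intro t ht
    have ht' := interior_subset ht
    have ht0 : 0 < t := hxn.trans_le ht'.1
    rw [(hd t ht').deriv]
    have := hk (l t) (by rw [hln t ht0]; exact ht'.2.trans_lt hz)
    positivity
  have h1 := hmono (left_mem_Icc.2 hxz) (right_mem_Icc.2 hxz) hxz
  have hzn : 0 < ‖z‖ := hxn.trans_le hxz
  simp only [hln _ hxn, hln _ hzn] at h1
  rw [hJ.radial (l ‖x‖) x (by rw [hln _ hxn]; exact hxz.trans_lt hz) (hln _ hxn),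
    hJ.radial (l ‖z‖) z (by rw [hln _ hzn]; exact hz) (hln _ hzn)] at h1
  exact h1

end CoordDeriv

namespace DiscMetric

section ConformalData

variable {n : ℕ} {T α : ℝ} {i j : Fin n}

/-- The conformal factor of a warped metric at the given exponent. -/
def confFactor (i : Fin n) (α : ℝ) (h : DiscMetric n T) (x : Euc n) : ℝ := tanCoeff i h x ^ (α / 2)

/-- The constant which normalises the conformal coordinate to `0` on the sphere of radius `T / 2`. -/
def confShift (i : Fin n) (h : DiscMetric n T) : ℝ :=
  Real.log (T / 2) + rayPrimitive (confSpeed i h) ((T / 2) • basisVec i)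

/-- The regular part of the conformal coordinate `log t + confReg`, which vanishes on the sphere of
radius `T / 2`. -/
def confReg (i : Fin n) (h : DiscMetric n T) (x : Euc n) : ℝ :=
  rayPrimitive (confSpeed i h) x - confShift i h

theorem norm_smul_basisVec {r : ℝ} (hr : 0 ≤ r) (l : Fin n) : ‖r • (basisVec l : Euc n)‖ = r := by
  rw [norm_smul, Real.norm_of_nonneg hr]
  simp [basisVec]

section Family

variable (hn : 2 ≤ n) (hij : i ≠ j)
include hn hij

theorem isSmoothFamily_confFactor : IsSmoothFamily (Metric.ball (0 : Euc n) T)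
    (fun h : WarpedMetric n T => confFactor i α h.1) :=
  (isSmoothFamily_tanCoeff.comp_param continuous_subtype_val).rpow_const _
    fun h _ hx => (coeff_pos hn hij h.2 (by simpa using hx)).1

theorem continuous_confShift (hT : 0 < T) : Continuous fun h : WarpedMetric n T => confShift i h.1 := by
  have h1 := ((isSmoothFamily_confSpeed (T := T) hn hij).rayPrimitive).continuousOn
  have h2 : Continuous fun h : WarpedMetric n T => (h, (T / 2) • (basisVec i : Euc n)) :=
    continuous_id.prodMk continuous_const
  have h3 : (T / 2) • (basisVec i : Euc n) ∈ Metric.ball (0 : Euc n) T := by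
    rw [mem_ball_zero_iff, norm_smul_basisVec (by positivity)]
    linarith
  have h4 := h1.comp_continuous h2 fun h => ⟨mem_univ _, h3⟩
  unfold confShift
  exact continuous_const.add h4

theorem isSmoothFamily_confReg (hT : 0 < T) : IsSmoothFamily (Metric.ball (0 : Euc n) T)
    (fun h : WarpedMetric n T => confReg i h.1) :=
  (isSmoothFamily_confSpeed hn hij).rayPrimitive.sub (.const (continuous_confShift hn hij hT))

end Family

variable {h : DiscMetric n T} {x : Euc n} (hn : 2 ≤ n) (hij : i ≠ j) (hh : h.IsWarped)
include hn hij hh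

theorem contDiffOn_confSpeed : ContDiffOn ℝ ∞ (confSpeed i h) (Metric.ball 0 T) :=
  (isSmoothFamily_confSpeed hn hij).contDiffOn Metric.isOpen_ball ⟨h, hh⟩

theorem isSmoothRadial_confReg (hT : 0 < T) : IsSmoothRadial T (confReg i h) where
  smooth := (isSmoothFamily_confReg hn hij hT).contDiffOn Metric.isOpen_ball ⟨h, hh⟩
  radial x y hx hxy := congrArg (· - _) (isRadialOn_rayPrimitive (contDiffOn_confSpeed hn hij hh)
    (isRadialOn_confSpeed hn hij hh) x y hx hxy)

/-- The normalisation `confSpeed i h 0 = 1`, which expresses smoothness of the metric at the origin,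
makes the speed of `log t + confReg` equal to `t g / f`. -/
theorem one_add_eulerDeriv_confReg (hT : 0 < T) (hx : ‖x‖ < T) :
    1 + eulerDeriv (confReg i h) x = confSpeed i h x := by
  have h1 : eulerDeriv (confReg i h) x = fderiv ℝ (rayPrimitive (confSpeed i h)) x x := by
    rw [eulerDeriv]
    congr 1
    exact fderiv_sub_const _
  rw [h1, fderiv_rayPrimitive (contDiffOn_confSpeed hn hij hh) hx, confSpeed_zero hn hij hT hh]
  ring

theorem one_add_eulerDeriv_confReg_pos (hT : 0 < T) (hx : ‖x‖ < T) :
    0 < 1 + eulerDeriv (confReg i h) x := by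
  rw [one_add_eulerDeriv_confReg hn hij hh hT hx]
  exact confSpeed_pos hn hij hh hx

theorem isSmoothRadial_confFactor : IsSmoothRadial T (confFactor i α h) where
  smooth := (isSmoothFamily_confFactor hn hij).contDiffOn Metric.isOpen_ball ⟨h, hh⟩
  radial x y hx hxy := congrArg (· ^ (α / 2)) ((isRadialOn_coeff hn hij hh).1 x y hx hxy)

theorem confFactor_pos (hx : ‖x‖ < T) : 0 < confFactor i α h x :=
  Real.rpow_pos_of_pos (coeff_pos hn hij hh hx).1 _

/-- A warped metric can thus be deformed by changing just two functions on the ball, its conformal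
factor and the regular part of its coordinate. -/
theorem toFun_eq_conformalForm (hT : 0 < T) (hα : α ≠ 0) (hx : ‖x‖ < T) :
    h.toFun x = conformalForm i α (confFactor i α h) (confReg i h) x := by
  have hA := coeff_pos hn hij hh hx
  have h1 : confFactor i α h x ^ (2 / α) = tanCoeff i h x := by
    rw [confFactor, ← Real.rpow_mul hA.1.le]
    convert Real.rpow_one _ using 2
    field_simp
  ext v w
  rcases eq_or_ne x 0 with rfl | hx0
  · rw [conformalForm_apply, h1, toFun_zero hn hij hT hh]
    simp
  · obtain ⟨g, f, -, hw⟩ := id hh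
    rw [conformalForm_eq hij (isSmoothRadial_confReg hn hij hh hT) hx0 hx, h1,
      toFun_eq_of_warping hn hij hw hx0 hx, one_add_eulerDeriv_confReg hn hij hh hT hx,
      confSpeed_sq hn hij hh hx]
    have := hA.1.ne'
    field_simp

/-- With `coord_confReg_nonneg` this identifies the disc of radius `T / 2` with the half-line `v ≤
0`, to which the deformation is confined. -/
theorem coord_confReg_nonpos (hT : 0 < T) (hx0 : x ≠ 0) (hx : ‖x‖ ≤ T / 2) :
    Real.log ‖x‖ + confReg i h x ≤ 0 := by
  have h1 := norm_smul_basisVec (n := n) (show 0 ≤ T / 2 by positivity) i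
  have h2 := (isSmoothRadial_confReg hn hij hh hT).coord_mono
    (fun x hx => one_add_eulerDeriv_confReg_pos hn hij hh hT hx) hx0 (h1.symm ▸ hx)
    (h1.symm ▸ by linarith)
  rw [h1] at h2
  unfold confReg confShift at h2 ⊢
  linarith

theorem coord_confReg_nonneg (hT : 0 < T) (hx : T / 2 ≤ ‖x‖) (hxT : ‖x‖ < T) :
    0 ≤ Real.log ‖x‖ + confReg i h x := by
  have h1 := norm_smul_basisVec (n := n) (show 0 ≤ T / 2 by positivity) i
  have h2 := (isSmoothRadial_confReg hn hij hh hT).coord_mono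
    (fun x hx => one_add_eulerDeriv_confReg_pos hn hij hh hT hx)
    (smul_ne_zero (by positivity) (basisVec_ne_zero i)) (h1.symm ▸ hx) hxT
  rw [h1] at h2
  unfold confReg confShift at h2 ⊢
  linarith

end ConformalData

end DiscMetric

end

/-! ### The deformation: factor moved by `s₁`, coordinate moved by `s₂` -/

noncomputable section

/-- A cutoff function which is `1` for `z ≤ 2` and vanishes for `z ≥ 3`. -/
def coreCut (z : ℝ) : ℝ := Real.smoothTransition (3 - z)

theorem contDiff_coreCut : ContDiff ℝ ∞ coreCut :=
  contDiff_smoothTransition.comp (contDiff_const.sub contDiff_id)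

theorem coreCut_of_le {z : ℝ} (h : z ≤ 2) : coreCut z = 1 :=
  Real.smoothTransition.one_of_one_le (by linarith)

theorem coreCut_of_ge {z : ℝ} (h : 3 ≤ z) : coreCut z = 0 :=
  Real.smoothTransition.zero_of_nonpos (by linarith)

theorem coreCut_mem (z : ℝ) : coreCut z ∈ Icc (0 : ℝ) 1 :=
  ⟨Real.smoothTransition.nonneg _, Real.smoothTransition.le_one _⟩

theorem deriv_coreCut_nonpos (z : ℝ) : deriv coreCut z ≤ 0 :=
  Antitone.deriv_nonpos fun _ _ h => Real.smoothTransition.monotone (sub_le_sub_left h 3)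

theorem deriv_coreCut_of_notMem {z : ℝ} (hz : z ∉ Icc (2 : ℝ) 3) : deriv coreCut z = 0 := by
  rw [mem_Icc, not_and_or, not_le, not_le] at hz
  rcases hz with hz | hz
  · refine (deriv_eq_zero_of_eventually_const (C := 1) ?_).1
    filter_upwards [Iio_mem_nhds hz] with y hy using coreCut_of_le (le_of_lt hy)
  · refine (deriv_eq_zero_of_eventually_const (C := 0) ?_).1
    filter_upwards [Ioi_mem_nhds hz] with y hy using coreCut_of_ge (le_of_lt hy)

namespace TorpedoProfile

open DiscMetric

variable {n : ℕ} {T α c B w₁ : ℝ} {f₀ : ℝ → ℝ} (pr : TorpedoProfile n T α c B w₁ f₀) {i j : Fin n}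

theorem yhat_pos {z : ℝ} (hz : 0 ≤ z) : 0 < pr.yhat z := by
  rcases hz.eq_or_lt with rfl | hz
  · exact pr.yhat_zero_pos
  · have h1 : Real.exp (2 * (Real.log z / 2)) = z := by
      rw [mul_div_cancel₀ _ two_ne_zero, Real.exp_log hz]
    rw [← h1, pr.yhat_exp]
    exact mul_pos (pr.y_pos _) (Real.exp_pos _)

/-- The radius of the disc that becomes a torpedo, when the torpedo is placed at the value `a` of
the conformal coordinate of `h`. -/
def coreRadius (_ : TorpedoProfile n T α c B w₁ f₀) (i : Fin n) (h : DiscMetric n T) (a : ℝ) : ℝ :=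
  Real.exp (a + w₁ - 2 + confShift i h)

theorem coreRadius_pos (h : DiscMetric n T) (a : ℝ) : 0 < pr.coreRadius i h a := Real.exp_pos _

/-- The regular part of the conformal coordinate of the torpedo of size `coreRadius`, shifted
by `a`. -/
def coreReg (i : Fin n) (h : DiscMetric n T) (a : ℝ) (x : Euc n) : ℝ :=
  pr.J ((T / pr.coreRadius i h a) • x) + Real.log (T / pr.coreRadius i h a) + a

/-- The regular part of the conformal coordinate of the deformed metric. -/
def deformReg (i : Fin n) (h : DiscMetric n T) (a s : ℝ) (x : Euc n) : ℝ :=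
  confReg i h x + s * (coreCut (‖x‖ ^ 2 / pr.coreRadius i h a ^ 2) *
    (pr.coreReg i h a x - confReg i h x))

/-- The square `exp (2 v)` of the exponential of the conformal coordinate of the deformed metric. -/
def deformSq (i : Fin n) (h : DiscMetric n T) (a s : ℝ) (x : Euc n) : ℝ :=
  ‖x‖ ^ 2 * Real.exp (2 * pr.deformReg i h a s x)

/-- The conformal factor of the deformed metric. -/
def deformFactor (i : Fin n) (h : DiscMetric n T) (a s₁ s₂ : ℝ) (x : Euc n) : ℝ :=
  (1 - s₁ + s₁ * Real.smoothTransition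
      (pr.deformSq i h a s₂ x * Real.exp (-(2 * a)) - Real.exp (2 * w₁))) * confFactor i α h x
    + s₁ * (Real.smoothTransition (2 - 2 * pr.deformSq i h a s₂ x) *
      (Real.exp (α * (pr.deformReg i h a s₂ x - a)) *
        pr.yhat (pr.deformSq i h a s₂ x * Real.exp (-(2 * a)))))

section Family

variable {P : Type*} [TopologicalSpace P] {h : P → WarpedMetric n T} {a s₁ s₂ : P → ℝ}
  (hn : 2 ≤ n) (hij : i ≠ j) (hT : 0 < T) (hh : Continuous h) (ha : Continuous a)
  (hs₁ : Continuous s₁) (hs₂ : Continuous s₂)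
include hn hij hT hh ha

theorem continuous_coreRadius : Continuous fun p => pr.coreRadius i (h p).1 (a p) :=
  Real.continuous_exp.comp (((ha.add continuous_const).sub continuous_const).add
    ((continuous_confShift hn hij hT).comp hh))

theorem isSmoothFamily_coreReg : IsSmoothFamily (Metric.ball (0 : Euc n) T)
    (fun p => pr.coreReg i (h p).1 (a p)) := by
  have hr := pr.continuous_coreRadius hn hij hT hh ha
  have hρ : Continuous fun p => T / pr.coreRadius i (h p).1 (a p) :=
    continuous_const.div hr fun p => (pr.coreRadius_pos _ _).ne'
  have h1 : IsSmoothFamily (Metric.ball (0 : Euc n) T)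
      (fun p (x : Euc n) => (T / pr.coreRadius i (h p).1 (a p)) • x) :=
    (IsSmoothFamily.const hρ).smul .id
  exact ((h1.comp_contDiff pr.J_smooth).add (.const (hρ.log fun p =>
    (div_pos hT (pr.coreRadius_pos _ _)).ne'))).add (.const ha)

include hs₂

theorem isSmoothFamily_deformReg : IsSmoothFamily (Metric.ball (0 : Euc n) T)
    (fun p => pr.deformReg i (h p).1 (a p) (s₂ p)) := by
  have hr := pr.continuous_coreRadius hn hij hT hh ha
  have hn2 : IsSmoothFamily (P := P) (Metric.ball (0 : Euc n) T) (fun _ x => ‖x‖ ^ 2) :=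
    .of_contDiffOn Metric.isOpen_ball (contDiff_norm_sq ℝ).contDiffOn
  have h1 : IsSmoothFamily (Metric.ball (0 : Euc n) T) (fun p => confReg i (h p).1) :=
    IsSmoothFamily.comp_param (F := fun h : WarpedMetric n T => confReg i h.1) hh
      (isSmoothFamily_confReg hn hij hT)
  have h2 := hn2.div (.const (hr.pow 2)) fun p _ _ => (pow_pos (pr.coreRadius_pos _ _) 2).ne'
  exact h1.add ((IsSmoothFamily.const hs₂).mul ((h2.comp_contDiff contDiff_coreCut).mul
    ((pr.isSmoothFamily_coreReg hn hij hT hh ha).sub h1)))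

theorem isSmoothFamily_deformSq : IsSmoothFamily (Metric.ball (0 : Euc n) T)
    (fun p => pr.deformSq i (h p).1 (a p) (s₂ p)) := by
  have hn2 : IsSmoothFamily (P := P) (Metric.ball (0 : Euc n) T) (fun _ x => ‖x‖ ^ 2) :=
    .of_contDiffOn Metric.isOpen_ball (contDiff_norm_sq ℝ).contDiffOn
  exact hn2.mul ((IsSmoothFamily.const continuous_const).mul
    (pr.isSmoothFamily_deformReg hn hij hT hh ha hs₂)).exp

include hs₁

/-- The cutoffs and the torpedo factor enter as functions of `exp (2 v) = ‖x‖² exp (2 J)`, which is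
smooth on the whole ball although `v` is not. So the origin needs no separate treatment. -/
theorem isSmoothFamily_deformFactor : IsSmoothFamily (Metric.ball (0 : Euc n) T)
    (fun p => pr.deformFactor i (h p).1 (a p) (s₁ p) (s₂ p)) := by
  have hR := pr.isSmoothFamily_deformSq hn hij hT hh ha hs₂
  have hJ := pr.isSmoothFamily_deformReg hn hij hT hh ha hs₂
  have hu : IsSmoothFamily (Metric.ball (0 : Euc n) T) (fun p => confFactor i α (h p).1) :=
    IsSmoothFamily.comp_param (F := fun h : WarpedMetric n T => confFactor i α h.1) hh
      (isSmoothFamily_confFactor hn hij)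
  have hRa : IsSmoothFamily (Metric.ball (0 : Euc n) T)
      (fun p x => pr.deformSq i (h p).1 (a p) (s₂ p) x * Real.exp (-(2 * a p))) :=
    hR.mul (.const (by fun_prop))
  have h1 := (hRa.sub (.const continuous_const)).comp_contDiff (contDiff_smoothTransition)
    |>.congr Metric.isOpen_ball (F₁ := fun p x => Real.smoothTransition
      (pr.deformSq i (h p).1 (a p) (s₂ p) x * Real.exp (-(2 * a p)) - Real.exp (2 * w₁)))
      fun _ _ _ => rfl
  have h2 := ((IsSmoothFamily.const continuous_const).sub
    ((IsSmoothFamily.const continuous_const).mul hR)).comp_contDiff (contDiff_smoothTransition)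
    |>.congr Metric.isOpen_ball (F₁ := fun p x => Real.smoothTransition
      (2 - 2 * pr.deformSq i (h p).1 (a p) (s₂ p) x)) fun _ _ _ => rfl
  have h3 := hRa.comp_contDiffOn isOpen_Ioi pr.yhat_smooth fun p x _ => by
    have := pr.r₀_pos
    have : 0 ≤ pr.deformSq i (h p).1 (a p) (s₂ p) x * Real.exp (-(2 * a p)) := by
      unfold deformSq
      positivity
    rw [mem_Ioi]
    linarith
  have h4 := ((IsSmoothFamily.const (P := P) (E := Euc n) (U := Metric.ball 0 T)
    (continuous_const (y := α))).mul (hJ.sub (.const ha))).exp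
  have hs : IsSmoothFamily (E := Euc n) (Metric.ball (0 : Euc n) T) (fun p _ => s₁ p) := .const hs₁
  exact ((((IsSmoothFamily.const continuous_const).sub hs).add (hs.mul h1)).mul hu).add
    (hs.mul (h2.mul (h4.mul h3)))

end Family

end TorpedoProfile

end

/-! ### Admissible positions; positivity of the deformed factor and speed -/

noncomputable section

namespace TorpedoProfile

open DiscMetric

variable {n : ℕ} {T α c B w₁ : ℝ} {f₀ : ℝ → ℝ} (pr : TorpedoProfile n T α c B w₁ f₀) {i j : Fin n}
  {h : DiscMetric n T} {a b s s₁ s₂ : ℝ} {x : Euc n}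

/-- The derivative of the conformal factor `t^α confFactor` with respect to the conformal
coordinate, divided by `t^α`. -/
def _root_.DiscMetric.confFactor' (i : Fin n) (α : ℝ) (h : DiscMetric n T) : Euc n → ℝ :=
  coordDeriv α (confReg i h) (confFactor i α h)

/-- The second derivative of the conformal factor `t^α confFactor` with respect to the conformal
coordinate, divided by `t^α`. -/
def _root_.DiscMetric.confFactor'' (i : Fin n) (α : ℝ) (h : DiscMetric n T) : Euc n → ℝ :=
  coordDeriv α (confReg i h) (confFactor' i α h)

/-- The two curvature inequalities which the deformation interpolates. -/
def CurvatureBound (i : Fin n) (h : DiscMetric n T) (a b : ℝ) (x : Euc n) : Prop :=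
  let v := Real.log ‖x‖ + confReg i h x
  let U := ‖x‖ ^ α * confFactor i α h x
  let U' := ‖x‖ ^ α * confFactor' i α h x
  let L := α ^ 2 * U - ‖x‖ ^ α * confFactor'' i α h x
  c * b * U ^ (1 + 2 / α) < L ∧
    c * b * (innerCut w₁ (v - a) * U + outerCut v * pr.y (v - a)) ^ (1 + 2 / α)
        < innerCut w₁ (v - a) * L - deriv (deriv (innerCut w₁)) (v - a) * U
          - 2 * deriv (innerCut w₁) (v - a) * U' + α ^ 2 * (outerCut v * pr.y (v - a))
          - (deriv (deriv outerCut) v * pr.y (v - a) + 2 * deriv outerCut v * deriv pr.y (v - a)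
            + outerCut v * deriv (deriv pr.y) (v - a))

/-- The conditions under which a torpedo can be glued into `h` at the value `a` of the conformal
coordinate such that the curvature remains greater than `B₀`. -/
structure IsAdmissible (i : Fin n) (B₀ : ℝ) (h : DiscMetric n T) (a : ℝ) : Prop where
  le : a ≤ -w₁ - 1
  radius_le : 2 * pr.coreRadius i h a ≤ T / 2
  ray_le : ∀ x : Euc n, ‖x‖ ≤ 2 * pr.coreRadius i h a → |rayPrimitive (confSpeed i h) x| ≤ 1
  curv : ∃ b, B₀ < b ∧ b ≤ B ∧ ∀ x : Euc n, x ≠ 0 → ‖x‖ ≤ T / 2 → pr.CurvatureBound i h a b x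

section Values

theorem coord_coreReg (hT : 0 < T) (hx : x ≠ 0) :
    Real.log ‖x‖ + pr.coreReg i h a x = Real.log ‖(T / pr.coreRadius i h a) • x‖
      + pr.J ((T / pr.coreRadius i h a) • x) + a := by
  have hr := pr.coreRadius_pos (i := i) h a
  rw [coreReg, norm_smul, Real.norm_of_nonneg (by positivity),
    Real.log_mul (by positivity) (norm_ne_zero_iff.2 hx)]
  ring

theorem coord_coreReg_le (hT : 0 < T) (hx : x ≠ 0) (hxr : ‖x‖ ≤ 2 * pr.coreRadius i h a) :
    Real.log ‖x‖ + pr.coreReg i h a x ≤ a + w₁ - 3 := by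
  have hr := pr.coreRadius_pos (i := i) h a
  have h1 := pr.coord_le ((T / pr.coreRadius i h a) • x) (smul_ne_zero (by positivity) hx) (by
    rw [norm_smul, Real.norm_of_nonneg (by positivity), div_mul_eq_mul_div, div_le_iff₀ hr]
    nlinarith)
  rw [pr.coord_coreReg hT hx]
  linarith

theorem log_coreRadius : Real.log (pr.coreRadius i h a) = a + w₁ - 2 + confShift i h :=
  Real.log_exp _

theorem deformReg_eq_confReg (hx : s = 0 ∨ 3 * pr.coreRadius i h a ^ 2 ≤ ‖x‖ ^ 2) :
    pr.deformReg i h a s x = confReg i h x := by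
  have hr := pr.coreRadius_pos (i := i) h a
  rcases hx with rfl | hx
  · simp [deformReg]
  · rw [deformReg, coreCut_of_ge ((le_div_iff₀ (by positivity)).2 hx)]
    simp

theorem deformSq_eq (hx : x ≠ 0) : pr.deformSq i h a s x
    = Real.exp (2 * (Real.log ‖x‖ + pr.deformReg i h a s x)) := by
  have : 0 < ‖x‖ := norm_pos_iff.2 hx
  rw [deformSq, mul_add, Real.exp_add, two_mul (Real.log _), Real.exp_add, Real.exp_log this]
  ring

/-- The conformal factor of the deformed metric in terms of the conformal coordinate. -/
theorem mul_deformFactor (hx : x ≠ 0) {v : ℝ} (hv : Real.log ‖x‖ + pr.deformReg i h a s₂ x = v) :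
    ‖x‖ ^ α * pr.deformFactor i h a s₁ s₂ x =
      (1 - s₁) * (‖x‖ ^ α * confFactor i α h x) + s₁ * (innerCut w₁ (v - a) *
        (‖x‖ ^ α * confFactor i α h x) + outerCut v * pr.y (v - a)) := by
  have hx0 : 0 < ‖x‖ := norm_pos_iff.2 hx
  have h1 : pr.deformSq i h a s₂ x * Real.exp (-(2 * a)) = Real.exp (2 * (v - a)) := by
    rw [pr.deformSq_eq hx, hv, ← Real.exp_add]
    congr 1
    ring
  have h2 : ‖x‖ ^ α * Real.exp (α * (pr.deformReg i h a s₂ x - a))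
      * Real.exp (-(α * (v - a))) = 1 := by
    rw [Real.rpow_def_of_pos hx0, ← Real.exp_add, ← Real.exp_add, Real.exp_eq_one_iff, ← hv]
    ring
  rw [deformFactor, h1, pr.yhat_exp, pr.deformSq_eq hx, hv, innerCut, outerCut]
  linear_combination (s₁ * Real.smoothTransition (2 - 2 * Real.exp (2 * v)) * pr.y (v - a)) * h2

/-- For `s₁ < 1` a positive multiple of the factor of `h` survives. For `s₁ = 1` the two cutoffs
cannot vanish together: where the inner one does, `v ≤ a + w₁ < 0`, and there the outer one is
positive. -/
theorem deformFactor_pos (ha : a ≤ -w₁ - 1) (hs₁ : s₁ ∈ Icc (0 : ℝ) 1)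
    (hu : 0 < confFactor i α h x) : 0 < pr.deformFactor i h a s₁ s₂ x := by
  have hR : 0 ≤ pr.deformSq i h a s₂ x := by unfold deformSq; positivity
  have hy := pr.yhat_pos (mul_nonneg hR (Real.exp_pos (-(2 * a))).le)
  rw [deformFactor]
  set P := Real.smoothTransition
    (pr.deformSq i h a s₂ x * Real.exp (-(2 * a)) - Real.exp (2 * w₁)) with hP
  set Q := Real.smoothTransition (2 - 2 * pr.deformSq i h a s₂ x) with hQ
  have hP0 : 0 ≤ P := Real.smoothTransition.nonneg _
  have hQ0 : 0 ≤ Q := Real.smoothTransition.nonneg _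
  have he := Real.exp_pos (α * (pr.deformReg i h a s₂ x - a))
  have h1 : 0 ≤ s₁ * (Q * (Real.exp (α * (pr.deformReg i h a s₂ x - a)) *
      pr.yhat (pr.deformSq i h a s₂ x * Real.exp (-(2 * a))))) := by
    have := hs₁.1
    positivity
  rcases hs₁.2.lt_or_eq with h2 | rfl
  · have h3 : 0 < 1 - s₁ + s₁ * P := by nlinarith [mul_nonneg hs₁.1 hP0]
    have := mul_pos h3 hu
    linarith
  rcases hP0.lt_or_eq with h3 | h3
  · have : 0 < (1 - 1 + 1 * P) * confFactor i α h x := by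
      rw [sub_self, zero_add, one_mul]
      exact mul_pos h3 hu
    linarith
  · have h4 := Real.smoothTransition.zero_iff_nonpos.1 h3.symm
    have h5 : pr.deformSq i h a s₂ x ≤ Real.exp (2 * w₁) * Real.exp (2 * a) := by
      rw [Real.exp_neg, ← div_eq_mul_inv, sub_nonpos, div_le_iff₀ (Real.exp_pos _)] at h4
      exact h4
    rw [← Real.exp_add] at h5
    have h6 : Real.exp (2 * w₁ + 2 * a) < 1 := by
      rw [← Real.exp_zero]
      exact Real.exp_lt_exp.2 (by linarith [pr.w₁_pos])
    have h7 : 0 < Q := Real.smoothTransition.pos_of_pos (by linarith)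
    have : 0 < 1 * (Q * (Real.exp (α * (pr.deformReg i h a s₂ x - a)) *
        pr.yhat (pr.deformSq i h a s₂ x * Real.exp (-(2 * a))))) := by positivity
    rw [← h3]
    simp only [sub_self, mul_zero, add_zero, zero_mul, zero_add]
    exact this

theorem deformFactor_zero : pr.deformFactor i h a 0 s₂ x = confFactor i α h x := by
  simp [deformFactor]

theorem deformFactor_of_coord_nonneg (ha : a ≤ -w₁ - 1) (hx : x ≠ 0)
    (hv : 0 ≤ Real.log ‖x‖ + pr.deformReg i h a s₂ x) :
    pr.deformFactor i h a s₁ s₂ x = confFactor i α h x := by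
  have h1 := pr.mul_deformFactor (i := i) (h := h) (a := a) (s₁ := s₁) (s₂ := s₂) hx rfl
  rw [innerCut_of_ge pr.w₁_pos.le (by linarith), outerCut_of_nonneg hv] at h1
  have h2 : 0 < ‖x‖ ^ α := Real.rpow_pos_of_pos (norm_pos_iff.2 hx) _
  refine mul_left_cancel₀ h2.ne' (h1.trans ?_)
  ring

/-- At the end of the first stage the factor on the core is that of the torpedo, as a function of
whichever coordinate is in use. No trace of `h` is left except in the coordinate. -/
theorem mul_deformFactor_core (ha : a ≤ -w₁ - 1) (hx : x ≠ 0)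
    (hv : Real.log ‖x‖ + pr.deformReg i h a s₂ x ≤ a + w₁) :
    ‖x‖ ^ α * pr.deformFactor i h a 1 s₂ x
      = pr.y (Real.log ‖x‖ + pr.deformReg i h a s₂ x - a) := by
  rw [pr.mul_deformFactor hx rfl, innerCut_of_le (by linarith), outerCut_of_le (by linarith)]
  ring

theorem one_add_eulerDeriv_coreReg : 1 + eulerDeriv (pr.coreReg i h a) x
    = 1 + fderiv ℝ pr.J ((T / pr.coreRadius i h a) • x) ((T / pr.coreRadius i h a) • x) := by
  set ρ := T / pr.coreRadius i h a with hρ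
  have h1 : HasFDerivAt pr.J (fderiv ℝ pr.J (ρ • x)) (ρ • x) :=
    ((pr.J_smooth.differentiable (by simp)) _).hasFDerivAt
  have h2 : HasFDerivAt (fun y : Euc n => ρ • y) (ρ • ContinuousLinearMap.id ℝ (Euc n)) x :=
    (hasFDerivAt_id x).const_smul ρ
  have h3 := ((h1.comp x h2).add_const (Real.log ρ)).add_const a
  congr 1
  have h4 : fderiv ℝ (pr.coreReg i h a) x = _ := h3.fderiv
  rw [eulerDeriv, h4]
  simp

/-- The deformed coordinate is a convex combination of two coordinates. That of the torpedo is at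
most `a + w₁ - 3`. That of `h` is at most `log 2 + (a + w₁ - 2) + 1` by the choice of `coreRadius`
and the bound on the ray primitive, and `log 2 ≤ 1`. -/
theorem coord_deformReg_le (hT : 0 < T)
    (hray : ∀ x : Euc n, ‖x‖ ≤ 2 * pr.coreRadius i h a → |rayPrimitive (confSpeed i h) x| ≤ 1)
    (hs : s ∈ Icc (0 : ℝ) 1) (hx0 : x ≠ 0) (hxr : ‖x‖ ≤ 2 * pr.coreRadius i h a) :
    Real.log ‖x‖ + pr.deformReg i h a s x ≤ a + w₁ := by
  have hr := pr.coreRadius_pos (i := i) h a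
  have hx1 : 0 < ‖x‖ := norm_pos_iff.2 hx0
  have e1 := pr.coord_coreReg_le hT hx0 hxr
  have e2 := (abs_le.1 (hray x hxr)).2
  have e3 := Real.log_le_log hx1 hxr
  rw [Real.log_mul two_ne_zero hr.ne', pr.log_coreRadius] at e3
  have e4 : confReg i h x = rayPrimitive (confSpeed i h) x - confShift i h := rfl
  have e5 := Real.log_le_sub_one_of_pos (show (0 : ℝ) < 2 by norm_num)
  set ζ := coreCut (‖x‖ ^ 2 / pr.coreRadius i h a ^ 2) with hζ
  have h3 : 0 ≤ s * ζ := mul_nonneg hs.1 (coreCut_mem _).1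
  have h4 : s * ζ ≤ 1 := mul_le_one₀ hs.2 (coreCut_mem _).1 (coreCut_mem _).2
  have h5 : Real.log ‖x‖ + pr.deformReg i h a s x
      = (1 - s * ζ) * (Real.log ‖x‖ + confReg i h x)
        + s * ζ * (Real.log ‖x‖ + pr.coreReg i h a x) := by
    rw [deformReg]
    ring
  rw [h5]
  have h6 := mul_le_mul_of_nonneg_left (show Real.log ‖x‖ + confReg i h x ≤ a + w₁ by linarith)
    (sub_nonneg.2 h4)
  have h7 := mul_le_mul_of_nonneg_left
    (show Real.log ‖x‖ + pr.coreReg i h a x ≤ a + w₁ by linarith) h3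
  linarith

end Values

section Speed

variable (hn : 2 ≤ n) (hij : i ≠ j) (hT : 0 < T) (hh : h.IsWarped)
include hn hij hT hh

theorem isSmoothRadial_coreReg : IsSmoothRadial T (pr.coreReg i h a) where
  smooth := (pr.isSmoothFamily_coreReg (P := Unit) (h := fun _ => ⟨h, hh⟩) (a := fun _ => a) hn hij
    hT continuous_const continuous_const).contDiffOn Metric.isOpen_ball ()
  radial x y hx hxy := by
    rw [coreReg, coreReg, pr.J_radial _ ((T / pr.coreRadius i h a) • y)
      (by rw [norm_smul, norm_smul, hxy])]

theorem isSmoothRadial_deformReg : IsSmoothRadial T (pr.deformReg i h a s) where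
  smooth := (pr.isSmoothFamily_deformReg (P := Unit) (h := fun _ => ⟨h, hh⟩) (a := fun _ => a)
    (s₂ := fun _ => s) hn hij hT continuous_const continuous_const
    continuous_const).contDiffOn Metric.isOpen_ball ()
  radial x y hx hxy := by
    rw [deformReg, deformReg, (pr.isSmoothRadial_coreReg hn hij hT hh).radial x y hx hxy,
      (isSmoothRadial_confReg hn hij hh hT).radial x y hx hxy, hxy]

theorem eulerDeriv_deformReg (hx0 : x ≠ 0) (hx : ‖x‖ < T) {z : ℝ}
    (hz : z = ‖x‖ ^ 2 / pr.coreRadius i h a ^ 2) :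
    1 + eulerDeriv (pr.deformReg i h a s) x
      = (1 - s * coreCut z) * (1 + eulerDeriv (confReg i h) x)
        + s * coreCut z * (1 + eulerDeriv (pr.coreReg i h a) x)
        + s * (2 * z * deriv coreCut z) * (pr.coreReg i h a x - confReg i h x) := by
  have hr := pr.coreRadius_pos (i := i) h a
  have h0 : ‖x‖ ≠ 0 := norm_ne_zero_iff.2 hx0
  have hc := (isSmoothRadial_confReg hn hij hh hT).hasRadialGrad hx0 hx
  have hd := (pr.isSmoothRadial_coreReg (a := a) hn hij hT hh).hasRadialGrad hx0 hx
  have h1 := (HasRadialGrad.normSq (x := x)).div (.const (pr.coreRadius i h a ^ 2))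
    (by positivity)
  have h2 := HasRadialGrad.scomp (contDiff_coreCut.hasDerivAt_deriv_top _) h1
  have h3 := hc.add ((h2.mul (hd.sub hc)).const_mul s)
  have h4 : eulerDeriv (pr.deformReg i h a s) x = _ := h3.eulerDeriv
  rw [h4, hz]
  field_simp
  ring

/-- The speed is a convex combination of two positive speeds plus a term from the cutoff. That term
is nonnegative, because the cutoff decreases with `t` and, where it varies, the torpedo coordinate
lies below that of `h`. -/
theorem eulerDeriv_deformReg_pos
    (hray : ∀ x : Euc n, ‖x‖ ≤ 2 * pr.coreRadius i h a → |rayPrimitive (confSpeed i h) x| ≤ 1)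
    (hs : s ∈ Icc (0 : ℝ) 1) (hx : ‖x‖ < T) : 0 < 1 + eulerDeriv (pr.deformReg i h a s) x := by
  rcases eq_or_ne x 0 with rfl | hx0
  · simp [eulerDeriv]
  have hr := pr.coreRadius_pos (i := i) h a
  rw [pr.eulerDeriv_deformReg hn hij hT hh hx0 hx rfl]
  set z := ‖x‖ ^ 2 / pr.coreRadius i h a ^ 2 with hz
  have h1 := one_add_eulerDeriv_confReg_pos hn hij hh hT hx
  have h2 : 0 < 1 + eulerDeriv (pr.coreReg i h a) x := by
    rw [pr.one_add_eulerDeriv_coreReg]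
    exact pr.J_speed_pos _
  have h3 : 0 ≤ s * coreCut z := mul_nonneg hs.1 (coreCut_mem z).1
  have h4 : s * coreCut z ≤ 1 := mul_le_one₀ hs.2 (coreCut_mem z).1 (coreCut_mem z).2
  have h5 : 0 < (1 - s * coreCut z) * (1 + eulerDeriv (confReg i h) x)
      + s * coreCut z * (1 + eulerDeriv (pr.coreReg i h a) x) := by
    rcases h4.lt_or_eq with h | h
    · have := mul_pos (sub_pos.2 h) h1
      have := mul_nonneg h3 h2.le
      linarith
    · rw [h]
      linarith
  have h6 : 0 ≤ s * (2 * z * deriv coreCut z) * (pr.coreReg i h a x - confReg i h x) := by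
    by_cases hz3 : z ∈ Icc (2 : ℝ) 3
    -- For `z` in `[2, 3]` the norm lies between `coreRadius` and twice that radius. There the
    -- coordinate of the torpedo is at most `a + w₁ - 3` and that of `h` is at least `(a + w₁ - 2) -
    -- 1`, which explains the `- 2` in `coreRadius`.
    · have hle : pr.coreReg i h a x - confReg i h x ≤ 0 := by
        have hr1 : pr.coreRadius i h a ≤ ‖x‖ := by
          have := hz3.1
          rw [hz, le_div_iff₀ (by positivity)] at this
          exact le_of_sq_le_sq (by nlinarith) (norm_nonneg x)
        have hr2 : ‖x‖ ≤ 2 * pr.coreRadius i h a := by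
          have := hz3.2
          rw [hz, div_le_iff₀ (by positivity)] at this
          exact le_of_sq_le_sq (by nlinarith) (by positivity)
        have e1 := pr.coord_coreReg_le hT hx0 hr2
        have e2 := (abs_le.1 (hray x hr2)).1
        have e3 := Real.log_le_log hr hr1
        rw [pr.log_coreRadius] at e3
        have e4 : confReg i h x = rayPrimitive (confSpeed i h) x - confShift i h := rfl
        linarith
      have hd := deriv_coreCut_nonpos z
      have hz0 : 0 ≤ z := by linarith [hz3.1]
      have hs0 := hs.1
      refine mul_nonneg_of_nonpos_of_nonpos ?_ hle
      exact mul_nonpos_of_nonneg_of_nonpos hs0 (mul_nonpos_of_nonneg_of_nonpos (by positivity) hd)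
    · rw [deriv_coreCut_of_notMem hz3]
      simp
  linarith

end Speed

end TorpedoProfile

end

/-! ### The deformed metric and its curvature -/

noncomputable section

theorem eulerDeriv_congr {n : ℕ} {φ ψ : Euc n → ℝ} {x : Euc n} (h : φ =ᶠ[𝓝 x] ψ) :
    eulerDeriv φ x = eulerDeriv ψ x := by
  rw [eulerDeriv, eulerDeriv, h.fderiv_eq]

theorem conformalForm_congr {n : ℕ} {T α : ℝ} {i j : Fin n} (hij : i ≠ j) {u u₁ J J₁ : Euc n → ℝ}
    (hJ : IsSmoothRadial T J) (hJ₁ : IsSmoothRadial T J₁) {x : Euc n} (hx0 : x ≠ 0) (hx : ‖x‖ < T)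
    (he : J =ᶠ[𝓝 x] J₁) (hu : u x = u₁ x) : conformalForm i α u J x = conformalForm i α u₁ J₁ x := by
  ext v w
  rw [conformalForm_eq hij hJ hx0 hx, conformalForm_eq hij hJ₁ hx0 hx, eulerDeriv_congr he, hu]

namespace TorpedoProfile

open DiscMetric

variable {n : ℕ} {T α c B w₁ : ℝ} {f₀ : ℝ → ℝ} (pr : TorpedoProfile n T α c B w₁ f₀) {i j : Fin n}
  {h k : DiscMetric n T} {a b s s₁ s₂ B₀ : ℝ} {x : Euc n}

/-- The values of the deformed metric on the open disc. -/
def deformForm (i : Fin n) (h : DiscMetric n T) (a s₁ s₂ : ℝ) :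
    Euc n → LinearMap.BilinForm ℝ (Euc n) :=
  conformalForm i α (pr.deformFactor i h a s₁ s₂) (pr.deformReg i h a s₂)

theorem deformReg_eventuallyEq (hx : s = 0 ∨ 3 * pr.coreRadius i h a ^ 2 < ‖x‖ ^ 2) :
    pr.deformReg i h a s =ᶠ[𝓝 x] confReg i h := by
  rcases hx with rfl | hx
  · exact Filter.Eventually.of_forall fun y => pr.deformReg_eq_confReg (Or.inl rfl)
  · have h1 : ContinuousAt (fun y : Euc n => ‖y‖ ^ 2) x := by fun_prop
    filter_upwards [h1.eventually_const_lt hx] with y hy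
      using pr.deformReg_eq_confReg (Or.inr hy.le)

section Metric

variable (hn : 2 ≤ n) (hij : i ≠ j) (hT : 0 < T) (hh : h.IsWarped)
include hn hij hT hh

theorem deformForm_eq_of_ge (hα : α ≠ 0) (hadm : pr.IsAdmissible i B₀ h a) (hx : T / 2 ≤ ‖x‖)
    (hxT : ‖x‖ < T) : pr.deformForm i h a s₁ s₂ x = h.toFun x := by
  have hr := pr.coreRadius_pos (i := i) h a
  have hx0 : x ≠ 0 := norm_pos_iff.1 (by linarith)
  have h1 : 3 * pr.coreRadius i h a ^ 2 < ‖x‖ ^ 2 := by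
    have := pow_le_pow_left₀ (by positivity) (hadm.radius_le.trans hx) 2
    nlinarith [pow_pos hr 2]
  rw [toFun_eq_conformalForm hn hij hh hT hα hxT]
  refine conformalForm_congr hij (pr.isSmoothRadial_deformReg hn hij hT hh)
    (isSmoothRadial_confReg hn hij hh hT) hx0 hxT (pr.deformReg_eventuallyEq (Or.inr h1)) ?_
  refine pr.deformFactor_of_coord_nonneg hadm.le hx0 ?_
  rw [pr.deformReg_eq_confReg (Or.inr h1.le)]
  exact coord_confReg_nonneg hn hij hh hT hx hxT

theorem deformForm_zero (hα : α ≠ 0) (hxT : ‖x‖ < T) : pr.deformForm i h a 0 0 x = h.toFun x := by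
  have h1 : pr.deformReg i h a 0 = confReg i h :=
    funext fun y => pr.deformReg_eq_confReg (Or.inl rfl)
  have h2 : pr.deformFactor i h a 0 0 = confFactor i α h := funext fun y => pr.deformFactor_zero
  rw [toFun_eq_conformalForm hn hij hh hT hα hxT, deformForm, h1, h2]

theorem deformForm_pos (hadm : pr.IsAdmissible i B₀ h a) (hs₁ : s₁ ∈ Icc (0 : ℝ) 1)
    (hs₂ : s₂ ∈ Icc (0 : ℝ) 1) (hx : ‖x‖ < T) {v : Euc n} (hv : v ≠ 0) :
    0 < pr.deformForm i h a s₁ s₂ x v v :=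
  conformalForm_pos hij (pr.isSmoothRadial_deformReg hn hij hT hh) hx
    (pr.deformFactor_pos hadm.le hs₁ (confFactor_pos hn hij hh hx))
    (pr.eulerDeriv_deformReg_pos hn hij hT hh hadm.ray_le hs₂ hx) hv

theorem contDiffOn_deformForm (hadm : pr.IsAdmissible i B₀ h a) (hs₁ : s₁ ∈ Icc (0 : ℝ) 1)
    (v w : Euc n) :
    ContDiffOn ℝ ∞ (fun x => pr.deformForm i h a s₁ s₂ x v w) (Metric.ball 0 T) :=
  (IsSmoothFamily.conformalForm (P := Unit)
    (pr.isSmoothFamily_deformFactor (h := fun _ => ⟨h, hh⟩) (a := fun _ => a) (s₁ := fun _ => s₁)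
      (s₂ := fun _ => s₂) hn hij hT continuous_const continuous_const continuous_const
      continuous_const)
    (pr.isSmoothFamily_deformReg (h := fun _ => ⟨h, hh⟩) (a := fun _ => a)
      (s₂ := fun _ => s₂) hn hij hT continuous_const continuous_const continuous_const)
    (fun _ _ hx => pr.deformFactor_pos hadm.le hs₁ (confFactor_pos hn hij hh hx))
    v w).contDiffOn Metric.isOpen_ball ()

/-- The deformed metric. -/
def deform (hα : α ≠ 0) (hadm : pr.IsAdmissible i B₀ h a) (hs₁ : s₁ ∈ Icc (0 : ℝ) 1)
    (hs₂ : s₂ ∈ Icc (0 : ℝ) 1) : DiscMetric n T :=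
  h.splice (pr.deformForm i h a s₁ s₂) (fun _ _ _ _ => conformalForm_symm _ _ _)
    (fun _ hx _ hv => pr.deformForm_pos hn hij hT hh hadm hs₁ hs₂ hx hv)
    (pr.contDiffOn_deformForm hn hij hT hh hadm hs₁) (half_lt_self hT)
    (fun _ hx hxT => pr.deformForm_eq_of_ge hn hij hT hh hα hadm hx hxT)

end Metric

section Curvature

variable (hn : 3 ≤ n) (hij : i ≠ j) (hT : 0 < T) (hh : h.IsWarped) (hα : α = (n - 2) / 2)
  (hk : ∀ x, ‖x‖ < T → k.toFun x = pr.deformForm i h a s₁ s₂ x)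
include hn hij hT hh hα

theorem _root_.DiscMetric.scalarCurvature_mul_confFactor (hx0 : x ≠ 0) (hx : ‖x‖ < T) :
    α / (2 * (n - 1)) * h.scalarCurvature x * (‖x‖ ^ α * confFactor i α h x) ^ (1 + 2 / α)
      = α ^ 2 * (‖x‖ ^ α * confFactor i α h x) - ‖x‖ ^ α * confFactor'' i α h x := by
  have hn2 : 2 ≤ n := by omega
  have hα0 : α ≠ 0 := by
    have : (3 : ℝ) ≤ n := by exact_mod_cast hn
    rw [hα]
    exact (show (0 : ℝ) < (n - 2) / 2 by linarith).ne'
  have hkp : ∀ y : Euc n, ‖y‖ < T → 0 < 1 + eulerDeriv (confReg i h) y :=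
    fun y hy => one_add_eulerDeriv_confReg_pos hn2 hij hh hT hy
  have hJ := isSmoothRadial_confReg hn2 hij hh hT
  have hu : IsSmoothRadial T (confFactor i α h) := isSmoothRadial_confFactor hn2 hij hh
  have hmem : ∀ y ∈ Metric.ball (0 : Euc n) T \ {0}, ‖y‖ < T ∧ y ≠ 0 := fun y hy =>
    ⟨by simpa using hy.1, by simpa using hy.2⟩
  exact scalarCurvature_of_conformalForm (V := Metric.ball 0 T \ {0}) hn hij hα
    (Metric.isOpen_ball.sdiff isClosed_singleton) sdiff_subset (by simp) hJ
    (fun y hy => toFun_eq_conformalForm hn2 hij hh hT hα0 (hmem y hy).1)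
    (fun y hy => confFactor_pos hn2 hij hh (hmem y hy).1) (fun y hy => rfl)
    (fun y hy => hkp y (hmem y hy).1)
    (fun y hy => hu.hasRadialGrad_coordDeriv (hmem y hy).2 (hmem y hy).1 (hkp y (hmem y hy).1))
    ⟨by simpa using hx, by simpa using hx0⟩
    ((hJ.coordDeriv hu hkp).hasRadialGrad_coordDeriv hx0 hx (hkp x hx))

include hk

/-- Where the coordinate is that of `h`, the factor is a point `F` of the segment from `U` to the
glued factor. As `α² F - F''` is linear in `F` and `c b F ^ q` is convex, the two inequalities in
`CurvatureBound` combine. -/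
theorem lt_scalarCurvature_of_coord_eq (hc : c = α / (2 * (n - 1))) (hb : 0 ≤ b)
    (ha : a ≤ -w₁ - 1) (hcurv : pr.CurvatureBound i h a b x) (hs₁ : s₁ ∈ Icc (0 : ℝ) 1)
    (hx0 : x ≠ 0) (hxT : ‖x‖ < T) (hx : s₂ = 0 ∨ 3 * pr.coreRadius i h a ^ 2 < ‖x‖ ^ 2) :
    b < k.scalarCurvature x := by
  have hn2 : 2 ≤ n := by omega
  have hn' : (3 : ℝ) ≤ n := by exact_mod_cast hn
  have hα0 : 0 < α := by rw [hα]; linarith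
  have hc0 : 0 < c := by rw [hc]; exact div_pos hα0 (by linarith)
  have hkp : ∀ y : Euc n, ‖y‖ < T → 0 < 1 + eulerDeriv (confReg i h) y :=
    fun y hy => one_add_eulerDeriv_confReg_pos hn2 hij hh hT hy
  have hJ := isSmoothRadial_confReg hn2 hij hh hT
  have hu : IsSmoothRadial T (confFactor i α h) := isSmoothRadial_confFactor hn2 hij hh
  have hu' : IsSmoothRadial T (confFactor' i α h) := hJ.coordDeriv hu hkp
  -- The curvature equation needs an open set. The strict inequality makes the deformed coordinate
  -- agree with that of `h` near each point.
  set V : Set (Euc n) := {y | s₂ = 0 ∨ 3 * pr.coreRadius i h a ^ 2 < ‖y‖ ^ 2} ∩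
    (Metric.ball 0 T \ {0}) with hV
  have hVo : IsOpen V := by
    refine IsOpen.inter ?_ (Metric.isOpen_ball.sdiff isClosed_singleton)
    exact isOpen_const.union (isOpen_lt continuous_const (continuous_norm.pow 2))
  have hmem : ∀ y ∈ V, ‖y‖ < T ∧ y ≠ 0 := fun y hy =>
    ⟨by simpa using hy.2.1, by simpa using hy.2.2⟩
  have hxV : x ∈ V := ⟨hx, by simpa using hxT, by simpa using hx0⟩
  set v : Euc n → ℝ := fun y => Real.log ‖y‖ + confReg i h y with hv
  set U : Euc n → ℝ := fun y => ‖y‖ ^ α * confFactor i α h y with hU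
  set U' : Euc n → ℝ := fun y => ‖y‖ ^ α * confFactor' i α h y with hU'
  set U'' : Euc n → ℝ := fun y => ‖y‖ ^ α * confFactor'' i α h y with hU''
  have dv : ∀ y ∈ V, HasRadialGrad v ((1 + eulerDeriv (confReg i h) y) / ‖y‖ ^ 2) y :=
    fun y hy => hJ.hasRadialGrad_coord (hmem y hy).2 (hmem y hy).1
  have dva : ∀ y ∈ V, HasRadialGrad (fun z => v z - a)
      ((1 + eulerDeriv (confReg i h) y) / ‖y‖ ^ 2) y :=
    fun y hy => ((dv y hy).sub (.const a)).congr_grad (sub_zero _)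
  have dU : ∀ y ∈ V, HasRadialGrad U ((1 + eulerDeriv (confReg i h) y) * U' y / ‖y‖ ^ 2) y :=
    fun y hy => hu.hasRadialGrad_coordDeriv (hmem y hy).2 (hmem y hy).1 (hkp y (hmem y hy).1)
  have dU' : ∀ y ∈ V, HasRadialGrad U' ((1 + eulerDeriv (confReg i h) y) * U'' y / ‖y‖ ^ 2) y :=
    fun y hy => hu'.hasRadialGrad_coordDeriv (hmem y hy).2 (hmem y hy).1 (hkp y (hmem y hy).1)
  have cP := contDiff_innerCut w₁
  have cQ := contDiff_outerCut
  have cy := pr.y_smooth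
  have dP := fun y hy => HasRadialGrad.scomp (cP.hasDerivAt_deriv_top _) (dva y hy)
  have dP' := fun y hy => HasRadialGrad.scomp (cP.deriv_top.hasDerivAt_deriv_top _) (dva y hy)
  have dQ := fun y hy => HasRadialGrad.scomp (cQ.hasDerivAt_deriv_top _) (dv y hy)
  have dQ' := fun y hy => HasRadialGrad.scomp (cQ.deriv_top.hasDerivAt_deriv_top _) (dv y hy)
  have dy := fun y hy => HasRadialGrad.scomp (cy.hasDerivAt_deriv_top _) (dva y hy)
  have dy' := fun y hy => HasRadialGrad.scomp (cy.deriv_top.hasDerivAt_deriv_top _) (dva y hy)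
  have key := scalarCurvature_of_conformalForm (h := k) (α := α) hn hij hα hVo
    (inter_subset_right.trans sdiff_subset) (fun h => h.2.2 rfl) hJ
    (u := pr.deformFactor i h a s₁ s₂)
    (U := fun y => (1 - s₁) * U y + s₁ * (innerCut w₁ (v y - a) * U y +
      outerCut (v y) * pr.y (v y - a)))
    (U' := fun y => (1 - s₁) * U' y + s₁ * (deriv (innerCut w₁) (v y - a) * U y +
      innerCut w₁ (v y - a) * U' y + (deriv outerCut (v y) * pr.y (v y - a) +
      outerCut (v y) * deriv pr.y (v y - a))))
    (U'' := (1 - s₁) * U'' x + s₁ * (deriv (deriv (innerCut w₁)) (v x - a) * U x +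
      2 * deriv (innerCut w₁) (v x - a) * U' x + innerCut w₁ (v x - a) * U'' x +
      (deriv (deriv outerCut) (v x) * pr.y (v x - a) + 2 * deriv outerCut (v x) *
      deriv pr.y (v x - a) + outerCut (v x) * deriv (deriv pr.y) (v x - a))))
    ?_ ?_ ?_ (fun y hy => hkp y (hmem y hy).1) ?_ hxV ?_
  · obtain ⟨c1, c2⟩ := hcurv
    change c * b * U x ^ (1 + 2 / α) < α ^ 2 * U x - U'' x at c1
    change c * b * (innerCut w₁ (v x - a) * U x + outerCut (v x) * pr.y (v x - a)) ^ (1 + 2 / α)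
        < innerCut w₁ (v x - a) * (α ^ 2 * U x - U'' x)
          - deriv (deriv (innerCut w₁)) (v x - a) * U x
          - 2 * deriv (innerCut w₁) (v x - a) * U' x + α ^ 2 * (outerCut (v x) * pr.y (v x - a))
          - (deriv (deriv outerCut) (v x) * pr.y (v x - a) + 2 * deriv outerCut (v x) *
            deriv pr.y (v x - a) + outerCut (v x) * deriv (deriv pr.y) (v x - a)) at c2
    have hUx : 0 < U x := by
      have := confFactor_pos (α := α) hn2 hij hh hxT
      have := Real.rpow_pos_of_pos (norm_pos_iff.2 hx0) α
      positivity
    set G := innerCut w₁ (v x - a) * U x + outerCut (v x) * pr.y (v x - a) with hG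
    have hP0 : 0 ≤ innerCut w₁ (v x - a) := Real.smoothTransition.nonneg _
    have hQ0 : 0 ≤ outerCut (v x) := Real.smoothTransition.nonneg _
    have hy0 := pr.y_pos (v x - a)
    have hG0 : 0 ≤ G := by positivity
    have hF : 0 < (1 - s₁) * U x + s₁ * G := by
      have h1 : (1 - s₁) * U x + s₁ * G = ‖x‖ ^ α * pr.deformFactor i h a s₁ s₂ x :=
        (pr.mul_deformFactor hx0 (by rw [pr.deformReg_eq_confReg (hx.imp_right le_of_lt)])).symm
      rw [h1]
      exact mul_pos (Real.rpow_pos_of_pos (norm_pos_iff.2 hx0) α)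
        (pr.deformFactor_pos ha hs₁ (confFactor_pos hn2 hij hh hxT))
    have hconv := (convexOn_rpow (show 1 ≤ 1 + 2 / α by
      have := div_pos two_pos hα0; linarith)).2 (mem_Ici.2 hUx.le) (mem_Ici.2 hG0)
      (sub_nonneg.2 hs₁.2) hs₁.1 (by ring)
    simp only [smul_eq_mul] at hconv
    have hFq := Real.rpow_pos_of_pos hF (1 + 2 / α)
    rw [← hc] at key
    have e1 := mul_le_mul_of_nonneg_left hconv (mul_nonneg hc0.le hb)
    have e2 : c * b * ((1 - s₁) * U x ^ (1 + 2 / α) + s₁ * G ^ (1 + 2 / α))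
        < c * k.scalarCurvature x * ((1 - s₁) * U x + s₁ * G) ^ (1 + 2 / α) := by
      rw [key]
      -- At `s₁ = 0` the glued factor has weight zero, so strictness comes from the inequality for
      -- `U`. Otherwise it comes from the glued one.
      rcases hs₁.1.eq_or_lt with h0 | h0
      · rw [← h0]
        linarith
      · have e3 := mul_lt_mul_of_pos_left c2 h0
        have e4 := mul_le_mul_of_nonneg_left c1.le (sub_nonneg.2 hs₁.2)
        linarith
    have e5 := lt_of_mul_lt_mul_right (e1.trans_lt e2) hFq.le
    exact lt_of_mul_lt_mul_left e5 hc0.le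
  · intro y hy
    rw [hk y (hmem y hy).1]
    exact conformalForm_congr hij (pr.isSmoothRadial_deformReg hn2 hij hT hh) hJ (hmem y hy).2
      (hmem y hy).1 (pr.deformReg_eventuallyEq hy.1) rfl
  · intro y hy
    exact pr.deformFactor_pos ha hs₁ (confFactor_pos hn2 hij hh (hmem y hy).1)
  · intro y hy
    exact (pr.mul_deformFactor (hmem y hy).2
      (by rw [pr.deformReg_eq_confReg (hy.1.imp_right le_of_lt)])).symm
  · intro y hy
    refine (((dU y hy).const_mul _).add ((((dP y hy).mul (dU y hy)).add
      ((dQ y hy).mul (dy y hy))).const_mul _)).congr_grad ?_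
    ring
  · refine (((dU' x hxV).const_mul _).add (((((dP' x hxV).mul (dU x hxV)).add
      ((dP x hxV).mul (dU' x hxV))).add (((dQ' x hxV).mul (dy x hxV)).add
      ((dQ x hxV).mul (dy' x hxV)))).const_mul _)).congr_grad ?_
    ring

/-- The curvature equation involves only the factor as a function of the coordinate, and this
function is `y` for every `s₂`. Changing the coordinate amounts to a radial diffeomorphism, so the
bound is the inequality `ode` of the torpedo. -/
theorem lt_scalarCurvature_of_core (hc : c = α / (2 * (n - 1))) (hb : b ≤ B)
    (hadm : pr.IsAdmissible i B₀ h a) (hs₁ : s₁ = 1) (hs₂ : s₂ ∈ Icc (0 : ℝ) 1)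
    (hx0 : x ≠ 0) (hx : ‖x‖ < 2 * pr.coreRadius i h a) : b < k.scalarCurvature x := by
  subst hs₁
  have hn2 : 2 ≤ n := by omega
  have hn' : (3 : ℝ) ≤ n := by exact_mod_cast hn
  have hα0 : 0 < α := by rw [hα]; linarith
  have hc0 : 0 < c := by rw [hc]; exact div_pos hα0 (by linarith)
  have hrT : 2 * pr.coreRadius i h a ≤ T := hadm.radius_le.trans (by linarith)
  have hkp : ∀ y : Euc n, ‖y‖ < T → 0 < 1 + eulerDeriv (pr.deformReg i h a s₂) y :=
    fun y hy => pr.eulerDeriv_deformReg_pos hn2 hij hT hh hadm.ray_le hs₂ hy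
  have hJ : IsSmoothRadial T (pr.deformReg i h a s₂) := pr.isSmoothRadial_deformReg hn2 hij hT hh
  set V : Set (Euc n) := Metric.ball 0 (2 * pr.coreRadius i h a) \ {0} with hV
  have hmem : ∀ y ∈ V, ‖y‖ < 2 * pr.coreRadius i h a ∧ ‖y‖ < T ∧ y ≠ 0 := fun y hy => by
    have h1 : ‖y‖ < 2 * pr.coreRadius i h a := by simpa using hy.1
    exact ⟨h1, h1.trans_le hrT, by simpa using hy.2⟩
  have hxV : x ∈ V := ⟨by simpa using hx, by simpa using hx0⟩
  set v : Euc n → ℝ := fun y => Real.log ‖y‖ + pr.deformReg i h a s₂ y - a with hv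
  have dv : ∀ y ∈ V, HasRadialGrad v ((1 + eulerDeriv (pr.deformReg i h a s₂) y) / ‖y‖ ^ 2) y :=
    fun y hy => ((hJ.hasRadialGrad_coord (hmem y hy).2.2 (hmem y hy).2.1).sub
      (.const a)).congr_grad (sub_zero _)
  have cy := pr.y_smooth
  have hpos : ∀ y ∈ V, 0 < pr.deformFactor i h a 1 s₂ y := fun y hy =>
    pr.deformFactor_pos hadm.le ⟨zero_le_one, le_rfl⟩ (confFactor_pos hn2 hij hh (hmem y hy).2.1)
  have key := scalarCurvature_of_conformalForm (h := k) hn hij hα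
    (Metric.isOpen_ball.sdiff isClosed_singleton)
    (sdiff_subset.trans (Metric.ball_subset_ball hrT)) (fun h => h.2 rfl) hJ
    (U := fun y => pr.y (v y)) (U' := fun y => deriv pr.y (v y)) (U'' := deriv (deriv pr.y) (v x))
    (fun y hy => hk y (hmem y hy).2.1) hpos ?_ (fun y hy => hkp y (hmem y hy).2.1) ?_ hxV ?_
  · rw [← hc] at key
    have h1 := pr.ode (v x)
    have h2 := Real.rpow_pos_of_pos (pr.y_pos (v x)) (1 + 2 / α)
    have h3 : c * b ≤ c * B := mul_le_mul_of_nonneg_left hb hc0.le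
    have h4 := mul_le_mul_of_nonneg_right h3 h2.le
    exact lt_of_mul_lt_mul_left (lt_of_mul_lt_mul_right ((h4.trans_lt h1).trans_eq key.symm) h2.le)
      hc0.le
  · intro y hy
    exact (pr.mul_deformFactor_core hadm.le (hmem y hy).2.2 (pr.coord_deformReg_le hT hadm.ray_le
      hs₂ (hmem y hy).2.2 (hmem y hy).1.le)).symm
  · intro y hy
    exact (HasRadialGrad.scomp (cy.hasDerivAt_deriv_top _) (dv y hy)).congr_grad (by ring)
  · exact (HasRadialGrad.scomp (cy.deriv_top.hasDerivAt_deriv_top _) (dv x hxV)).congr_grad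
      (by ring)

/-- The scalar curvature of the deformed metric is greater than `B₀`. -/
theorem lt_scalarCurvature_of_norm_le (hc : c = α / (2 * (n - 1))) (hB₀ : 0 ≤ B₀)
    (hadm : pr.IsAdmissible i B₀ h a) (hs₁ : s₁ ∈ Icc (0 : ℝ) 1) (hs₂ : s₂ ∈ Icc (0 : ℝ) 1)
    (hs : s₂ = 0 ∨ s₁ = 1) (hx : ‖x‖ ≤ T / 2) : B₀ < k.scalarCurvature x := by
  obtain ⟨b, hb, hbB, hcurv⟩ := hadm.curv
  have hr := pr.coreRadius_pos (i := i) h a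
  have key : ∀ y : Euc n, y ≠ 0 → ‖y‖ ≤ T / 2 → b < k.scalarCurvature y := by
    intro y hy0 hy
    have hyT : ‖y‖ < T := by linarith
    -- Either the coordinate is still that of `h` near `y`, or the second stage has begun and `‖y‖`
    -- is at most `√3` times the core radius, hence inside the core.
    by_cases h1 : s₂ = 0 ∨ 3 * pr.coreRadius i h a ^ 2 < ‖y‖ ^ 2
    · exact pr.lt_scalarCurvature_of_coord_eq hn hij hT hh hα hk hc (hB₀.trans hb.le) hadm.le
        (hcurv y hy0 hy) hs₁ hy0 hyT h1
    · rw [not_or, not_lt] at h1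
      refine pr.lt_scalarCurvature_of_core hn hij hT hh hα hk hc hbB hadm
        (hs.resolve_left h1.1) hs₂ hy0 ?_
      exact lt_of_pow_lt_pow_left₀ 2 (by positivity) (by nlinarith [pow_pos hr 2])
  rcases eq_or_ne x 0 with rfl | hx0
  -- The conformal coordinate is undefined at the origin, so the bound is passed to the limit. It
  -- becomes weak in `b`, which is why `b` is strictly greater than `B₀`.
  · have hcont : ContinuousAt k.scalarCurvature 0 := by
      have h1 := (isSmoothFamily_scalarCurvature (n := n) (T := T)).contDiffOn Metric.isOpen_ball k
      exact h1.continuousOn.continuousAt (Metric.ball_mem_nhds _ hT)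
    refine hb.trans_le (ge_of_tendsto
      (tendsto_comp_punctured (l := fun t : ℝ => t • (basisVec i : Euc n)) hcont (by fun_prop)
        (by simp)) ?_)
    have h2 := eventually_norm_lt_punctured (T := T / 2)
      (l := fun t : ℝ => t • (basisVec i : Euc n)) (by fun_prop) (by simpa using hT)
    filter_upwards [h2, self_mem_nhdsWithin] with t ht ht0
    exact (key _ (smul_ne_zero ht0 (basisVec_ne_zero i)) ht.le).le
  · exact hb.trans (key x hx0 hx)

end Curvature

end TorpedoProfile

end

/-! ### Continuous choice of the position of the torpedo -/

noncomputable section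

theorem IsSmoothFamily.eulerDeriv {n : ℕ} {T : ℝ} {P : Type*} [TopologicalSpace P]
    {F : P → Euc n → ℝ} (hF : IsSmoothFamily (Metric.ball (0 : Euc n) T) F) :
    IsSmoothFamily (Metric.ball (0 : Euc n) T) (fun p => _root_.eulerDeriv (F p)) :=
  (hF.fderiv Metric.isOpen_ball).clm_apply .id

/-- A continuous choice from lower sets of reals that decrease with the parameter. -/
theorem exists_continuous_of_antitone {t : ℝ → Set ℝ} (ht : Antitone t)
    (hlow : ∀ M, IsLowerSet (t M)) (hne : ∀ M, (t M).Nonempty) :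
    ∃ θ : ℝ → ℝ, Continuous θ ∧ ∀ M, θ M ∈ t M := by
  obtain ⟨g, hg⟩ := exists_continuous_forall_mem_convex_of_local_const (t := t)
    (fun M => (hlow M).ordConnected.convex) (fun M => by
      -- A point of `t (M + 1)` lies in `t M'` for all `M' < M + 1`. So constants serve locally, and
      -- convexity of the sets allows a partition of unity.
      obtain ⟨a, ha⟩ := hne (M + 1)
      refine ⟨a, ?_⟩
      filter_upwards [Iio_mem_nhds (lt_add_one M)] with M' hM'
      exact ht (le_of_lt hM') ha)
  exact ⟨g, g.continuous, hg⟩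

namespace DiscMetric

variable {n : ℕ} {T α : ℝ} {i j : Fin n}

theorem isSmoothFamily_confFactor' (hn : 2 ≤ n) (hij : i ≠ j) (hT : 0 < T) :
    IsSmoothFamily (Metric.ball (0 : Euc n) T)
      (fun h : WarpedMetric n T => confFactor' i α h.1) := by
  have h1 := isSmoothFamily_confFactor (T := T) (α := α) hn hij
  exact (((IsSmoothFamily.const continuous_const).mul h1).add h1.eulerDeriv).div
    ((IsSmoothFamily.const continuous_const).add (isSmoothFamily_confReg hn hij hT).eulerDeriv)
    fun h x hx => (one_add_eulerDeriv_confReg_pos hn hij h.2 hT (by simpa using hx)).ne'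

/-- Bounds on the geometry of a warped metric on the disc of radius `T / 2`. -/
structure IsBoundedBy (i : Fin n) (α B : ℝ) (h : DiscMetric n T) (M : ℝ) : Prop where
  pos : 0 < M
  factor_le : ∀ x : Euc n, ‖x‖ ≤ T / 2 → confFactor i α h x * Real.exp (-(α * confReg i h x)) ≤ M
  le_factor : ∀ x : Euc n, ‖x‖ ≤ T / 2 →
    1 / M ≤ confFactor i α h x * Real.exp (-(α * confReg i h x))
  factor'_le : ∀ x : Euc n, ‖x‖ ≤ T / 2 →
    |confFactor' i α h x * Real.exp (-(α * confReg i h x))| ≤ M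
  curv : ∀ x : Euc n, ‖x‖ ≤ T / 2 → B + 1 / M ≤ h.scalarCurvature x
  avgDeriv_le : ∀ x : Euc n, ‖x‖ ≤ T / 2 → ‖avgDeriv (confSpeed i h) x‖ ≤ M
  shift_le : confShift i h ≤ M

theorem IsBoundedBy.mono {B M M' : ℝ} {h : DiscMetric n T} (hb : IsBoundedBy i α B h M)
    (hM : M ≤ M') : IsBoundedBy i α B h M' := by
  have h0 := hb.pos
  have h1 : 1 / M' ≤ 1 / M := one_div_le_one_div_of_le h0 hM
  exact ⟨h0.trans_le hM, fun x hx => (hb.factor_le x hx).trans hM,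
    fun x hx => h1.trans (hb.le_factor x hx), fun x hx => (hb.factor'_le x hx).trans hM,
    fun x hx => (add_le_add_right h1 B).trans (hb.curv x hx),
    fun x hx => (hb.avgDeriv_le x hx).trans hM, hb.shift_le.trans hM⟩

theorem isWarped_of_mem {B : ℝ} {h : DiscMetric n T} (hh : h ∈ warpedMetrics n T B) :
    h.IsWarped := hh.1

/-- The bounds depend continuously on the metric. -/
theorem exists_continuous_isBoundedBy (hn : 2 ≤ n) (hij : i ≠ j) (hT : 0 < T) (B : ℝ) :
    ∃ β : warpedMetrics n T B → ℝ, Continuous β ∧ ∀ h, IsBoundedBy i α B h.1 (β h) := by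
  set K := Metric.closedBall (0 : Euc n) (T / 2) with hK
  have hKT : ∀ x : K, ‖(x : Euc n)‖ < T := fun x => by
    have := mem_closedBall_zero_iff.1 x.2
    linarith
  let π : warpedMetrics n T B → WarpedMetric n T := fun h => ⟨h.1, isWarped_of_mem h.2⟩
  have hπ : Continuous π := continuous_subtype_val.subtype_mk _
  have hcont : ∀ {G : Type} [NormedAddCommGroup G] [NormedSpace ℝ G]
      {F : WarpedMetric n T → Euc n → G}, IsSmoothFamily (Metric.ball (0 : Euc n) T) F →
      Continuous fun q : warpedMetrics n T B × K => F (π q.1) q.2 := by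
    intro G _ _ F hF
    exact hF.continuousOn.comp_continuous
      (f := fun q : warpedMetrics n T B × K => (π q.1, (q.2 : Euc n)))
      ((hπ.comp continuous_fst).prodMk (continuous_subtype_val.comp continuous_snd))
      fun q => ⟨mem_univ _, by simpa using hKT q.2⟩
  have cu := hcont (isSmoothFamily_confFactor (α := α) hn hij)
  have cu' := hcont (isSmoothFamily_confFactor' (α := α) hn hij hT)
  have cJ := hcont (isSmoothFamily_confReg hn hij hT)
  have cS := hcont (isSmoothFamily_scalarCurvature.comp_param continuous_subtype_val)
  have cD := hcont (isSmoothFamily_confSpeed hn hij).avgDeriv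
  have cν : Continuous fun q : warpedMetrics n T B × K => confShift i (π q.1).1 :=
    (continuous_confShift hn hij hT).comp (hπ.comp continuous_fst)
  have ce : Continuous fun q : warpedMetrics n T B × K =>
      Real.exp (-(α * confReg i (π q.1).1 q.2)) := by fun_prop
  have hupos : ∀ (h : warpedMetrics n T B) (x : K),
      0 < confFactor i α (π h).1 x * Real.exp (-(α * confReg i (π h).1 x)) := fun h x =>
    mul_pos (confFactor_pos hn hij (π h).2 (hKT x)) (Real.exp_pos _)
  have hSpos : ∀ (h : warpedMetrics n T B) (x : K), 0 < (π h).1.scalarCurvature x - B :=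
    fun h x => sub_pos.2 (h.2.2 x (mem_disc_of_norm_lt (hKT x)))
  -- All summands but `confShift` under its absolute value are bounds at a point, and none is
  -- negative. So the supremum of the sum bounds each of them, and compactness makes it continuous
  -- in the metric. Reciprocals encode the lower bounds.
  set F : warpedMetrics n T B → K → ℝ := fun h x =>
    confFactor i α (π h).1 x * Real.exp (-(α * confReg i (π h).1 x))
      + (confFactor i α (π h).1 x * Real.exp (-(α * confReg i (π h).1 x)))⁻¹
      + |confFactor' i α (π h).1 x * Real.exp (-(α * confReg i (π h).1 x))|
      + ((π h).1.scalarCurvature x - B)⁻¹ + ‖avgDeriv (confSpeed i (π h).1) x‖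
      + |confShift i (π h).1| with hF
  have hFc : Continuous ↿F := by
    change Continuous fun q : warpedMetrics n T B × K => F q.1 q.2
    exact (((((cu.mul ce).add ((cu.mul ce).inv₀ fun q => (hupos q.1 q.2).ne')).add
      (cu'.mul ce).abs).add ((cS.sub continuous_const).inv₀ fun q => (hSpos q.1 q.2).ne')).add
      cD.norm).add cν.abs
  have hKc : CompactSpace K := isCompact_iff_compactSpace.1 (isCompact_closedBall _ _)
  refine ⟨fun h => sSup (F h '' univ), isCompact_univ.continuous_sSup hFc, fun h => ?_⟩
  have hle : ∀ x : K, F h x ≤ sSup (F h '' univ) := fun x =>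
    le_csSup (isCompact_univ.bddAbove_image
      (hFc.comp (Continuous.prodMk_right h)).continuousOn) (mem_image_of_mem _ (mem_univ x))
  set M := sSup (F h '' univ) with hM
  have key : ∀ x : Euc n, ‖x‖ ≤ T / 2 →
      confFactor i α h.1 x * Real.exp (-(α * confReg i h.1 x)) ≤ M ∧
      (confFactor i α h.1 x * Real.exp (-(α * confReg i h.1 x)))⁻¹ ≤ M ∧
      |confFactor' i α h.1 x * Real.exp (-(α * confReg i h.1 x))| ≤ M ∧
      (h.1.scalarCurvature x - B)⁻¹ ≤ M ∧ ‖avgDeriv (confSpeed i h.1) x‖ ≤ M ∧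
      |confShift i h.1| ≤ M ∧ 0 < confFactor i α h.1 x * Real.exp (-(α * confReg i h.1 x)) ∧
      0 < h.1.scalarCurvature x - B := by
    intro x hx
    have h1 := hle ⟨x, by rwa [hK, mem_closedBall_zero_iff]⟩
    have h2 := hupos h ⟨x, by rwa [hK, mem_closedBall_zero_iff]⟩
    have h3 := hSpos h ⟨x, by rwa [hK, mem_closedBall_zero_iff]⟩
    simp only [hF] at h1
    change 0 < confFactor i α h.1 x * Real.exp (-(α * confReg i h.1 x)) at h2
    change 0 < h.1.scalarCurvature x - B at h3
    change confFactor i α h.1 x * Real.exp (-(α * confReg i h.1 x))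
      + (confFactor i α h.1 x * Real.exp (-(α * confReg i h.1 x)))⁻¹
      + |confFactor' i α h.1 x * Real.exp (-(α * confReg i h.1 x))|
      + (h.1.scalarCurvature x - B)⁻¹ + ‖avgDeriv (confSpeed i h.1) x‖
      + |confShift i h.1| ≤ M at h1
    have h4 := inv_pos.2 h2
    have h5 := inv_pos.2 h3
    have h6 := abs_nonneg (confFactor' i α h.1 x * Real.exp (-(α * confReg i h.1 x)))
    have h7 := norm_nonneg (avgDeriv (confSpeed i h.1) x)
    have h8 := abs_nonneg (confShift i h.1)
    exact ⟨by linarith, by linarith, by linarith, by linarith, by linarith, by linarith, h2, h3⟩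
  have hM0 : 0 < M := by
    have := key 0 (by simpa using (half_pos hT).le)
    exact this.2.2.2.2.2.2.1.trans_le this.1
  refine ⟨hM0, fun x hx => (key x hx).1, fun x hx => ?_, fun x hx => (key x hx).2.2.1,
    fun x hx => ?_, fun x hx => (key x hx).2.2.2.2.1,
    (le_abs_self _).trans (key 0 (by simpa using (half_pos hT).le)).2.2.2.2.2.1⟩
  · rw [one_div]
    exact inv_le_of_inv_le₀ (key x hx).2.2.2.2.2.2.1 (key x hx).2.1
  · have := inv_le_of_inv_le₀ (key x hx).2.2.2.2.2.2.2 (key x hx).2.2.2.1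
    rw [one_div]
    linarith

end DiscMetric

namespace TorpedoProfile

open DiscMetric

variable {n : ℕ} {T α c B B₀ w₁ : ℝ} {f₀ : ℝ → ℝ} (pr : TorpedoProfile n T α c B w₁ f₀) {i j : Fin n}

/-- For metrics of bounded geometry every sufficiently small value of the conformal coordinate is
admissible. -/
theorem exists_isAdmissible (hn : 3 ≤ n) (hij : i ≠ j) (hT : 0 < T) (hα : α = (n - 2) / 2)
    (hc : c = α / (2 * (n - 1))) (hB₀ : 0 ≤ B₀) (hB : B₀ < B) (M : ℝ) :
    ∃ a₀ : ℝ, ∀ a ≤ a₀, ∀ h : DiscMetric n T, h.IsWarped → IsBoundedBy i α B₀ h M →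
      pr.IsAdmissible i B₀ h a := by
  rcases le_or_gt M 0 with hM | hM
  · exact ⟨0, fun a _ h _ hb => absurd hb.pos (not_lt.2 hM)⟩
  have hn2 : 2 ≤ n := by omega
  have hn' : (3 : ℝ) ≤ n := by exact_mod_cast hn
  have hα0 : 0 < α := by rw [hα]; linarith
  have hc0 : 0 < c := by rw [hc]; exact div_pos hα0 (by linarith)
  -- The curvature of `h` exceeds `B₀` by at least `1 / M`. Half of this goes into `b > B₀`, and the
  -- other half is the margin `1 / (2 M)` used in the gluing.
  obtain ⟨a₁, ha₁⟩ := pr.glue_ineq hα0 hc0 (hB₀.trans hB.le) (M := 2 * M) (by positivity)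
  -- A core radius of at most `T / 4` keeps twice the core within the disc of radius `T / 2`. A
  -- radius of at most `1 / (2 M)` bounds the ray primitive by `M * (2 * coreRadius) ≤ 1`.
  set d := min (T / 4) (1 / (2 * M)) with hd
  have hd0 : 0 < d := lt_min (by positivity) (by positivity)
  refine ⟨min a₁ (min (-w₁ - 1) (Real.log d - w₁ - M)), fun a ha h hh hb => ?_⟩
  have ha1 := ha.trans (min_le_left _ _)
  have ha2 := (ha.trans (min_le_right _ _)).trans (min_le_left _ _)
  have ha3 := (ha.trans (min_le_right _ _)).trans (min_le_right _ _)
  have hr : pr.coreRadius i h a ≤ d := by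
    rw [coreRadius, ← Real.le_log_iff_exp_le hd0]
    have := hb.shift_le
    linarith
  have hr1 : pr.coreRadius i h a ≤ T / 4 := hr.trans (min_le_left _ _)
  have hr2 : pr.coreRadius i h a ≤ 1 / (2 * M) := hr.trans (min_le_right _ _)
  rw [le_div_iff₀ (by positivity)] at hr2
  refine ⟨ha2, by linarith, fun x hx => ?_, ?_⟩
  · refine (abs_rayPrimitive_le (M := M) fun y hy => hb.avgDeriv_le y (by linarith)).trans ?_
    have := mul_le_mul_of_nonneg_left hx hM.le
    linarith
  have hM2 : 0 < 1 / (2 * M) := by positivity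
  have hMM : 1 / (2 * M) + 1 / (2 * M) = 1 / M := by field_simp; ring
  refine ⟨min B (B₀ + 1 / (2 * M)), lt_min hB (by linarith), min_le_left _ _, fun x hx0 hx => ?_⟩
  have hxT : ‖x‖ < T := by linarith
  have hbB : min B (B₀ + 1 / (2 * M)) ≤ B₀ + 1 / (2 * M) := min_le_right _ _
  have hb0 : 0 ≤ min B (B₀ + 1 / (2 * M)) := le_min (hB₀.trans hB.le) (by positivity)
  set b := min B (B₀ + 1 / (2 * M)) with hbdef
  have hv := coord_confReg_nonpos hn2 hij hh hT hx0 hx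
  have hS := scalarCurvature_mul_confFactor hn hij hT hh hα hx0 hxT
  rw [← hc] at hS
  have hxn : 0 < ‖x‖ := norm_pos_iff.2 hx0
  have hUpos : 0 < ‖x‖ ^ α * confFactor i α h x :=
    mul_pos (Real.rpow_pos_of_pos hxn α) (confFactor_pos hn2 hij hh hxT)
  have hUq := Real.rpow_pos_of_pos hUpos (1 + 2 / α)
  have hL : c * (b + 1 / (2 * M)) * (‖x‖ ^ α * confFactor i α h x) ^ (1 + 2 / α)
      ≤ α ^ 2 * (‖x‖ ^ α * confFactor i α h x) - ‖x‖ ^ α * confFactor'' i α h x := by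
    rw [← hS]
    have h1 : b + 1 / (2 * M) ≤ h.scalarCurvature x := by
      have := hb.curv x hx
      linarith
    exact mul_le_mul_of_nonneg_right (mul_le_mul_of_nonneg_left h1 hc0.le) hUq.le
  set E := Real.exp (α * (Real.log ‖x‖ + confReg i h x)) with hE
  have hE0 : 0 < E := Real.exp_pos _
  -- The bounds on the smooth data at the origin become bounds by multiples of `exp (α v)`, the form
  -- required by the gluing inequality.
  have hscale : ∀ z, ‖x‖ ^ α * z = E * (z * Real.exp (-(α * confReg i h x))) := by
    intro z
    have : ‖x‖ ^ α = E * Real.exp (-(α * confReg i h x)) := by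
      rw [hE, ← Real.exp_add, Real.rpow_def_of_pos hxn]
      congr 1
      ring
    rw [this]
    ring
  refine ⟨lt_of_lt_of_le ?_ hL, ha₁ a ha1 b ⟨hb0, min_le_left _ _⟩ _ hv _ _ _ ?_ ?_ ?_ hL⟩
  · exact mul_lt_mul_of_pos_right (mul_lt_mul_of_pos_left (by linarith) hc0) hUq
  · rw [hscale, div_eq_mul_one_div]
    have := hb.le_factor x hx
    exact mul_le_mul_of_nonneg_left (by linarith) hE0.le
  · rw [hscale, mul_comm]
    have := hb.factor_le x hx
    exact mul_le_mul_of_nonneg_right (by linarith) hE0.le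
  · rw [hscale, abs_mul, abs_of_pos hE0, mul_comm]
    have := hb.factor'_le x hx
    exact mul_le_mul_of_nonneg_right (by linarith) hE0.le

/-- An admissible value of the conformal coordinate can be chosen continuously. -/
theorem exists_continuous_isAdmissible (hn : 3 ≤ n) (hij : i ≠ j) (hT : 0 < T)
    (hα : α = (n - 2) / 2) (hc : c = α / (2 * (n - 1))) (hB₀ : 0 ≤ B₀) (hB : B₀ < B) :
    ∃ a : warpedMetrics n T B₀ → ℝ, Continuous a ∧ ∀ h, pr.IsAdmissible i B₀ h.1 (a h) := by
  obtain ⟨β, hβ, hβb⟩ := exists_continuous_isBoundedBy (α := α) (show 2 ≤ n by omega) hij hT B₀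
  -- Requiring admissibility for all `a' ≤ a` and all metrics bounded by `M` gives lower sets that
  -- shrink as `M` grows. Composition with the continuous bound `β` then gives the choice.
  obtain ⟨θ, hθ, hθt⟩ := exists_continuous_of_antitone
    (t := fun M => {a | ∀ a' ≤ a, ∀ h : DiscMetric n T, h.IsWarped → IsBoundedBy i α B₀ h M →
      pr.IsAdmissible i B₀ h a'})
    (fun M M' hM a ha a' ha' h hh hb => ha a' ha' h hh (hb.mono hM))
    (fun M a a' haa ha a'' ha'' => ha a'' (ha''.trans haa))
    (fun M => pr.exists_isAdmissible hn hij hT hα hc hB₀ hB M)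
  exact ⟨fun h => θ (β h), hθ.comp hβ,
    fun h => hθt (β h) _ le_rfl h.1 (isWarped_of_mem h.2) (hβb h)⟩

end TorpedoProfile

end

/-! ### The deformation inside `W` and its end point -/

noncomputable section

namespace TorpedoProfile

open DiscMetric

variable {n : ℕ} {T α c B B₀ w₁ : ℝ} {f₀ : ℝ → ℝ} (pr : TorpedoProfile n T α c B w₁ f₀) {i j : Fin n}
  {h : DiscMetric n T} {a s₁ s₂ : ℝ} {x : Euc n}

section Warped

variable (hn : 2 ≤ n) (hij : i ≠ j) (hT : 0 < T) (hh : h.IsWarped)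

variable (hα : α ≠ 0) (hadm : pr.IsAdmissible i B₀ h a) (hs₁ : s₁ ∈ Icc (0 : ℝ) 1)
  (hs₂ : s₂ ∈ Icc (0 : ℝ) 1)

theorem deform_of_lt (hx : ‖x‖ < T) :
    (pr.deform hn hij hT hh hα hadm hs₁ hs₂).toFun x = pr.deformForm i h a s₁ s₂ x :=
  if_pos hx

theorem deform_of_ge (hx : T / 2 ≤ ‖x‖) :
    (pr.deform hn hij hT hh hα hadm hs₁ hs₂).toFun x = h.toFun x := by
  rcases lt_or_ge ‖x‖ T with h1 | h1
  · rw [pr.deform_of_lt hn hij hT hh hα hadm hs₁ hs₂ h1]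
    exact pr.deformForm_eq_of_ge hn hij hT hh hα hadm hx h1
  · exact if_neg (not_lt.2 h1)

include hn hij hT hh in
theorem deformForm_eq_warpedForm (hadm : pr.IsAdmissible i B₀ h a) (hs₁ : s₁ ∈ Icc (0 : ℝ) 1)
    (hx0 : x ≠ 0) (hx : ‖x‖ < T) (v w : Euc n) : pr.deformForm i h a s₁ s₂ x v w =
      warpedForm (pr.deformFactor i h a s₁ s₂ x ^ (1 / α) *
        (1 + eulerDeriv (pr.deformReg i h a s₂) x))
        (pr.deformFactor i h a s₁ s₂ x ^ (1 / α) * ‖x‖) x v w :=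
  conformalForm_eq_warpedForm hij (pr.isSmoothRadial_deformReg hn hij hT hh) hx0 hx
    (pr.deformFactor_pos hadm.le hs₁ (confFactor_pos hn hij hh hx)) v w

include hn hij hT hh in
theorem isRadialOn_deformFactor : IsRadialOn T (pr.deformFactor i h a s₁ s₂) := by
  intro x y hx hxy
  rw [deformFactor, deformFactor, deformSq, deformSq,
    (pr.isSmoothRadial_deformReg hn hij hT hh).radial x y hx hxy,
    (isSmoothRadial_confFactor hn hij hh).radial x y hx hxy, hxy]

theorem isWarped_deform : (pr.deform hn hij hT hh hα hadm hs₁ hs₂).IsWarped := by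
  obtain ⟨g, f, hgf, hw⟩ := id hh
  have hJ : IsSmoothRadial T (pr.deformReg i h a s₂) := pr.isSmoothRadial_deformReg hn hij hT hh
  -- The warping functions are read off along the axis `i`. At `t = T`, which the formulas on the
  -- open ball do not reach, those of `h` are kept.
  refine ⟨fun t => if t < T then pr.deformFactor i h a s₁ s₂ (t • basisVec i) ^ (1 / α) *
      (1 + eulerDeriv (pr.deformReg i h a s₂) (t • basisVec i)) else g t,
    fun t => if t < T then pr.deformFactor i h a s₁ s₂ (t • basisVec i) ^ (1 / α) * t else f t,
    fun t ht => ?_, fun x hx0 hx v w => ?_⟩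
  · by_cases h1 : t < T
    · have h2 : ‖t • (basisVec i : Euc n)‖ < T := by rwa [norm_smul_basisVec ht.1.le]
      have h3 := Real.rpow_pos_of_pos (pr.deformFactor_pos (s₂ := s₂) hadm.le hs₁
        (confFactor_pos hn hij hh h2)) (1 / α)
      simp only [if_pos h1]
      exact ⟨mul_pos h3 (pr.eulerDeriv_deformReg_pos hn hij hT hh hadm.ray_le hs₂ h2),
        mul_pos h3 ht.1⟩
    · simp only [if_neg h1]
      exact hgf t ht
  · by_cases h1 : ‖x‖ < T
    · simp only [if_pos h1]
      have h2 : ‖x‖ = ‖‖x‖ • (basisVec i : Euc n)‖ := (norm_smul_basisVec (norm_nonneg x) i).symm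
      rw [pr.deform_of_lt hn hij hT hh hα hadm hs₁ hs₂ h1,
        pr.deformForm_eq_warpedForm hn hij hT hh hadm hs₁ hx0 h1,
        pr.isRadialOn_deformFactor hn hij hT hh x _ h1 h2, hJ.eulerDeriv.radial x _ h1 h2]
    · simp only [if_neg h1]
      rw [pr.deform_of_ge hn hij hT hh hα hadm hs₁ hs₂ (by linarith)]
      exact hw x hx0 hx v w

end Warped

theorem deform_mem_warpedMetrics (hn : 3 ≤ n) (hij : i ≠ j) (hT : 0 < T) (hα : α = (n - 2) / 2)
    (hα0 : α ≠ 0) (hc : c = α / (2 * (n - 1))) (hB₀ : 0 ≤ B₀) (hh : h ∈ warpedMetrics n T B₀)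
    (hadm : pr.IsAdmissible i B₀ h a) (hs₁ : s₁ ∈ Icc (0 : ℝ) 1) (hs₂ : s₂ ∈ Icc (0 : ℝ) 1)
    (hs : s₂ = 0 ∨ s₁ = 1) (hn2 : 2 ≤ n) :
    pr.deform hn2 hij hT (isWarped_of_mem hh) hα0 hadm hs₁ hs₂ ∈ warpedMetrics n T B₀ := by
  refine ⟨pr.isWarped_deform hn2 hij hT _ hα0 hadm hs₁ hs₂, fun x hx => ?_⟩
  rcases le_or_gt ‖x‖ (T / 2) with h1 | h1
  · exact pr.lt_scalarCurvature_of_norm_le hn hij hT (isWarped_of_mem hh) hα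
      (fun y hy => pr.deform_of_lt hn2 hij hT _ hα0 hadm hs₁ hs₂ hy) hc hB₀ hadm hs₁ hs₂ hs h1
  · rw [scalarCurvature_congr (V := {y | T / 2 < ‖y‖}) (isOpen_lt continuous_const continuous_norm)
      (fun y hy => pr.deform_of_ge hn2 hij hT _ hα0 hadm hs₁ hs₂ (le_of_lt hy)) h1]
    exact hh.2 x hx

/-- On the core disc the deformation ends in the torpedo metric. -/
theorem hasWarpingOn_deform {ε : ℝ} (hf : IsTorpedoFunction ε T f₀) (hn : 2 ≤ n) (hij : i ≠ j)
    (hT : 0 < T) (hh : h.IsWarped) (hα : 0 < α) (hadm : pr.IsAdmissible i B₀ h a)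
    (hs₁ : s₁ ∈ Icc (0 : ℝ) 1) (hs₂ : s₂ ∈ Icc (0 : ℝ) 1) (h₁ : s₁ = 1) (h₂ : s₂ = 1) :
    HasWarpingOn (pr.deform hn hij hT hh hα.ne' hadm hs₁ hs₂) (pr.coreRadius i h a)
      (fun _ => T / pr.coreRadius i h a) (fun t => f₀ (T / pr.coreRadius i h a * t)) := by
  subst h₁ h₂
  have hr := pr.coreRadius_pos (i := i) h a
  intro x hx0 hx v w
  have hxn : 0 < ‖x‖ := norm_pos_iff.2 hx0
  have hxT : ‖x‖ < T := by
    have := hadm.radius_le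
    linarith
  set ρ := T / pr.coreRadius i h a with hρ
  have hρ0 : 0 < ρ := div_pos hT hr
  have hρx : ‖ρ • x‖ = ρ * ‖x‖ := by rw [norm_smul, Real.norm_of_nonneg hρ0.le]
  have hρxT : ‖ρ • x‖ ≤ T := by
    rw [hρx, hρ, div_mul_eq_mul_div, div_le_iff₀ hr]
    exact mul_le_mul_of_nonneg_left hx hT.le
  have hρx0 : ρ • x ≠ 0 := smul_ne_zero hρ0.ne' hx0
  have hfpos : 0 < f₀ (ρ * ‖x‖) := hf.apply_pos (by positivity) (hρx ▸ hρxT)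
  -- On the core disc the argument of the cutoff is at most `1`, so the cutoff is `1` near every
  -- point, including the boundary of the disc.
  have heq : pr.deformReg i h a 1 =ᶠ[𝓝 x] pr.coreReg i h a := by
    have h1 : ContinuousAt (fun y : Euc n => ‖y‖ ^ 2 / pr.coreRadius i h a ^ 2) x := by fun_prop
    have h2 : ‖x‖ ^ 2 / pr.coreRadius i h a ^ 2 < 2 := by
      rw [div_lt_iff₀ (by positivity)]
      have := pow_le_pow_left₀ hxn.le hx 2
      nlinarith [pow_pos hr 2]
    filter_upwards [h1.eventually_lt_const h2] with y hy
    rw [deformReg, coreCut_of_le hy.le]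
    ring
  have hspeed : 1 + eulerDeriv (pr.deformReg i h a 1) x = ρ * ‖x‖ / f₀ (ρ * ‖x‖) := by
    rw [eulerDeriv_congr heq, pr.one_add_eulerDeriv_coreReg, pr.J_speed_eq _ hρx0 hρxT, hρx]
  -- The coordinate is `a` plus that of the torpedo at `ρ • x`, so the factor gives `t ^ α u = f₀ (ρ
  -- t) ^ α`. Taking the power `1 / α` yields the radius of the sphere.
  have hfac : pr.deformFactor i h a 1 1 x ^ (1 / α) * ‖x‖ = f₀ (ρ * ‖x‖) := by
    have h1 := pr.mul_deformFactor_core (s₂ := 1) hadm.le hx0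
      (pr.coord_deformReg_le hT hadm.ray_le hs₂ hx0 (by linarith))
    rw [heq.eq_of_nhds, pr.coord_coreReg hT hx0, add_sub_cancel_right, pr.y_coord _ hρx0 hρxT,
      hρx] at h1
    have hp := pr.deformFactor_pos (s₂ := 1) hadm.le hs₁ (confFactor_pos (α := α) hn hij hh hxT)
    have h2 := congrArg (fun z : ℝ => z ^ (1 / α)) h1
    rw [Real.mul_rpow (by positivity) hp.le, ← Real.rpow_mul hxn.le, ← Real.rpow_mul hfpos.le,
      mul_one_div_cancel hα.ne', Real.rpow_one, Real.rpow_one] at h2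
    rw [← h2, mul_comm]
  rw [pr.deform_of_lt hn hij hT hh hα.ne' hadm hs₁ hs₂ hxT,
    pr.deformForm_eq_warpedForm hn hij hT hh hadm hs₁ hx0 hxT, hfac, hspeed]
  congr 1
  rw [← hfac] at hfpos ⊢
  have : 0 < pr.deformFactor i h a 1 1 x ^ (1 / α) := pos_of_mul_pos_left hfpos hxn.le
  field_simp

end TorpedoProfile

end

/-! ### Assembly of the homotopy -/

theorem theorem3p1 (n : ℕ) (hn : 3 ≤ n) (B : ℝ) (hB : 0 ≤ B) (T₀ : ℝ) (hT₀ : 0 < T₀)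
    (ε₀ : ℝ) (f₀ : ℝ → ℝ) (hf₀ : IsTorpedoFunction ε₀ T₀ f₀)
    (g₀ : DiscMetric n T₀) (hg₀ : HasWarpingOn g₀ T₀ (fun _ => 1) f₀)
    (hg₀W : g₀ ∈ warpedMetrics n T₀ B) :
    ∃ δ : ℝ, 0 < δ ∧ δ < T₀ ∧
      ∃ Ψ : warpedMetrics n T₀ B × unitInterval → warpedMetrics n T₀ B,
        Continuous Ψ ∧
        (∀ h, Ψ (h, 0) = h) ∧
        (∀ h, (Ψ (h, 1) : DiscMetric n T₀) ∈ locallyTorpedoMetrics n T₀ B f₀) ∧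
        (∀ h s, ∀ x : Euc n, T₀ - δ ≤ ‖x‖ → ‖x‖ ≤ T₀ →
          (Ψ (h, s) : DiscMetric n T₀).toFun x = (h : DiscMetric n T₀).toFun x) := by
  have hn2 : 2 ≤ n := by omega
  have hα : (0 : ℝ) < ((n : ℝ) - 2) / 2 := by
    have : (3 : ℝ) ≤ n := by exact_mod_cast hn
    linarith
  obtain ⟨B', w₁, hBB', ⟨pr⟩⟩ := hf₀.exists_torpedoProfile hn hg₀ hB hg₀W.2 rfl
  obtain ⟨i, j, hij⟩ : ∃ i j : Fin n, i ≠ j := ⟨⟨0, by omega⟩, ⟨1, by omega⟩, by simp⟩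
  obtain ⟨a, ha, hadm⟩ := pr.exists_continuous_isAdmissible hn hij hT₀ rfl rfl hB hBB'
  -- The factor moves during the first half of the time and the coordinate during the second. So at
  -- every time the coordinate is still that of `h` or the core is already a torpedo.
  have hs₁ : ∀ s : unitInterval, min (2 * (s : ℝ)) 1 ∈ Icc (0 : ℝ) 1 := fun s =>
    ⟨le_min (mul_nonneg zero_le_two s.2.1) zero_le_one, min_le_right _ _⟩
  have hs₂ : ∀ s : unitInterval, max (2 * (s : ℝ) - 1) 0 ∈ Icc (0 : ℝ) 1 := fun s =>
    ⟨le_max_right _ _, max_le (by linarith [s.2.2]) zero_le_one⟩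
  have hs : ∀ s : unitInterval, max (2 * (s : ℝ) - 1) 0 = 0 ∨ min (2 * (s : ℝ)) 1 = 1 := fun s =>
    (le_total (2 * (s : ℝ)) 1).imp (fun h => max_eq_right (by linarith)) fun h => min_eq_right h
  let Φ : warpedMetrics n T₀ B × unitInterval → DiscMetric n T₀ := fun q =>
    pr.deform hn2 hij hT₀ (DiscMetric.isWarped_of_mem q.1.2) hα.ne' (hadm q.1) (hs₁ q.2) (hs₂ q.2)
  have hΦmem : ∀ q, Φ q ∈ warpedMetrics n T₀ B := fun q =>
    pr.deform_mem_warpedMetrics hn hij hT₀ rfl hα.ne' rfl hB q.1.2 (hadm q.1) (hs₁ q.2) (hs₂ q.2)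
      (hs q.2) hn2
  have hΦge : ∀ q x, T₀ / 2 ≤ ‖x‖ → (Φ q).toFun x = q.1.1.toFun x := fun q x hx =>
    pr.deform_of_ge hn2 hij hT₀ _ hα.ne' (hadm q.1) (hs₁ q.2) (hs₂ q.2) hx
  have hΦlt : ∀ q x, ‖x‖ < T₀ → (Φ q).toFun x = pr.deformForm i q.1.1 (a q.1)
      (min (2 * (q.2 : ℝ)) 1) (max (2 * (q.2 : ℝ) - 1) 0) x := fun q x hx =>
    pr.deform_of_lt hn2 hij hT₀ _ hα.ne' (hadm q.1) (hs₁ q.2) (hs₂ q.2) hx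
  let π : warpedMetrics n T₀ B × unitInterval → WarpedMetric n T₀ := fun q =>
    ⟨q.1.1, DiscMetric.isWarped_of_mem q.1.2⟩
  have hπ : Continuous π := (continuous_subtype_val.comp continuous_fst).subtype_mk _
  have ha' : Continuous fun q : warpedMetrics n T₀ B × unitInterval => a q.1 :=
    ha.comp continuous_fst
  have hsub : Continuous fun q : warpedMetrics n T₀ B × unitInterval => (q.2 : ℝ) :=
    continuous_subtype_val.comp continuous_snd
  have c₁ : Continuous fun q : warpedMetrics n T₀ B × unitInterval => min (2 * (q.2 : ℝ)) 1 :=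
    (continuous_const.mul hsub).min continuous_const
  have c₂ : Continuous fun q : warpedMetrics n T₀ B × unitInterval => max (2 * (q.2 : ℝ) - 1) 0 :=
    ((continuous_const.mul hsub).sub continuous_const).max continuous_const
  have hΦ : Continuous Φ := by
    -- The comparison family is the projection to `h`, with which the deformation agrees for `‖x‖ ≥
    -- T₀ / 2`. Only joint smoothness on the open ball remains to be checked.
    refine DiscMetric.continuous_of_eq_off_ball (Φ₀ := fun q => q.1.1)
      (continuous_subtype_val.comp continuous_fst) (half_lt_self hT₀) (fun v w => ?_) hΦge
    refine (IsSmoothFamily.conformalForm (i := i) (α := (n - 2) / 2)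
      (pr.isSmoothFamily_deformFactor hn2 hij hT₀ hπ ha' c₁ c₂)
      (pr.isSmoothFamily_deformReg hn2 hij hT₀ hπ ha' c₂) (fun q x hx => ?_) v w).congr
      Metric.isOpen_ball fun q x hx => ?_
    · exact pr.deformFactor_pos (hadm q.1).le (hs₁ q.2)
        (DiscMetric.confFactor_pos hn2 hij (DiscMetric.isWarped_of_mem q.1.2) hx)
    · rw [hΦlt q x (by simpa using hx)]
      rfl
  refine ⟨T₀ / 2, half_pos hT₀, half_lt_self hT₀, fun q => ⟨Φ q, hΦmem q⟩, hΦ.subtype_mk _,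
    fun h => ?_, fun h => ⟨hΦmem _, ?_⟩, fun h s x hx _ => hΦge (h, s) x (by linarith)⟩
  · refine Subtype.ext (DiscMetric.ext (funext fun x => ?_))
    rcases lt_or_ge ‖x‖ T₀ with hx | hx
    · rw [hΦlt _ x hx]
      simpa using pr.deformForm_zero hn2 hij hT₀ (DiscMetric.isWarped_of_mem h.2) hα.ne' hx
    · exact hΦge _ x (by linarith)
  · refine ⟨_, ⟨pr.coreRadius_pos _ _, ?_⟩, pr.hasWarpingOn_deform hf₀ hn2 hij hT₀
      (DiscMetric.isWarped_of_mem h.2) hα (hadm h) (hs₁ 1) (hs₂ 1) (by norm_num) (by norm_num)⟩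
    have := (hadm h).radius_le
    linarith [pr.coreRadius_pos (i := i) h.1 (a h)]
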